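/- Let $(\Omega,\Sigma,P)$ be a probability space, $\{\mathcal F_t\}_{t\ge 0}$ a filtration that is right continuous and such that $\mathcal F_0$ contains all $P$-null sets of $\mathcal F_\infty$, let $N\ge 2$, and let $W^1,\dots,W^N$ be independent standard Wiener processes adapted to $\{\mathcal F_t\}$. $C^k(\mathbb T)$ is the space of $1$-periodic functions on $\mathbb R$ with $k$ continuous derivatives, with norm $\|f\|_{C^k}=\sum_{j\le k}\sup_x|f^{(j)}(x)|$. For $t_0\le\tau$, $\mathcal C^k([t_0,\tau];\mathbb T)$ is the set of processes $u$ such that almost surely $u_t\in C^k(\mathbb T)$ for all $t\in[t_0,\tau]$ and $t\mapsto u_t$ is continuous from $[t_0,\tau]$ to $C^k(\mathbb T)$, and such that $u_{\tau\wedge t}$ is $\mathcal F_t$-measurable for all $t\ge t_0$. For $s,\tau\ge 0$ and data $g$ at time $s$, write $u_t=S^{\tau}_{s,t}g$ $(t\ge s)$ if $u\in\mathcal C^1([s,\tau\vee s];\mathbb T)$ is the unique (up to indistinguishability) process in this space for which, almost surely, for all $t\ge s$ and $a\in\mathbb R$, $$X^i_t(a)=a+\int_s^{(\tau\vee s)\wedge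 t}u_r(X^i_r(a))\,dr+W^i_{(\tau\vee s)\wedge t}-W^i_s,\qquad A^i_t=(X^i_t)^{-1},\qquad u_t=\frac1N\sum_{i=1}^N g\circ A^i_t ,$$ where $X^i_t$, $1\le i\le N$, are adapted random bijections of $\mathbb R$. For $\delta_t>0$, a process $u^{\delta_t}$ solves the reset system on $[t_0,\tau]$ with data $u_{t_0}$ if $u^{\delta_t}_{t_0}=u_{t_0}$ and $$u^{\delta_t}_t=S^{\tau}_{t_0+k\delta_t,\,t}\,u^{\delta_t}_{t_0+k\delta_t}\qquad\text{for } t\in(t_0+k\delta_t,\,t_0+(k+1)\delta_t],\ k=0,1,2,\dots,$$ almost surely. Then there are functions $T:[0,\infty)\to(0,\infty)$ and $U:[0,\infty)\times\mathbb N\to[0,\infty)$, not depending on the probability space, the filtration, $N$, the Wiener processes, $t_0$, the data or $\delta_t$, such that the following holds. Let $t_0\ge 0$, let $u_{t_0}$ be a $C^1(\mathbb T)$-valued $\mathcal F_{t_0}$-measurable random variable with $\|u_{t_0}\|_{C^1}\le U^0_1$ almost surely for a constant $U^0_1\ge0$, and put $T_0=t_0+T(U^0_1)$. Then for every $\delta_t>0$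 there is a process $u^{\delta_t}\in\mathcal C^1([t_0,T_0];\mathbb T)$ that solves the reset system on $[t_0,T_0]$ with data $u_{t_0}$. If further, for some $n\ge1$, $u_{t_0}$ is a $C^n(\mathbb T)$-valued $\mathcal F_{t_0}$-measurable random variable with $\|u_{t_0}\|_{C^n}\le U^0_n$ almost surely for a constant $U^0_n\ge0$, then every such $u^{\delta_t}$ is in $\mathcal C^n([t_0,T_0];\mathbb T)$, and, for all $\delta_t<T_0$, almost surely $$\sup_{t_0\le t\le T_0}\|u^{\delta_t}_t\|_{C^n}\le U(U^0_n,n).$$ -/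

import Mathlib

open MeasureTheory ProbabilityTheory Set Filter Topology
open scoped NNReal

namespace BurgersReset

/-- `f ∈ C^k(𝕋)`: a real function on the line, periodic with period `1`, that has `k` continuous
derivatives. -/
def IsCk (k : ℕ) (f : ℝ → ℝ) : Prop :=
  Function.Periodic f 1 ∧ ContDiff ℝ k f

/-- The norm `‖f‖_{C^k} = ∑_{j ≤ k} sup_x |f^{(j)}(x)|` of `f ∈ C^k(𝕋)` (each supremum is finite,
as a continuous periodic function is bounded). -/
noncomputable def ckNorm (k : ℕ) (f : ℝ → ℝ) : ℝ :=
  ∑ j ∈ Finset.range (k + 1), ⨆ x : ℝ, |iteratedDeriv j f x|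

section Processes

variable {Ω : Type*} {mΩ : MeasurableSpace Ω}

/-- The usual conditions: the filtration is right continuous, and `ℱ_0` contains all `P`-null sets
of `ℱ_∞`, the sigma algebra generated by all the `ℱ_t`. -/
structure UsualConditions (F : Filtration ℝ≥0 mΩ) (P : Measure Ω) : Prop where
  rightContinuous : F.IsRightContinuous
  nullSets : ∀ s : Set Ω, MeasurableSet[⨆ t, F t] s → P s = 0 → MeasurableSet[F 0] s

/-- `W^1, …, W^N` are independent standard Wiener processes adapted to the filtration. -/
structure IsWienerFamily {N : ℕ} (F : Filtration ℝ≥0 mΩ) (P : Measure Ω)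
    (W : Fin N → ℝ≥0 → Ω → ℝ) : Prop where
  brownian : ∀ i, IsBrownianReal (W i) P
  adapted : ∀ i t, Measurable[F t] (W i t)
  indep : iIndepFun (fun (i : Fin N) (ω : Ω) (t : ℝ≥0) => W i t ω) P

/-- `f` is a `C^k(𝕋)`-valued `ℱ_t`-measurable random variable. Measurability is that of all the
evaluations `ω ↦ f ω x` (the product sigma algebra); since `C^k(𝕋)` is a separable Banach space,
on `C^k(𝕋)` these evaluations generate the Borel sigma algebra. -/
structure IsCkRandomVariable (F : Filtration ℝ≥0 mΩ) (t : ℝ≥0) (k : ℕ) (f : Ω → ℝ → ℝ) :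
    Prop where
  measurable : Measurable[F t] f
  mem : ∀ ω, IsCk k (f ω)

/-- The space `𝒞^k([t₀, τ]; 𝕋)` for a deterministic time `τ`, with the convention that `τ` is
replaced by `τ ∨ t₀`: almost surely `u_t ∈ C^k(𝕋)` for all `t ∈ [t₀, τ]` and `t ↦ u_t` is
continuous on `[t₀, τ]` for the `C^k` norm, and `u_{τ ∧ t}` is `ℱ_t`-measurable for `t ≥ t₀`. -/
structure IsCkProcess (F : Filtration ℝ≥0 mΩ) (P : Measure Ω) (t₀ τ : ℝ≥0) (k : ℕ)
    (u : ℝ≥0 → Ω → ℝ → ℝ) : Prop where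
  mem : ∀ᵐ ω ∂P, ∀ t ∈ Icc t₀ (max τ t₀), IsCk k (u t ω)
  continuous : ∀ᵐ ω ∂P, ∀ t ∈ Icc t₀ (max τ t₀),
    Tendsto (fun s => ckNorm k (u s ω - u t ω)) (𝓝[Icc t₀ (max τ t₀)] t) (𝓝 0)
  adapted : ∀ t, t₀ ≤ t → Measurable[F t] (u (min (max τ t₀) t))

/-- `u ∈ 𝒞^1([t₀, τ]; 𝕋)` is a fixed point of the particle system (with `ν = 1/2`, stopped at the
deterministic time `τ`, which is replaced by `τ ∨ t₀`) with data `f` at time `t₀`: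
`X^i_t(a) = a + ∫_{t₀}^{τ ∧ t} u_s(X^i_s(a)) ds + W^i_{τ ∧ t} - W^i_{t₀}`, `A^i_t = (X^i_t)⁻¹` and
`u_t = (1/N) ∑_i f ∘ A^i_t`, almost surely, for all `t ≥ t₀` and all points of the line. -/
def IsFixedPoint {N : ℕ} (F : Filtration ℝ≥0 mΩ) (P : Measure Ω) (W : Fin N → ℝ≥0 → Ω → ℝ)
    (t₀ τ : ℝ≥0) (f : Ω → ℝ → ℝ) (u : ℝ≥0 → Ω → ℝ → ℝ) : Prop :=
  IsCkProcess F P t₀ τ 1 u ∧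
  ∃ X A : Fin N → ℝ≥0 → Ω → ℝ → ℝ,
    (∀ i t, t₀ ≤ t → Measurable[F t] (X i t)) ∧
    ∀ᵐ ω ∂P, ∀ t, t₀ ≤ t →
      (∀ i a,
        IntervalIntegrable (fun s : ℝ => u s.toNNReal ω (X i s.toNNReal ω a)) volume
          (t₀ : ℝ) (min (max τ t₀) t : ℝ≥0) ∧
        X i t ω a = a
          + (∫ s in (t₀ : ℝ)..(min (max τ t₀) t : ℝ≥0), u s.toNNReal ω (X i s.toNNReal ω a))
          + (W i (min (max τ t₀) t) ω - W i t₀ ω)) ∧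
      (∀ i, Function.LeftInverse (A i t ω) (X i t ω) ∧
        Function.RightInverse (A i t ω) (X i t ω)) ∧
      ∀ x, u t ω x = (1 / (N : ℝ)) * ∑ i, f ω (A i t ω x)

/-- `u_t = S^{N,τ}_{t₀,t} f` for `t ≥ t₀`: `u` is the unique fixed point of the particle system with
data `f` at time `t₀` (unique up to indistinguishability). -/
def IsSolution {N : ℕ} (F : Filtration ℝ≥0 mΩ) (P : Measure Ω) (W : Fin N → ℝ≥0 → Ω → ℝ)
    (t₀ τ : ℝ≥0) (f : Ω → ℝ → ℝ) (u : ℝ≥0 → Ω → ℝ → ℝ) : Prop :=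
  IsFixedPoint F P W t₀ τ f u ∧
  ∀ v, IsFixedPoint F P W t₀ τ f v → ∀ᵐ ω ∂P, ∀ t, t₀ ≤ t → v t ω = u t ω

/-- `u` solves the reset system with resetting time `δ`: `u_{t₀} = f`, and
`u_t = S^{N,τ}_{t₀ + kδ, t} u_{t₀ + kδ}` for `t ∈ (t₀ + kδ, t₀ + (k+1)δ]`, `k = 0, 1, 2, …`. -/
def IsResetSolution {N : ℕ} (F : Filtration ℝ≥0 mΩ) (P : Measure Ω)
    (W : Fin N → ℝ≥0 → Ω → ℝ) (δ t₀ τ : ℝ≥0) (f : Ω → ℝ → ℝ) (u : ℝ≥0 → Ω → ℝ → ℝ) : Prop :=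
  (∀ᵐ ω ∂P, u t₀ ω = f ω) ∧
  ∀ k : ℕ, ∃ v : ℝ≥0 → Ω → ℝ → ℝ,
    IsSolution F P W (t₀ + k * δ) τ (u (t₀ + k * δ)) v ∧
    ∀ᵐ ω ∂P, ∀ t ∈ Ioc (t₀ + k * δ) (t₀ + (k + 1) * δ), u t ω = v t ω

end Processes

end BurgersReset

open MeasureTheory ProbabilityTheory Set Filter Topology
open scoped NNReal

namespace BurgersReset

/-! Everything is proved along one path of the driving processes. The forcing moves all particles
with the same index `i` by the same amount, so it cancels in the difference of two positions: it
enters neither the Lipschitz constants nor the equations for spatial derivatives along particles. On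
a window that is short compared to the inverse Lipschitz constant of the data, the displacements `X
a - a - p` are the fixed point of a contraction (`IsData.nextDisp_disp`), and the same estimates
give uniqueness (`IsData.sol_unique`).

The bounds must not deteriorate with the number of resets, so each of them is put in a form that
composes exactly over successive windows. A Lipschitz constant `G` becomes at most `G / (1 - 3 * G *
t)`, which is the flow of the equation `y' = 3 * y ^ 2` (`IsData.lip_sol`). Each field `g ∘ A i` is
constant along the particles `X i`, so its derivatives satisfy transport equations along them, with
the Leibniz source `src`. From order two on this source is affine in the top order, with
coefficients controlled by the lower orders, and Grönwall multiplies a bound on `|y| + M` by `exp (α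
* t)` (`transport_gronwall`, `IsData.derivControl_sol`). Averaging over `i` preserves both bounds,
and a reset merely restarts all fields from their average. Hence the bounds depend on the elapsed
time only, and `Controlled` passes through any number of windows. The admissible time is dictated by
the first of them, that is, by the Lipschitz constant of the data; this is why `T` depends on the
`C^1` norm alone.

Regularity of order `n` is obtained without differentiating the flow. Candidates for the derivatives
are constructed as solutions of the transport hierarchy (`IsTower.exists_succ`), and the remainder
of the first order expansion satisfies a linear integral inequality that forces it to vanish to
first order (`IsTower.uniformDeriv`).

Probability enters through measurability: the Picard iterates use the past of the forcing only, the
usual conditions provide continuous adapted versions of the Wiener processes, and the data have a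
version with a deterministic Lipschitz constant. Conversely, uniqueness on each window identifies
almost every path of any reset solution with the pathwise construction, so that the bounds hold for
every solution. -/

/-! ### Averages and elementary integral estimates -/

/-- The mean of a finite family of real numbers. -/
noncomputable def avg {N : ℕ} (f : Fin N → ℝ) : ℝ := (1 / (N : ℝ)) * ∑ i, f i

theorem avg_sub {N : ℕ} (f g : Fin N → ℝ) : avg f - avg g = avg fun i => f i - g i := by
  simp only [avg, Finset.sum_sub_distrib]; ring

theorem avg_mul {N : ℕ} (f : Fin N → ℝ) (c : ℝ) : avg f * c = avg fun i => f i * c := by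
  simp only [avg, ← Finset.sum_mul]; ring

theorem avg_const {N : ℕ} [NeZero N] (c : ℝ) : avg (fun _ : Fin N => c) = c := by
  have : (N : ℝ) ≠ 0 := Nat.cast_ne_zero.mpr (NeZero.ne N)
  simp [avg, this]

theorem abs_avg_le {N : ℕ} {f : Fin N → ℝ} {M : ℝ} (hM : 0 ≤ M) (h : ∀ i, |f i| ≤ M) :
    |avg f| ≤ M := by
  rcases Nat.eq_zero_or_pos N with rfl | hN
  · simpa [avg] using hM
  · have hN' : (0 : ℝ) < N := Nat.cast_pos.mpr hN
    have h1 : |∑ i, f i| ≤ N * M := by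
      refine (Finset.abs_sum_le_sum_abs _ _).trans ((Finset.sum_le_sum fun i _ => h i).trans ?_)
      simp
    rw [avg, abs_mul, abs_of_pos (by positivity), one_div, inv_mul_le_iff₀ hN']
    exact h1

theorem continuous_avg {N : ℕ} {Y : Type*} [TopologicalSpace Y] {f : Fin N → Y → ℝ}
    (h : ∀ i, Continuous (f i)) : Continuous fun y => avg fun i => f i y := by
  unfold avg
  exact continuous_const.mul (continuous_finsetSum _ fun i _ => h i)

theorem abs_integral_le {f : ℝ → ℝ} {a b C : ℝ} (hab : a ≤ b)
    (h : ∀ r ∈ Icc a b, |f r| ≤ C) : |∫ r in a..b, f r| ≤ C * (b - a) := by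
  have := intervalIntegral.norm_integral_le_of_norm_le_const (f := f) (a := a) (b := b) (C := C) ?_
  · rwa [Real.norm_eq_abs, abs_of_nonneg (sub_nonneg.mpr hab)] at this
  · intro x hx
    rw [uIoc_of_le hab] at hx
    exact h x ⟨hx.1.le, hx.2⟩

theorem abs_integral_sub_le {f f' : ℝ → ℝ} {a b C : ℝ} (hab : a ≤ b)
    (hf : IntervalIntegrable f volume a b) (hf' : IntervalIntegrable f' volume a b)
    (h : ∀ r ∈ Icc a b, |f r - f' r| ≤ C) :
    |(∫ r in a..b, f r) - ∫ r in a..b, f' r| ≤ C * (b - a) := by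
  rw [← intervalIntegral.integral_sub hf hf']
  exact abs_integral_le hab h

theorem tendsto_mul_half_pow (C : ℝ) :
    Tendsto (fun k : ℕ => C * (1 / 2 : ℝ) ^ k) atTop (𝓝 0) := by
  simpa using (tendsto_pow_atTop_nhds_zero_of_lt_one (r := (1 / 2 : ℝ)) (by norm_num)
    (by norm_num)).const_mul C

/-! ### Flows of particles -/

/-- The projection of the real line to the interval `[s, τ]`. -/
noncomputable def clampTime (s τ t : ℝ) : ℝ := max s (min t τ)

theorem clampTime_of_mem {s τ t : ℝ} (h : t ∈ Icc s τ) : clampTime s τ t = t := by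
  rw [clampTime, min_eq_left h.2, max_eq_right h.1]

theorem clampTime_mem {s τ : ℝ} (h : s ≤ τ) (t : ℝ) : clampTime s τ t ∈ Icc s τ :=
  ⟨le_max_left _ _, max_le h (min_le_right _ _)⟩

theorem continuous_clampTime (s τ : ℝ) : Continuous (clampTime s τ) := by
  unfold clampTime; fun_prop

/-- `X i t` are homeomorphisms of the line with inverses `A i t`, jointly continuous in time and
space, and Lipschitz with constant `2` in space. -/
structure IsFlow {N : ℕ} (X A : Fin N → ℝ → ℝ → ℝ) : Prop where
  contX : ∀ i, Continuous fun q : ℝ × ℝ => X i q.1 q.2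
  contA : ∀ i, Continuous fun q : ℝ × ℝ => A i q.1 q.2
  left : ∀ i t a, A i t (X i t a) = a
  right : ∀ i t x, X i t (A i t x) = x
  lipX : ∀ i t a b, |X i t a - X i t b| ≤ 2 * |a - b|
  lipA : ∀ i t x y, |A i t x - A i t y| ≤ 2 * |x - y|

/-- Jointly continuous displacements that are Lipschitz with constant `1/2` in space. -/
structure IsDisplacement {N : ℕ} (d : Fin N → ℝ → ℝ → ℝ) : Prop where
  cont : ∀ i, Continuous fun q : ℝ × ℝ => d i q.1 q.2
  lip : ∀ i t a b, |d i t a - d i t b| ≤ 1 / 2 * |a - b|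

/-- The position of the particle with label `a`, displacement `d` and forcing path `p`. -/
def posn {N : ℕ} (p : Fin N → ℝ → ℝ) (d : Fin N → ℝ → ℝ → ℝ) (i : Fin N) (t a : ℝ) : ℝ :=
  a + d i t a + p i t

/-- The label of the particle at a given position. -/
noncomputable def lab {N : ℕ} (p : Fin N → ℝ → ℝ) (d : Fin N → ℝ → ℝ → ℝ) (i : Fin N) (t : ℝ) :
    ℝ → ℝ :=
  Function.invFun (posn p d i t)

/-- The displacement can undo at most half of the slope of the identity, and the forcing does not
depend on the label. Monotonicity, bijectivity and the Lipschitz bound on labels all come from here.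
-/
theorem IsDisplacement.posn_expand {N : ℕ} {d : Fin N → ℝ → ℝ → ℝ} (hd : IsDisplacement d)
    (p : Fin N → ℝ → ℝ) (i : Fin N) (t : ℝ) {a b : ℝ} (hab : a ≤ b) :
    1 / 2 * (b - a) ≤ posn p d i t b - posn p d i t a := by
  have h := hd.lip i t a b
  rw [abs_of_nonpos (sub_nonpos.mpr hab), abs_le] at h
  unfold posn
  linarith [h.1, h.2]

theorem IsDisplacement.posn_bijective {N : ℕ} {d : Fin N → ℝ → ℝ → ℝ} (hd : IsDisplacement d)
    (p : Fin N → ℝ → ℝ) (i : Fin N) (t : ℝ) : Function.Bijective (posn p d i t) := by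
  have hmono : StrictMono (posn p d i t) := fun a b hab => by
    have := hd.posn_expand p i t hab.le
    linarith
  refine ⟨hmono.injective, Continuous.surjective ?_ ?_ ?_⟩
  · have := hd.cont i
    have h2 : Continuous fun a : ℝ => d i t a := this.comp (by fun_prop : Continuous fun a : ℝ => (t, a))
    unfold posn
    fun_prop
  · refine tendsto_atTop_mono' atTop (f₁ := fun a => 1 / 2 * a + posn p d i t 0) ?_ ?_
    · filter_upwards [eventually_ge_atTop 0] with a ha
      linarith [hd.posn_expand p i t ha]
    · exact tendsto_atTop_add_const_right _ _ (tendsto_id.const_mul_atTop (by norm_num))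
  · refine tendsto_atBot_mono' atBot (f₂ := posn p d i t)
      (f₁ := fun a => 1 / 2 * a + posn p d i t 0) ?_ ?_
    · filter_upwards [eventually_le_atBot 0] with a ha
      linarith [hd.posn_expand p i t ha]
    · exact tendsto_atBot_add_const_right _ _ (tendsto_id.const_mul_atBot (by norm_num))

theorem IsDisplacement.isFlow {N : ℕ} {d : Fin N → ℝ → ℝ → ℝ} (hd : IsDisplacement d)
    {p : Fin N → ℝ → ℝ} (hp : ∀ i, Continuous (p i)) : IsFlow (posn p d) (lab p d) := by
  have hleft : ∀ i t a, lab p d i t (posn p d i t a) = a := fun i t =>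
    Function.leftInverse_invFun (hd.posn_bijective p i t).1
  have hright : ∀ i t x, posn p d i t (lab p d i t x) = x := fun i t =>
    Function.rightInverse_invFun (hd.posn_bijective p i t).2
  have hexp : ∀ i t a b, |a - b| ≤ 2 * |posn p d i t a - posn p d i t b| := by
    intro i t a b
    rcases le_total a b with h | h
    · have := hd.posn_expand p i t h
      rw [abs_of_nonpos (by linarith), abs_of_nonpos (by linarith)]; linarith
    · have := hd.posn_expand p i t h
      rw [abs_of_nonneg (by linarith), abs_of_nonneg (by linarith)]; linarith
  have hX : ∀ i, Continuous fun q : ℝ × ℝ => posn p d i q.1 q.2 := by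
    intro i
    have h1 := hd.cont i
    have h2 := hp i
    unfold posn
    fun_prop
  refine ⟨hX, ?_, hleft, hright, ?_, ?_⟩
  · intro i
    rw [continuous_iff_continuousAt]
    rintro ⟨t, x⟩
    rw [ContinuousAt, tendsto_iff_dist_tendsto_zero]
    -- By `hexp` at time `q.1` this dominates the distance between the labels at `q` and at `(t,
    -- x)`. The label in it is frozen, so it is continuous in `q` and vanishes at `(t, x)`.
    have hlim : Tendsto (fun q : ℝ × ℝ => 2 * |q.2 - posn p d i q.1 (lab p d i t x)|) (𝓝 (t, x))
        (𝓝 0) := by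
      have hc : Continuous fun q : ℝ × ℝ => 2 * |q.2 - posn p d i q.1 (lab p d i t x)| := by
        have := (hX i).comp
          (by fun_prop : Continuous fun q : ℝ × ℝ => (q.1, lab p d i t x))
        simp only [Function.comp_def] at this
        fun_prop
      have := hc.tendsto (t, x)
      simpa [hright] using this
    refine squeeze_zero (fun _ => dist_nonneg) (fun q => ?_) hlim
    have := hexp i q.1 (lab p d i q.1 q.2) (lab p d i t x)
    rwa [hright] at this
  · intro i t a b
    have h := hd.lip i t a b
    have h2 : posn p d i t a - posn p d i t b = (a - b) + (d i t a - d i t b) := by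
      unfold posn; ring
    rw [h2]
    refine (abs_add_le _ _).trans ?_
    linarith [abs_nonneg (a - b)]
  · intro i t x y
    have := hexp i t (lab p d i t x) (lab p d i t y)
    rwa [hright, hright] at this

/-! ### The fixed point of the particle system along a path -/

/-- The velocity field of the particles with displacement `d`. -/
noncomputable def vel {N : ℕ} (p : Fin N → ℝ → ℝ) (g : ℝ → ℝ) (d : Fin N → ℝ → ℝ → ℝ) (t x : ℝ) :
    ℝ :=
  avg fun j => g (lab p d j t x)

/-- The displacement that results from transport with the velocity field of `d`. -/
noncomputable def nextDisp {N : ℕ} (s τ : ℝ) (p : Fin N → ℝ → ℝ) (g : ℝ → ℝ)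
    (d : Fin N → ℝ → ℝ → ℝ) (i : Fin N) (t a : ℝ) : ℝ :=
  ∫ r in s..clampTime s τ t, vel p g d r (posn p d i r a)

/-- The Picard iterates of `nextDisp`. -/
noncomputable def dispIter {N : ℕ} (s τ : ℝ) (p : Fin N → ℝ → ℝ) (g : ℝ → ℝ) :
    ℕ → Fin N → ℝ → ℝ → ℝ
  | 0 => fun _ _ _ => 0
  | k + 1 => nextDisp s τ p g (dispIter s τ p g k)

/-- The limit of the Picard iterates. -/
noncomputable def disp {N : ℕ} (s τ : ℝ) (p : Fin N → ℝ → ℝ) (g : ℝ → ℝ) (i : Fin N) (t a : ℝ) :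
    ℝ :=
  limUnder atTop fun k => dispIter s τ p g k i t a

/-- Data for the particle system on `[s, τ]`: continuous forcing paths `p` that vanish at time `s`
and a periodic Lipschitz function `g`, on an interval that is short compared to its Lipschitz
constant. -/
structure IsData {N : ℕ} (s τ G : ℝ) (p : Fin N → ℝ → ℝ) (g : ℝ → ℝ) : Prop where
  le : s ≤ τ
  contp : ∀ i, Continuous (p i)
  zero : ∀ i, p i s = 0
  lip : ∀ x y, |g x - g y| ≤ G * |x - y|
  nonneg : 0 ≤ G
  per : Function.Periodic g 1
  small : 16 * G * (τ - s) ≤ 1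

theorem continuous_of_lip {g : ℝ → ℝ} {G : ℝ} (h : ∀ x y, |g x - g y| ≤ G * |x - y|) :
    Continuous g := by
  have : LipschitzWith G.toNNReal g := LipschitzWith.of_dist_le_mul fun x y => by
    refine (h x y).trans ?_
    rw [Real.dist_eq]
    exact mul_le_mul_of_nonneg_right (Real.le_coe_toNNReal G) (abs_nonneg _)
  exact this.continuous

theorem exists_bound_of_periodic {g : ℝ → ℝ} (hc : Continuous g) (hp : Function.Periodic g 1) :
    ∃ M, 0 ≤ M ∧ ∀ x, |g x| ≤ M := by
  obtain ⟨M, hM⟩ := (isCompact_Icc (a := (0 : ℝ)) (b := 1)).exists_bound_of_continuousOn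
    hc.continuousOn
  have key : ∀ x, |g x| ≤ M := fun x => by
    obtain ⟨y, hy, hxy⟩ := hp.exists_mem_Ico₀ one_pos x
    rw [hxy]
    exact hM y ⟨hy.1, hy.2.le⟩
  exact ⟨M, (abs_nonneg _).trans (key 0), key⟩

section Core

variable {N : ℕ} {s τ G : ℝ} {p : Fin N → ℝ → ℝ} {g : ℝ → ℝ}

theorem continuous_avg_comp_lab {A : Fin N → ℝ → ℝ → ℝ}
    (hA : ∀ i, Continuous fun q : ℝ × ℝ => A i q.1 q.2) (hg : Continuous g) :
    Continuous fun q : ℝ × ℝ => avg fun j => g (A j q.1 q.2) :=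
  continuous_avg fun j => hg.comp (hA j)

theorem IsData.continuous (H : IsData s τ G p g) : Continuous g := continuous_of_lip H.lip

theorem IsData.continuous_vel (H : IsData s τ G p g) {d : Fin N → ℝ → ℝ → ℝ}
    (hd : IsDisplacement d) : Continuous fun q : ℝ × ℝ => vel p g d q.1 q.2 :=
  continuous_avg_comp_lab (hd.isFlow H.contp).contA H.continuous

theorem continuous_along {h : ℝ → ℝ → ℝ} {X : ℝ → ℝ → ℝ}
    (hh : Continuous fun q : ℝ × ℝ => h q.1 q.2) (hX : Continuous fun q : ℝ × ℝ => X q.1 q.2)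
    (a : ℝ) : Continuous fun r => h r (X r a) :=
  hh.comp (continuous_id.prodMk (hX.comp (continuous_id.prodMk continuous_const)))

/-- The labels of one point `y` under `d` and `d'` are compared by moving the second label with the
flow of `d`: the forcing cancels and the miss is the difference of the displacements at a common
label. -/
theorem IsData.vel_sub_le (H : IsData s τ G p g) {d d' : Fin N → ℝ → ℝ → ℝ}
    (hd : IsDisplacement d) (hd' : IsDisplacement d') {r S : ℝ}
    (hS : ∀ i a, |d i r a - d' i r a| ≤ S) (hS0 : 0 ≤ S) (x y : ℝ) :
    |vel p g d r x - vel p g d' r y| ≤ G * (2 * |x - y| + 2 * S) := by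
  have hf := hd.isFlow H.contp
  have hf' := hd'.isFlow H.contp
  rw [vel, vel, avg_sub]
  have hG := H.nonneg
  refine abs_avg_le (by positivity) fun j => (H.lip _ _).trans ?_
  refine mul_le_mul_of_nonneg_left ?_ hG
  have h1 := hf.lipA j r x y
  have h2 : |lab p d j r y - lab p d' j r y| ≤ 2 * S := by
    have h3 := hf.lipA j r y (posn p d j r (lab p d' j r y))
    rw [hf.left] at h3
    refine h3.trans (mul_le_mul_of_nonneg_left ?_ zero_le_two)
    have h4 := hf'.right j r y
    have h5 : y - posn p d j r (lab p d' j r y)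
        = -(d j r (lab p d' j r y) - d' j r (lab p d' j r y)) := by
      nth_rewrite 1 [← h4]
      unfold posn; ring
    rw [h5, abs_neg]
    exact hS _ _
  calc |lab p d j r x - lab p d' j r y|
      ≤ |lab p d j r x - lab p d j r y| + |lab p d j r y - lab p d' j r y| := abs_sub_le _ _ _
    _ ≤ _ := by linarith

/-- The factor 3 is the Lipschitz constant 2 of the labels times the constant 3/2 of the positions
without forcing. The dependence on the elapsed time is kept because at the fixed point it improves
the a priori constant 1/2. -/
theorem IsData.lip_nextDisp (H : IsData s τ G p g) {d : Fin N → ℝ → ℝ → ℝ}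
    (hd : IsDisplacement d) (i : Fin N) (t a b : ℝ) :
    |nextDisp s τ p g d i t a - nextDisp s τ p g d i t b|
      ≤ 3 * G * (clampTime s τ t - s) * |a - b| := by
  have hv := H.continuous_vel hd
  have hf := hd.isFlow H.contp
  have hint := fun a => (continuous_along hv (hf.contX i) a).intervalIntegrable (μ := volume) s
    (clampTime s τ t)
  have h := abs_integral_sub_le (C := 3 * G * |a - b|) (clampTime_mem H.le t).1 (hint a) (hint b) ?_
  · refine h.trans (le_of_eq ?_)
    ring
  · intro r _
    have h1 := H.vel_sub_le hd hd (r := r) (S := 0) (by simp) le_rfl (posn p d i r a)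
      (posn p d i r b)
    refine h1.trans ?_
    have h2 : |posn p d i r a - posn p d i r b| ≤ 3 / 2 * |a - b| := by
      have h3 : posn p d i r a - posn p d i r b = (a - b) + (d i r a - d i r b) := by
        unfold posn; ring
      rw [h3]
      linarith [abs_add_le (a - b) (d i r a - d i r b), hd.lip i r a b]
    nlinarith [H.nonneg]

/-- Clamping the upper limit of the integral makes the iterates jointly continuous on the whole
plane, although the equation matters on `[s, τ]` only. -/
theorem IsData.isDisplacement_nextDisp (H : IsData s τ G p g) {d : Fin N → ℝ → ℝ → ℝ}
    (hd : IsDisplacement d) : IsDisplacement (nextDisp s τ p g d) := by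
  have hv := H.continuous_vel hd
  have hf := hd.isFlow H.contp
  refine ⟨fun i => ?_, fun i t a b => ?_⟩
  · refine intervalIntegral.continuous_parametric_intervalIntegral_of_continuous
      (f := fun (q : ℝ × ℝ) r => vel p g d r (posn p d i r q.2)) ?_
      ((continuous_clampTime s τ).comp continuous_fst)
    exact hv.comp (continuous_snd.prodMk ((hf.contX i).comp
      (continuous_snd.prodMk (continuous_snd.comp continuous_fst))))
  · refine (H.lip_nextDisp hd i t a b).trans ?_
    refine mul_le_mul_of_nonneg_right ?_ (abs_nonneg _)
    have := (clampTime_mem H.le t).2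
    have := H.small
    nlinarith [H.nonneg]

/-- The contraction estimate: displacements at distance `S` have velocities along their particles at
distance `G * (2 * S + 2 * S)`, and the window is short compared to `1 / G`. -/
theorem IsData.nextDisp_sub_le (H : IsData s τ G p g) {d d' : Fin N → ℝ → ℝ → ℝ}
    (hd : IsDisplacement d) (hd' : IsDisplacement d') {S : ℝ}
    (hS : ∀ i t a, |d i t a - d' i t a| ≤ S) (i : Fin N) (t a : ℝ) :
    |nextDisp s τ p g d i t a - nextDisp s τ p g d' i t a| ≤ 1 / 2 * S := by
  have hS0 : 0 ≤ S := (abs_nonneg _).trans (hS i t a)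
  have hint : ∀ d : Fin N → ℝ → ℝ → ℝ, IsDisplacement d → IntervalIntegrable
      (fun r => vel p g d r (posn p d i r a)) volume s (clampTime s τ t) := fun d hd =>
    (continuous_along (H.continuous_vel hd) ((hd.isFlow H.contp).contX i) a).intervalIntegrable _ _
  have h := abs_integral_sub_le (C := 4 * G * S) (clampTime_mem H.le t).1 (hint d hd)
    (hint d' hd') ?_
  · refine h.trans ?_
    have := (clampTime_mem H.le t).2
    have := H.small
    have h3 : 4 * G * (clampTime s τ t - s) ≤ 1 / 2 := by nlinarith [H.nonneg]
    nlinarith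
  · intro r _
    refine (H.vel_sub_le hd hd' (fun i a => hS i r a) hS0 _ _).trans ?_
    have h3 : posn p d i r a - posn p d' i r a = d i r a - d' i r a := by
      unfold posn; ring
    rw [h3]
    nlinarith [H.nonneg, hS i r a]

theorem IsData.isDisplacement_dispIter (H : IsData s τ G p g) (k : ℕ) :
    IsDisplacement (dispIter s τ p g k) := by
  induction k with
  | zero => exact ⟨fun _ => continuous_const, fun i t a b => by simp [dispIter]⟩
  | succ k ih => exact H.isDisplacement_nextDisp ih

theorem IsData.exists_rate (H : IsData s τ G p g) : ∃ M : ℝ, 0 ≤ M ∧ ∀ i t a,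
    Tendsto (fun k => dispIter s τ p g k i t a) atTop (𝓝 (disp s τ p g i t a)) ∧
    ∀ k, |dispIter s τ p g k i t a - disp s τ p g i t a| ≤ M * (1 / 2) ^ k := by
  obtain ⟨M, hM0, hM⟩ := exists_bound_of_periodic H.continuous H.per
  have hstep : ∀ k i t a, |dispIter s τ p g k i t a - dispIter s τ p g (k + 1) i t a|
      ≤ M * (τ - s) * (1 / 2) ^ k := by
    intro k
    induction k with
    | zero =>
      intro i t a
      have h := abs_integral_le (f := fun r => vel p g (dispIter s τ p g 0) r
        (posn p (dispIter s τ p g 0) i r a)) (C := M) (clampTime_mem H.le t).1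
        fun r _ => abs_avg_le hM0 fun j => hM _
      have h2 := (clampTime_mem H.le t).2
      have h3 : dispIter s τ p g 0 i t a = 0 := rfl
      rw [h3, zero_sub, abs_neg, pow_zero, mul_one]
      refine le_trans h ?_
      exact mul_le_mul_of_nonneg_left (by linarith) hM0
    | succ k ih =>
      intro i t a
      have := H.nextDisp_sub_le (H.isDisplacement_dispIter k) (H.isDisplacement_dispIter (k + 1))
        ih i t a
      refine le_trans this (le_of_eq ?_)
      ring
  have hτ : 0 ≤ τ - s := sub_nonneg.mpr H.le
  refine ⟨M * (τ - s) * 2, by positivity, fun i t a => ?_⟩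
  have hd : ∀ k, dist (dispIter s τ p g k i t a) (dispIter s τ p g (k + 1) i t a)
      ≤ M * (τ - s) * (1 / 2) ^ k := fun k => hstep k i t a
  have hc := cauchySeq_of_le_geometric (f := fun k => dispIter s τ p g k i t a) (1 / 2)
    (M * (τ - s)) (by norm_num) hd
  have hlim := hc.tendsto_limUnder
  refine ⟨hlim, fun k => ?_⟩
  have := dist_le_of_le_geometric_of_tendsto (f := fun k => dispIter s τ p g k i t a) (1 / 2)
    (M * (τ - s)) (by norm_num) hd hlim k
  refine le_trans this (le_of_eq ?_)
  ring

theorem IsData.isDisplacement_disp (H : IsData s τ G p g) : IsDisplacement (disp s τ p g) := by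
  obtain ⟨M, hM0, hM⟩ := H.exists_rate
  refine ⟨fun i => ?_, fun i t a b => ?_⟩
  · have hu : TendstoUniformly (fun k (q : ℝ × ℝ) => dispIter s τ p g k i q.1 q.2)
        (fun q => disp s τ p g i q.1 q.2) atTop := by
      rw [Metric.tendstoUniformly_iff]
      intro ε hε
      filter_upwards [(tendsto_mul_half_pow M).eventually_lt_const hε] with k hk q
      rw [dist_comm]
      exact ((hM i q.1 q.2).2 k).trans_lt hk
    exact hu.continuous (Frequently.of_forall fun k => (H.isDisplacement_dispIter k).cont i)
  · refine le_of_tendsto (((hM i t a).1.sub (hM i t b).1).abs) (Eventually.of_forall fun k => ?_)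
    exact (H.isDisplacement_dispIter k).lip i t a b

theorem IsData.nextDisp_disp (H : IsData s τ G p g) :
    nextDisp s τ p g (disp s τ p g) = disp s τ p g := by
  obtain ⟨M, hM0, hM⟩ := H.exists_rate
  funext i t a
  have h0 := (tendsto_mul_half_pow M).const_mul (1 / 2)
  rw [mul_zero] at h0
  have h1 : Tendsto (fun k => dispIter s τ p g (k + 1) i t a) atTop
      (𝓝 (nextDisp s τ p g (disp s τ p g) i t a)) := by
    rw [tendsto_iff_dist_tendsto_zero]
    refine squeeze_zero (fun _ => dist_nonneg) (fun k => ?_) h0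
    exact H.nextDisp_sub_le (H.isDisplacement_dispIter k) H.isDisplacement_disp
      (fun i t a => (hM i t a).2 k) i t a
  exact tendsto_nhds_unique h1 ((hM i t a).1.comp (tendsto_add_atTop_nat 1))

/-- Positions of the particles in the solution of the particle system. -/
noncomputable def pos (s τ : ℝ) (p : Fin N → ℝ → ℝ) (g : ℝ → ℝ) : Fin N → ℝ → ℝ → ℝ :=
  posn p (disp s τ p g)

/-- Labels of the particles in the solution of the particle system. -/
noncomputable def back (s τ : ℝ) (p : Fin N → ℝ → ℝ) (g : ℝ → ℝ) : Fin N → ℝ → ℝ → ℝ :=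
  lab p (disp s τ p g)

/-- The velocity in the solution of the particle system. -/
noncomputable def sol (s τ : ℝ) (p : Fin N → ℝ → ℝ) (g : ℝ → ℝ) : ℝ → ℝ → ℝ :=
  vel p g (disp s τ p g)

theorem sol_eq (t x : ℝ) : sol s τ p g t x = avg fun j => g (back s τ p g j t x) := rfl

theorem IsData.isFlow (H : IsData s τ G p g) : IsFlow (pos s τ p g) (back s τ p g) :=
  H.isDisplacement_disp.isFlow H.contp

theorem IsData.continuous_sol (H : IsData s τ G p g) :
    Continuous fun q : ℝ × ℝ => sol s τ p g q.1 q.2 :=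
  H.continuous_vel H.isDisplacement_disp

theorem IsData.pos_eq (H : IsData s τ G p g) {t : ℝ} (ht : t ∈ Icc s τ) (i : Fin N) (a : ℝ) :
    pos s τ p g i t a = a + (∫ r in s..t, sol s τ p g r (pos s τ p g i r a)) + p i t := by
  have h := congrFun (congrFun (congrFun H.nextDisp_disp i) t) a
  rw [nextDisp, clampTime_of_mem ht] at h
  conv_lhs => rw [pos, posn, ← h]
  rfl

theorem IsData.back_zero (H : IsData s τ G p g) (i : Fin N) (x : ℝ) :
    back s τ p g i s x = x := by
  have h := H.pos_eq (left_mem_Icc.mpr H.le) i x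
  rw [intervalIntegral.integral_same, H.zero, add_zero, add_zero] at h
  conv_lhs => rw [← h]
  exact H.isFlow.left i s x

theorem IsData.sol_zero [NeZero N] (H : IsData s τ G p g) (x : ℝ) : sol s τ p g s x = g x := by
  simp only [sol_eq, H.back_zero, avg_const]

/-- A solution is its own image under `nextDisp`, so its displacement has Lipschitz constant `3 * G
* (t - s)`, and a perturbation of the identity by it is inverted with this constant. -/
theorem IsData.lip_back (H : IsData s τ G p g) {t : ℝ} (ht : t ∈ Icc s τ) (i : Fin N) (x y : ℝ) :
    |back s τ p g i t x - back s τ p g i t y| ≤ |x - y| / (1 - 3 * G * (t - s)) := by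
  have h := H.lip_nextDisp H.isDisplacement_disp i t (back s τ p g i t x) (back s τ p g i t y)
  rw [H.nextDisp_disp, clampTime_of_mem ht] at h
  have hs : 3 * G * (t - s) ≤ 1 / 2 := by
    have := H.small
    have := ht.2
    nlinarith [H.nonneg]
  rw [le_div_iff₀ (by linarith)]
  have hx := H.isFlow.right i t x
  have hy := H.isFlow.right i t y
  unfold pos posn at hx hy
  set a := back s τ p g i t x
  set b := back s τ p g i t y
  have h2 : x - y = (a - b) + (disp s τ p g i t a - disp s τ p g i t b) := by
    linarith
  have h3 := abs_sub_abs_le_abs_sub (a - b) (-(disp s τ p g i t a - disp s τ p g i t b))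
  rw [sub_neg_eq_add, ← h2, abs_neg] at h3
  linarith

/-- The map `G ↦ G / (1 - 3 * G * t)` is a semigroup in `t`, so restarting from the result at a
later time yields the same bound as not restarting. -/
theorem IsData.lip_sol (H : IsData s τ G p g) {t : ℝ} (ht : t ∈ Icc s τ) (x y : ℝ) :
    |sol s τ p g t x - sol s τ p g t y| ≤ G / (1 - 3 * G * (t - s)) * |x - y| := by
  have hs : 3 * G * (t - s) ≤ 1 / 2 := by
    have := H.small
    have := ht.2
    nlinarith [H.nonneg]
  have hG := H.nonneg
  have hpos : 0 < 1 - 3 * G * (t - s) := by linarith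
  rw [sol_eq, sol_eq, avg_sub]
  refine abs_avg_le (by positivity) fun j => (H.lip _ _).trans ?_
  refine (mul_le_mul_of_nonneg_left (H.lip_back ht j x y) hG).trans (le_of_eq ?_)
  ring

theorem periodic_lab {d : Fin N → ℝ → ℝ → ℝ} (hd : IsDisplacement d)
    (hper : ∀ i t, Function.Periodic (d i t) 1) (p : Fin N → ℝ → ℝ) (i : Fin N) (t x : ℝ) :
    lab p d i t (x + 1) = lab p d i t x + 1 := by
  have hb := hd.posn_bijective p i t
  have hr := Function.rightInverse_invFun hb.2
  apply hb.1
  have h1 : posn p d i t (lab p d i t (x + 1)) = x + 1 := hr _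
  have h2 : posn p d i t (lab p d i t x) = x := hr _
  rw [h1]
  nth_rewrite 1 [← h2]
  simp only [posn, hper i t _]
  ring

theorem IsData.periodic_dispIter (H : IsData s τ G p g) (k : ℕ) (i : Fin N) (t : ℝ) :
    Function.Periodic (dispIter s τ p g k i t) 1 := by
  induction k generalizing i t with
  | zero => exact fun _ => rfl
  | succ k ih =>
    intro a
    refine intervalIntegral.integral_congr fun r _ => ?_
    have h1 : posn p (dispIter s τ p g k) i r (a + 1) = posn p (dispIter s τ p g k) i r a + 1 := by
      simp only [posn, ih i r a]; ring
    simp only [h1, vel, periodic_lab (H.isDisplacement_dispIter k) ih]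
    congr 1
    funext j
    exact H.per _

theorem IsData.periodic_disp (H : IsData s τ G p g) (i : Fin N) (t : ℝ) :
    Function.Periodic (disp s τ p g i t) 1 := fun a => by
  simp only [disp, H.periodic_dispIter _ i t a]

theorem IsData.periodic_sol (H : IsData s τ G p g) (t : ℝ) :
    Function.Periodic (sol s τ p g t) 1 := fun x => by
  have h := periodic_lab H.isDisplacement_disp H.periodic_disp p
  simp only [sol_eq, back, h]
  congr 1
  funext j
  exact H.per _

/-- Uniqueness for the particle system along a path. -/
theorem IsData.sol_unique (H : IsData s τ G p g) {v : ℝ → ℝ → ℝ} {Y B : Fin N → ℝ → ℝ → ℝ}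
    (hY : ∀ t ∈ Icc s τ, ∀ i a,
      IntervalIntegrable (fun r => v r (Y i r a)) volume s t ∧
      Y i t a = a + (∫ r in s..t, v r (Y i r a)) + p i t)
    (hBY : ∀ t ∈ Icc s τ, ∀ i, Function.RightInverse (B i t) (Y i t))
    (hv : ∀ t ∈ Icc s τ, ∀ x, v t x = avg fun j => g (B j t x)) :
    ∀ t ∈ Icc s τ, (∀ x, v t x = sol s τ p g t x) ∧ ∀ i a, Y i t a = pos s τ p g i t a := by
  have hG := H.nonneg
  have hF := H.isFlow
  obtain ⟨M, hM0, hM⟩ := exists_bound_of_periodic H.continuous H.per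
  have hvM : ∀ t ∈ Icc s τ, ∀ x, |v t x| ≤ M := fun t ht x => by
    rw [hv t ht x]; exact abs_avg_le hM0 fun j => hM _
  have huM : ∀ t x, |sol s τ p g t x| ≤ M := fun t x => abs_avg_le hM0 fun j => hM _
  -- No spatial regularity of `Y` or `B` is available. Only the labels of the constructed solution
  -- are moved, from `pos (B x)` to `x = Y (B x)`.
  have hvel : ∀ S, 0 ≤ S → ∀ t ∈ Icc s τ, (∀ i a, |Y i t a - pos s τ p g i t a| ≤ S) →
      ∀ x, |v t x - sol s τ p g t x| ≤ 2 * G * S := by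
    intro S hS t ht h x
    rw [hv t ht x, sol_eq, avg_sub]
    refine abs_avg_le (by positivity) fun j => (H.lip _ _).trans ?_
    have h1 := hF.lipA j t (pos s τ p g j t (B j t x)) x
    rw [hF.left] at h1
    have h2 : Y j t (B j t x) = x := hBY t ht j x
    have h3 := h j (B j t x)
    rw [h2, abs_sub_comm] at h3
    nlinarith
  have hdiff : ∀ t ∈ Icc s τ, ∀ i a, ∀ C,
      (∀ r ∈ Icc s t, |v r (Y i r a) - sol s τ p g r (pos s τ p g i r a)| ≤ C) →
      |Y i t a - pos s τ p g i t a| ≤ C * (t - s) := by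
    intro t ht i a C hC
    have h := abs_integral_sub_le ht.1 (hY t ht i a).1
      ((continuous_along H.continuous_sol (hF.contX i) a).intervalIntegrable s t) hC
    rw [(hY t ht i a).2, H.pos_eq ht]
    convert h using 2
    ring
  have hstep : ∀ S, 0 ≤ S → (∀ t ∈ Icc s τ, ∀ i a, |Y i t a - pos s τ p g i t a| ≤ S) →
      ∀ t ∈ Icc s τ, ∀ i a, |Y i t a - pos s τ p g i t a| ≤ 1 / 2 * S := by
    intro S hS h t ht i a
    have h1 := hdiff t ht i a (4 * G * S) fun r hr => by
      have hr' : r ∈ Icc s τ := ⟨hr.1, hr.2.trans ht.2⟩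
      have h1 := hvel S hS r hr' (h r hr') (Y i r a)
      have h2 := H.vel_sub_le H.isDisplacement_disp H.isDisplacement_disp (r := r) (S := 0)
        (by simp) le_rfl (Y i r a) (pos s τ p g i r a)
      change |sol s τ p g r _ - sol s τ p g r _| ≤ _ at h2
      have h3 := h r hr' i a
      have h4 := abs_sub_le (v r (Y i r a)) (sol s τ p g r (Y i r a))
        (sol s τ p g r (pos s τ p g i r a))
      nlinarith
    refine h1.trans ?_
    have h3 : 4 * G * (t - s) ≤ 1 / 2 := by
      have := H.small
      have := ht.2
      nlinarith
    nlinarith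
  -- The start is crude: both velocities are averages of values of `g`, hence at most `M`. Each
  -- application of `hstep` then halves the distance.
  have hpow : ∀ k : ℕ, ∀ t ∈ Icc s τ, ∀ i a,
      |Y i t a - pos s τ p g i t a| ≤ 2 * M * (τ - s) * (1 / 2) ^ k := by
    have hτ : 0 ≤ τ - s := sub_nonneg.mpr H.le
    intro k
    induction k with
    | zero =>
      intro t ht i a
      refine (hdiff t ht i a (2 * M) fun r hr => ?_).trans ?_
      · have hr' : r ∈ Icc s τ := ⟨hr.1, hr.2.trans ht.2⟩
        have h1 := hvM r hr' (Y i r a)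
        have h2 := huM r (pos s τ p g i r a)
        have h3 := abs_sub (v r (Y i r a)) (sol s τ p g r (pos s τ p g i r a))
        linarith
      · rw [pow_zero, mul_one]
        exact mul_le_mul_of_nonneg_left (by linarith [ht.2]) (by positivity)
    | succ k ih =>
      intro t ht i a
      refine (hstep _ (by positivity) ih t ht i a).trans (le_of_eq ?_)
      ring
  have hzero : ∀ t ∈ Icc s τ, ∀ i a, |Y i t a - pos s τ p g i t a| ≤ 0 := by
    intro t ht i a
    exact ge_of_tendsto (tendsto_mul_half_pow _) (Eventually.of_forall fun k => hpow k t ht i a)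
  intro t ht
  refine ⟨fun x => ?_, fun i a => ?_⟩
  · have := hvel 0 le_rfl t ht (hzero t ht) x
    rw [mul_zero] at this
    exact sub_eq_zero.mp (abs_nonpos_iff.mp this)
  · exact sub_eq_zero.mp (abs_nonpos_iff.mp (hzero t ht i a))

end Core

/-! ### Grönwall estimates for suprema -/

theorem abs_integral_le_exp {f : ℝ → ℝ} {s t α C : ℝ} (hst : s ≤ t) (hα : 0 < α)
    (h : ∀ r ∈ Icc s t, |f r| ≤ C * Real.exp (α * (r - s))) :
    |∫ r in s..t, f r| ≤ C / α * (Real.exp (α * (t - s)) - 1) := by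
  have hder : ∀ r ∈ uIcc s t, HasDerivAt (fun r => C / α * Real.exp (α * (r - s)))
      (C * Real.exp (α * (r - s))) r := by
    intro r _
    have h1 : HasDerivAt (fun r => α * (r - s)) α r := by
      simpa using ((hasDerivAt_id r).sub_const s).const_mul α
    have h2 := h1.exp.const_mul (C / α)
    have h3 : C / α * (Real.exp (α * (r - s)) * α) = C * Real.exp (α * (r - s)) := by
      field_simp
    rwa [h3] at h2
  have hint : IntervalIntegrable (fun r => C * Real.exp (α * (r - s))) volume s t :=
    (by fun_prop : Continuous fun r => C * Real.exp (α * (r - s))).intervalIntegrable _ _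
  have hval := intervalIntegral.integral_eq_sub_of_hasDerivAt hder hint
  have hle := intervalIntegral.norm_integral_le_of_norm_le (f := f) hst
    (Eventually.of_forall fun r hr => h r ⟨hr.1.le, hr.2⟩) hint
  rw [hval, Real.norm_eq_abs] at hle
  refine hle.trans (le_of_eq ?_)
  simp
  ring

/-- A form of Grönwall that needs no regularity in `t` of the supremum over `x`. If `S = Q + D`, one
pass gives `Q * e + D * (e - 1)` with `e = exp (α * (t - s))`, and `e - 1 ≤ κ * e`; so the excess
`D` shrinks by the factor `κ < 1`. The a priori bound `B` only starts the iteration and leaves no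
trace. -/
theorem sup_gronwall {ι : Type*} {f : ℝ → ι → ℝ} {s τ α Q B : ℝ} (hα : 0 ≤ α) (hQ : 0 ≤ Q)
    (hB : ∀ t ∈ Icc s τ, ∀ x, f t x ≤ B)
    (h : ∀ S, Q ≤ S → (∀ t ∈ Icc s τ, ∀ x, f t x ≤ S * Real.exp (α * (t - s))) →
      ∀ t ∈ Icc s τ, ∀ x, f t x ≤ Q + S * (Real.exp (α * (t - s)) - 1)) :
    ∀ t ∈ Icc s τ, ∀ x, f t x ≤ Q * Real.exp (α * (t - s)) := by
  set κ : ℝ := 1 - Real.exp (-(α * (τ - s))) with hκ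
  intro t₁ ht₁ x₁
  have hsτ : s ≤ τ := ht₁.1.trans ht₁.2
  have hκ0 : 0 ≤ κ := by
    have : Real.exp (-(α * (τ - s))) ≤ 1 := Real.exp_le_one_iff.mpr (by nlinarith)
    linarith
  have hκ1 : κ < 1 := by
    have := Real.exp_pos (-(α * (τ - s)))
    linarith
  have key : ∀ k : ℕ, ∀ t ∈ Icc s τ, ∀ x,
      f t x ≤ (Q + κ ^ k * max (B - Q) 0) * Real.exp (α * (t - s)) := by
    intro k
    induction k with
    | zero =>
      intro t ht x
      have h1 : 1 ≤ Real.exp (α * (t - s)) := Real.one_le_exp (by nlinarith [ht.1])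
      have h2 := hB t ht x
      have h3 := le_max_left (B - Q) 0
      have h4 := le_max_right (B - Q) 0
      rw [pow_zero, one_mul]
      nlinarith
    | succ k ih =>
      intro t ht x
      have hD : 0 ≤ κ ^ k * max (B - Q) 0 := by positivity
      have h1 := h _ (by linarith) ih t ht x
      have h2 : Real.exp (α * (t - s)) - 1 ≤ κ * Real.exp (α * (t - s)) := by
        have h3 : Real.exp (-(α * (τ - s))) * Real.exp (α * (t - s)) ≤ 1 := by
          rw [← Real.exp_add, Real.exp_le_one_iff]
          nlinarith [ht.2]
        rw [hκ]
        linarith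
      rw [pow_succ]
      nlinarith
  have hlim : Tendsto (fun k : ℕ => (Q + κ ^ k * max (B - Q) 0) * Real.exp (α * (t₁ - s))) atTop
      (𝓝 ((Q + 0 * max (B - Q) 0) * Real.exp (α * (t₁ - s)))) :=
    ((((tendsto_pow_atTop_nhds_zero_of_lt_one hκ0 hκ1).mul_const _).const_add Q).mul_const _)
  rw [zero_mul, add_zero] at hlim
  exact ge_of_tendsto hlim (Eventually.of_forall fun k => key k t₁ ht₁ x₁)

/-- Adding the constant `M` to `|y|` makes the affine bound on the source homogeneous. The resulting
bound is a pure exponential factor, which composes over windows. -/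
theorem transport_gronwall {N : ℕ} {X A y h : Fin N → ℝ → ℝ → ℝ} (hF : IsFlow X A)
    {s τ α Y M B : ℝ} {ζ : ℝ → ℝ}
    (heq : ∀ t ∈ Icc s τ, ∀ i a, y i t (X i t a) = ζ a + ∫ r in s..t, h i r (X i r a))
    (hζ : ∀ a, |ζ a| ≤ Y) (hB : ∀ i t x, |y i t x| ≤ B) (hM : 0 ≤ M) (hα : 0 < α)
    (hh : ∀ r ∈ Icc s τ, ∀ q, (∀ i x, |y i r x| ≤ q) → ∀ i x, |h i r x| ≤ α * (q + M)) :
    ∀ t ∈ Icc s τ, ∀ i x, |y i t x| + M ≤ (Y + M) * Real.exp (α * (t - s)) := by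
  have hY : 0 ≤ Y := (abs_nonneg _).trans (hζ 0)
  have key := sup_gronwall (f := fun t (q : Fin N × ℝ) => |y q.1 t q.2| + M) (s := s) (τ := τ)
    (B := B + M) hα.le (add_nonneg hY hM) (fun t _ q => by linarith [hB q.1 t q.2]) ?_
  · exact fun t ht i x => key t ht (i, x)
  · rintro S hS hle t ht ⟨i, x⟩
    have h1 := heq t ht i (A i t x)
    rw [hF.right] at h1
    have h2 := abs_integral_le_exp (f := fun r => h i r (X i r (A i t x))) (C := α * S) ht.1 hα
      fun r hr => by
        have hr' : r ∈ Icc s τ := ⟨hr.1, hr.2.trans ht.2⟩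
        refine (hh r hr' (S * Real.exp (α * (r - s)) - M) (fun j z => ?_) i _).trans
          (le_of_eq ?_)
        · have := hle r hr' (j, z)
          simp only at this
          linarith
        · ring
    rw [mul_div_cancel_left₀ _ hα.ne'] at h2
    simp only [h1]
    have h3 := abs_add_le (ζ (A i t x)) (∫ r in s..t, h i r (X i r (A i t x)))
    linarith [hζ (A i t x)]

/-! ### Transport equations along a flow -/

theorem exists_limit_of_geometric {f : ℕ → ℝ × ℝ → ℝ} {D : ℝ} (hc : ∀ k, Continuous (f k))
    (h : ∀ k q, |f k q - f (k + 1) q| ≤ D * (1 / 2) ^ k) :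
    ∃ F : ℝ × ℝ → ℝ, Continuous F ∧ ∀ k q, |f k q - F q| ≤ 2 * D * (1 / 2) ^ k := by
  have hlim : ∀ q, ∃ l, Tendsto (fun k => f k q) atTop (𝓝 l) := fun q =>
    cauchySeq_tendsto_of_complete
      (cauchySeq_of_le_geometric (f := fun k => f k q) (1 / 2) D (by norm_num) fun k => h k q)
  choose F hF using hlim
  have hrate : ∀ k q, |f k q - F q| ≤ 2 * D * (1 / 2) ^ k := fun k q => by
    have := dist_le_of_le_geometric_of_tendsto (f := fun k => f k q) (1 / 2) D (by norm_num)
      (fun k => h k q) (hF q) k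
    refine le_trans this (le_of_eq ?_)
    ring
  refine ⟨F, ?_, hrate⟩
  have hu : TendstoUniformly f F atTop := by
    rw [Metric.tendstoUniformly_iff]
    intro ε hε
    filter_upwards [(tendsto_mul_half_pow (2 * D)).eventually_lt_const hε] with k hk q
    rw [dist_comm]
    exact (hrate k q).trans_lt hk
  exact hu.continuous (Frequently.of_forall hc)

/-- Picard iteration along the flow of each index. The fields are coupled, as the source of the
`i`-th equation sees all fields at the position of the `i`-th particle. -/
theorem exists_transport {N : ℕ} {X A : Fin N → ℝ → ℝ → ℝ} (hF : IsFlow X A) {s τ C C₀ Y : ℝ}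
    (hsτ : s ≤ τ) (hC : 0 ≤ C) {F : Fin N → ℝ → ℝ → (Fin N → ℝ) → ℝ}
    (hcont : ∀ i, Continuous fun q : (ℝ × ℝ) × (Fin N → ℝ) => F i q.1.1 q.1.2 q.2)
    (hlip : ∀ i r x ξ ξ' δ, (∀ j, |ξ j - ξ' j| ≤ δ) → |F i r x ξ - F i r x ξ'| ≤ C * δ)
    (hbdd : ∀ i r x ξ, |F i r x ξ| ≤ C₀) {ζ : ℝ → ℝ} (hζc : Continuous ζ) (hζ : ∀ a, |ζ a| ≤ Y) :
    ∃ z : Fin N → ℝ → ℝ → ℝ, (∀ i, Continuous fun q : ℝ × ℝ => z i q.1 q.2) ∧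
      (∃ B, ∀ i t x, |z i t x| ≤ B) ∧
      ∀ t ∈ Icc s τ, ∀ i a, z i t (X i t a) =
        ζ a + ∫ r in s..t, F i r (X i r a) fun j => z j r (X i r a) := by
  let Ψ : (Fin N → ℝ → ℝ → ℝ) → Fin N → ℝ → ℝ → ℝ := fun z i t x =>
    ζ (A i t x) + ∫ r in s..clampTime s τ t, F i r (X i r (A i t x)) fun j => z j r (X i r (A i t x))
  let zs : ℕ → Fin N → ℝ → ℝ → ℝ := fun k => Ψ^[k] fun _ _ _ => 0
  have hzs : ∀ k, zs (k + 1) = Ψ (zs k) := fun k => Function.iterate_succ_apply' _ _ _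
  have hinner : ∀ z : Fin N → ℝ → ℝ → ℝ, (∀ i, Continuous fun q : ℝ × ℝ => z i q.1 q.2) → ∀ i,
      Continuous fun q : ℝ × ℝ => F i q.1 q.2 fun j => z j q.1 q.2 := fun z hz i =>
    (hcont i).comp (continuous_id.prodMk (continuous_pi fun j => hz j))
  have hΨc : ∀ z : Fin N → ℝ → ℝ → ℝ, (∀ i, Continuous fun q : ℝ × ℝ => z i q.1 q.2) →
      ∀ i, Continuous fun q : ℝ × ℝ => Ψ z i q.1 q.2 := by
    intro z hz i
    refine (hζc.comp (hF.contA i)).add ?_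
    refine intervalIntegral.continuous_parametric_intervalIntegral_of_continuous
      (f := fun (q : ℝ × ℝ) r => F i r (X i r (A i q.1 q.2)) fun j => z j r (X i r (A i q.1 q.2)))
      ?_ ((continuous_clampTime s τ).comp continuous_fst)
    exact (hinner z hz i).comp (continuous_snd.prodMk ((hF.contX i).comp
      (continuous_snd.prodMk ((hF.contA i).comp continuous_fst))))
  have hΨb : ∀ z i t x, |Ψ z i t x| ≤ Y + C₀ * (τ - s) := by
    intro z i t x
    have hm := clampTime_mem hsτ t
    have h1 := abs_integral_le (f := fun r => F i r (X i r (A i t x))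
      fun j => z j r (X i r (A i t x))) (C := C₀) hm.1 fun r _ => hbdd i _ _ _
    have hC0 : 0 ≤ C₀ := (abs_nonneg _).trans (hbdd i 0 0 fun _ => 0)
    have h2 : C₀ * (clampTime s τ t - s) ≤ C₀ * (τ - s) :=
      mul_le_mul_of_nonneg_left (by linarith [hm.2]) hC0
    have h3 := abs_add_le (ζ (A i t x)) (∫ r in s..clampTime s τ t, F i r (X i r (A i t x))
      fun j => z j r (X i r (A i t x)))
    change |ζ (A i t x) + _| ≤ _
    linarith [hζ (A i t x)]
  have hΨs : ∀ z z' : Fin N → ℝ → ℝ → ℝ, (∀ i, Continuous fun q : ℝ × ℝ => z i q.1 q.2) →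
      (∀ i, Continuous fun q : ℝ × ℝ => z' i q.1 q.2) → ∀ i t x,
      Ψ z i t x - Ψ z' i t x = ∫ r in s..clampTime s τ t,
        ((F i r (X i r (A i t x)) fun j => z j r (X i r (A i t x))) -
          F i r (X i r (A i t x)) fun j => z' j r (X i r (A i t x))) := by
    intro z z' hz hz' i t x
    rw [intervalIntegral.integral_sub
      ((continuous_along (h := fun r x => F i r x fun j => z j r x) (hinner z hz i) (hF.contX i)
        _).intervalIntegrable _ _)
      ((continuous_along (h := fun r x => F i r x fun j => z' j r x) (hinner z' hz' i) (hF.contX i)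
        _).intervalIntegrable _ _)]
    simp only [Ψ]
    ring
  have hzc : ∀ k i, Continuous fun q : ℝ × ℝ => zs k i q.1 q.2 := by
    intro k
    induction k with
    | zero => exact fun _ => continuous_const
    | succ k ih => rw [hzs]; exact hΨc _ ih
  -- With the weight `exp (lam * (t - s))` one iteration multiplies the error by `C / lam ≤ 1 / 2`,
  -- however long the interval is.
  set lam : ℝ := 2 * C + 1 with hlam
  have hlam0 : 0 < lam := by positivity
  set D : ℝ := |Y + C₀ * (τ - s)| with hD
  have hstep : ∀ k i t x, |zs k i t x - zs (k + 1) i t x|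
      ≤ D * (1 / 2) ^ k * Real.exp (lam * (clampTime s τ t - s)) := by
    intro k
    induction k with
    | zero =>
      intro i t x
      have h1 : zs 0 i t x = 0 := rfl
      rw [h1, hzs, zero_sub, abs_neg, pow_zero, mul_one]
      have h2 := Real.one_le_exp (x := lam * (clampTime s τ t - s))
        (mul_nonneg hlam0.le (sub_nonneg.mpr (clampTime_mem hsτ t).1))
      have h3 : |Ψ (zs 0) i t x| ≤ D := (hΨb (zs 0) i t x).trans (le_abs_self _)
      nlinarith [abs_nonneg (Y + C₀ * (τ - s))]
    | succ k ih =>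
      intro i t x
      rw [hzs k, hzs (k + 1), hΨs _ _ (hzc k) (hzc (k + 1))]
      have hm := clampTime_mem hsτ t
      refine (abs_integral_le_exp (C := C * (D * (1 / 2) ^ k)) hm.1 hlam0 fun r hr => ?_).trans ?_
      · have h1 := hlip i r (X i r (A i t x)) (fun j => zs k j r (X i r (A i t x)))
          (fun j => zs (k + 1) j r (X i r (A i t x))) _ (fun j => ih j r _)
        rw [clampTime_of_mem ⟨hr.1, hr.2.trans hm.2⟩] at h1
        refine h1.trans (le_of_eq ?_)
        ring
      · have h1 : C * (D * (1 / 2) ^ k) / lam ≤ D * (1 / 2) ^ (k + 1) := by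
          rw [div_le_iff₀ hlam0, pow_succ]
          have : 0 ≤ D * (1 / 2) ^ k := by positivity
          nlinarith
        refine mul_le_mul h1 (by linarith) (sub_nonneg.mpr (Real.one_le_exp
          (mul_nonneg hlam0.le (sub_nonneg.mpr hm.1)))) (by positivity)
  have hunif : ∀ k i (q : ℝ × ℝ), |zs k i q.1 q.2 - zs (k + 1) i q.1 q.2|
      ≤ D * Real.exp (lam * (τ - s)) * (1 / 2) ^ k := by
    intro k i q
    refine (hstep k i q.1 q.2).trans ?_
    have h1 : Real.exp (lam * (clampTime s τ q.1 - s)) ≤ Real.exp (lam * (τ - s)) :=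
      Real.exp_le_exp.mpr (mul_le_mul_of_nonneg_left
        (by linarith [(clampTime_mem hsτ q.1).2]) hlam0.le)
    have h2 : 0 ≤ D * (1 / 2) ^ k := by positivity
    nlinarith
  have hlimit := fun i => exists_limit_of_geometric (f := fun k q => zs k i q.1 q.2)
    (fun k => hzc k i) (fun k q => hunif k i q)
  choose Z hZc hZ using hlimit
  set E : ℝ := 2 * (D * Real.exp (lam * (τ - s))) with hE
  have hfix : ∀ i t x, Z i (t, x) = Ψ (fun j t x => Z j (t, x)) i t x := by
    intro i t x
    have h1 : Tendsto (fun k => zs (k + 1) i t x) atTop (𝓝 (Z i (t, x))) := by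
      have h2 : Tendsto (fun k => zs k i t x) atTop (𝓝 (Z i (t, x))) := by
        rw [tendsto_iff_dist_tendsto_zero]
        exact squeeze_zero (fun _ => dist_nonneg) (fun k => hZ i k (t, x)) (tendsto_mul_half_pow _)
      exact h2.comp (tendsto_add_atTop_nat 1)
    refine tendsto_nhds_unique h1 ?_
    rw [tendsto_iff_dist_tendsto_zero]
    refine squeeze_zero (fun _ => dist_nonneg) (fun k => ?_)
      (tendsto_mul_half_pow (C * E * (clampTime s τ t - s)))
    rw [hzs, Real.dist_eq, hΨs _ (fun j t x => Z j (t, x)) (hzc k) hZc]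
    refine (abs_integral_le (C := C * (E * (1 / 2) ^ k)) (clampTime_mem hsτ t).1
      fun r _ => hlip i r (X i r (A i t x)) (fun j => zs k j r (X i r (A i t x)))
        (fun j => Z j (r, X i r (A i t x))) _ fun j => hZ j k (r, X i r (A i t x))).trans
      (le_of_eq ?_)
    ring
  refine ⟨fun i t x => Z i (t, x), hZc, ⟨Y + C₀ * (τ - s), fun i t x => ?_⟩, fun t ht i a => ?_⟩
  · simp only
    rw [hfix]
    exact hΨb (fun j t x => Z j (t, x)) i t x
  · simp only
    rw [hfix]
    simp only [Ψ, hF.left, clampTime_of_mem ht]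

/-! ### The sources in the equations for the spatial derivatives -/

/-- The source in the transport equation for the `n`-th spatial derivative: if `z j i` is the
`j`-th derivative of the `i`-th field, this is `u ∂ⁿ⁺¹ v - ∂ⁿ (u ∂ v)` where `v` is the `i`-th field
and `u` the mean of the fields. -/
noncomputable def src {N : ℕ} (z : ℕ → Fin N → ℝ) (n : ℕ) (i : Fin N) : ℝ :=
  -∑ j ∈ Finset.range n, (n.choose (j + 1) : ℝ) * (avg (z (j + 1)) * z (n - j) i)

/-- The formal spatial derivative of `src`. -/
noncomputable def srcDeriv {N : ℕ} (z : ℕ → Fin N → ℝ) (n : ℕ) (i : Fin N) : ℝ :=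
  -∑ j ∈ Finset.range n, (n.choose (j + 1) : ℝ) *
    (avg (z (j + 2)) * z (n - j) i + avg (z (j + 1)) * z (n - j + 1) i)

theorem src_zero {N : ℕ} (z : ℕ → Fin N → ℝ) (i : Fin N) : src z 0 i = 0 := by simp [src]

theorem src_one {N : ℕ} (z : ℕ → Fin N → ℝ) (i : Fin N) : src z 1 i = -(avg (z 1) * z 1 i) := by
  simp [src]

/-- Differentiating the equation of order `n` in space yields that of order `n + 1`, the extra term
being the commutator of the spatial derivative with transport by the mean. Combinatorially this is
Pascal's rule. -/
theorem src_succ {N : ℕ} (z : ℕ → Fin N → ℝ) (n : ℕ) (i : Fin N) :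
    src z (n + 1) i = srcDeriv z n i - avg (z 1) * z (n + 1) i := by
  have h1 : ∑ j ∈ Finset.range (n + 1),
      ((n + 1).choose (j + 1) : ℝ) * (avg (z (j + 1)) * z (n + 1 - j) i)
      = (∑ j ∈ Finset.range (n + 1), (n.choose j : ℝ) * (avg (z (j + 1)) * z (n + 1 - j) i))
        + ∑ j ∈ Finset.range (n + 1),
          (n.choose (j + 1) : ℝ) * (avg (z (j + 1)) * z (n + 1 - j) i) := by
    rw [← Finset.sum_add_distrib]
    refine Finset.sum_congr rfl fun j _ => ?_
    rw [Nat.choose_succ_succ']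
    push_cast
    ring
  rw [src, srcDeriv, h1, Finset.sum_range_succ', Finset.sum_range_succ
    (fun j => (n.choose (j + 1) : ℝ) * (avg (z (j + 1)) * z (n + 1 - j) i))]
  have h2 : ∀ j ∈ Finset.range n, (n.choose (j + 1) : ℝ) *
      (avg (z (j + 2)) * z (n - j) i + avg (z (j + 1)) * z (n - j + 1) i)
      = (n.choose (j + 1) : ℝ) * (avg (z (j + 1 + 1)) * z (n + 1 - (j + 1)) i)
        + (n.choose (j + 1) : ℝ) * (avg (z (j + 1)) * z (n + 1 - j) i) := by
    intro j hj
    have : n - j + 1 = n + 1 - j := by have := Finset.mem_range.mp hj; omega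
    rw [this, Nat.add_sub_add_right]
    ring
  rw [Finset.sum_congr rfl h2, Finset.sum_add_distrib]
  simp
  ring

theorem src_congr {N : ℕ} {z z' : ℕ → Fin N → ℝ} {n : ℕ}
    (h : ∀ j, 1 ≤ j → j ≤ n → z j = z' j) (i : Fin N) : src z n i = src z' n i := by
  unfold src
  congr 1
  refine Finset.sum_congr rfl fun j hj => ?_
  have := Finset.mem_range.mp hj
  rw [h (j + 1) (by omega) (by omega), h (n - j) (by omega) (by omega)]

theorem abs_sum_choose_le {n : ℕ} {f : ℕ → ℝ} {C : ℝ} (hC : 0 ≤ C) (h : ∀ j < n, |f j| ≤ C) :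
    |∑ j ∈ Finset.range n, (n.choose (j + 1) : ℝ) * f j| ≤ 2 ^ n * C := by
  have h1 : ∑ j ∈ Finset.range n, (n.choose (j + 1) : ℝ) ≤ 2 ^ n := by
    have h2 := Nat.sum_range_choose n
    rw [Finset.sum_range_succ'] at h2
    have h3 : ∑ j ∈ Finset.range n, n.choose (j + 1) ≤ 2 ^ n := by omega
    exact_mod_cast h3
  calc |∑ j ∈ Finset.range n, (n.choose (j + 1) : ℝ) * f j|
      ≤ ∑ j ∈ Finset.range n, |(n.choose (j + 1) : ℝ) * f j| := Finset.abs_sum_le_sum_abs _ _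
    _ ≤ ∑ j ∈ Finset.range n, (n.choose (j + 1) : ℝ) * C := by
        refine Finset.sum_le_sum fun j hj => ?_
        rw [abs_mul, Nat.abs_cast]
        exact mul_le_mul_of_nonneg_left (h j (Finset.mem_range.mp hj)) (Nat.cast_nonneg _)
    _ ≤ 2 ^ n * C := by
        rw [← Finset.sum_mul]
        exact mul_le_mul_of_nonneg_right h1 hC

theorem abs_mul_le {a b A B : ℝ} (ha : |a| ≤ A) (hb : |b| ≤ B) : |a * b| ≤ A * B := by
  rw [abs_mul]
  exact mul_le_mul ha hb (abs_nonneg _) ((abs_nonneg _).trans ha)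

/-- For order at least two, no product in the source has two factors of top order, so the bound is
affine in `q`. At order one the source is quadratic, and the first derivative has to be controlled
by the Lipschitz estimate instead. -/
theorem abs_src_le {N : ℕ} {z : ℕ → Fin N → ℝ} {n : ℕ} (hn : 2 ≤ n) {M q : ℝ} (hM : 0 ≤ M)
    (hq : 0 ≤ q) (hlow : ∀ j, 1 ≤ j → j < n → ∀ i, |z j i| ≤ M) (htop : ∀ i, |z n i| ≤ q)
    (i : Fin N) : |src z n i| ≤ 2 ^ n * M * (q + M) := by
  rw [src, abs_neg, mul_assoc]
  refine abs_sum_choose_le (by positivity) fun j hj => ?_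
  rcases Nat.eq_zero_or_pos j with rfl | hj0
  · have h1 := abs_mul_le (abs_avg_le hM (hlow 1 le_rfl (by omega))) (htop i)
    simp only [zero_add, Nat.sub_zero]
    nlinarith
  · have hl := hlow (n - j) (by omega) (by omega) i
    rcases eq_or_lt_of_le (show j + 1 ≤ n from hj) with h | h
    · have h1 := abs_mul_le (abs_avg_le hq (fun i => by rw [h]; exact htop i) :
        |avg (z (j + 1))| ≤ q) hl
      nlinarith
    · have h1 := abs_mul_le (abs_avg_le hM (hlow (j + 1) (by omega) h)) hl
      nlinarith

theorem abs_src_le' {N : ℕ} {z : ℕ → Fin N → ℝ} {n : ℕ} {M : ℝ} (hM : 0 ≤ M)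
    (h : ∀ j, 1 ≤ j → j ≤ n → ∀ i, |z j i| ≤ M) (i : Fin N) : |src z n i| ≤ 2 ^ n * (M * M) := by
  rw [src, abs_neg]
  refine abs_sum_choose_le (by positivity) fun j hj => ?_
  exact abs_mul_le (abs_avg_le hM (h (j + 1) (by omega) (by omega)))
    (h (n - j) (by omega) (by omega) i)

theorem abs_src_sub_le {N : ℕ} {z z' : ℕ → Fin N → ℝ} {n : ℕ} {M δ : ℝ} (hM : 0 ≤ M) (hδ : 0 ≤ δ)
    (h : ∀ j, 1 ≤ j → j ≤ n → ∀ i, |z j i| ≤ M) (h' : ∀ j, 1 ≤ j → j ≤ n → ∀ i, |z' j i| ≤ M)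
    (hd : ∀ j, 1 ≤ j → j ≤ n → ∀ i, |z j i - z' j i| ≤ δ) (i : Fin N) :
    |src z n i - src z' n i| ≤ 2 ^ n * (2 * M * δ) := by
  have : src z n i - src z' n i = -∑ j ∈ Finset.range n, (n.choose (j + 1) : ℝ) *
      (avg (z (j + 1)) * z (n - j) i - avg (z' (j + 1)) * z' (n - j) i) := by
    simp only [src, mul_sub, Finset.sum_sub_distrib]; ring
  rw [this, abs_neg]
  refine abs_sum_choose_le (by positivity) fun j hj => ?_
  have h1 := abs_mul_le (abs_avg_le hM (h (j + 1) (by omega) (by omega)))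
    (hd (n - j) (by omega) (by omega) i)
  have h2 : |avg (z (j + 1)) - avg (z' (j + 1))| ≤ δ := by
    rw [avg_sub]
    exact abs_avg_le hδ (hd (j + 1) (by omega) (by omega))
  have h3 := abs_mul_le h2 (h' (n - j) (by omega) (by omega) i)
  have h4 := abs_add_le (avg (z (j + 1)) * (z (n - j) i - z' (n - j) i))
    ((avg (z (j + 1)) - avg (z' (j + 1))) * z' (n - j) i)
  have h5 : avg (z (j + 1)) * z (n - j) i - avg (z' (j + 1)) * z' (n - j) i
    = avg (z (j + 1)) * (z (n - j) i - z' (n - j) i)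
      + (avg (z (j + 1)) - avg (z' (j + 1))) * z' (n - j) i := by ring
  rw [h5]
  linarith

/-- The product rule for first order expansions. Besides the remainders `ρ` of the factors there is
a cross term in `|e| * ω`; it is quadratic in the distance of the two points once the fields are
Lipschitz. -/
theorem abs_src_sub_sub_le {N : ℕ} {z z' : ℕ → Fin N → ℝ} {n : ℕ} {M ρ ω e : ℝ} (hM : 0 ≤ M)
    (hρ : 0 ≤ ρ) (hω0 : 0 ≤ ω) (h : ∀ j, 1 ≤ j → j ≤ n + 1 → ∀ i, |z j i| ≤ M)
    (h' : ∀ j, 1 ≤ j → j ≤ n → ∀ i, |z' j i| ≤ M)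
    (hω : ∀ j, 1 ≤ j → j ≤ n → ∀ i, |z' j i - z j i| ≤ ω)
    (hd : ∀ j, 1 ≤ j → j ≤ n → ∀ i, |z' j i - z j i - z (j + 1) i * e| ≤ ρ) (i : Fin N) :
    |src z' n i - src z n i - srcDeriv z n i * e| ≤ 2 ^ n * (2 * M * ρ + M * |e| * ω) := by
  have : src z' n i - src z n i - srcDeriv z n i * e
      = -∑ j ∈ Finset.range n, (n.choose (j + 1) : ℝ) *
      (avg (z' (j + 1)) * z' (n - j) i - avg (z (j + 1)) * z (n - j) i
        - (avg (z (j + 2)) * z (n - j) i + avg (z (j + 1)) * z (n - j + 1) i) * e) := by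
    simp only [src, srcDeriv, mul_sub, Finset.sum_sub_distrib, neg_mul, Finset.sum_mul, mul_assoc]
    ring
  rw [this, abs_neg]
  refine abs_sum_choose_le (by positivity) fun j hj => ?_
  have ha : |avg (z' (j + 1)) - avg (z (j + 1)) - avg (z (j + 2)) * e| ≤ ρ := by
    rw [avg_mul, avg_sub, avg_sub]
    exact abs_avg_le hρ (hd (j + 1) (by omega) (by omega))
  have hb := hd (n - j) (by omega) (by omega) i
  have h1 := abs_mul_le ha (h' (n - j) (by omega) (by omega) i)
  have h2 := abs_mul_le (abs_avg_le hM (h (j + 1) (by omega) (by omega))) hb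
  have h3 := abs_mul_le (abs_mul_le (abs_avg_le hM (h (j + 2) (by omega) (by omega))) (le_refl |e|))
    (hω (n - j) (by omega) (by omega) i)
  have h5 : avg (z' (j + 1)) * z' (n - j) i - avg (z (j + 1)) * z (n - j) i
        - (avg (z (j + 2)) * z (n - j) i + avg (z (j + 1)) * z (n - j + 1) i) * e
      = (avg (z' (j + 1)) - avg (z (j + 1)) - avg (z (j + 2)) * e) * z' (n - j) i
        + avg (z (j + 1)) * (z' (n - j) i - z (n - j) i - z (n - j + 1) i * e)
        + avg (z (j + 2)) * e * (z' (n - j) i - z (n - j) i) := by ring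
  rw [h5]
  refine (abs_add_three _ _ _).trans ?_
  linarith

theorem continuous_src {N : ℕ} {Y : Type*} [TopologicalSpace Y] {z : ℕ → Fin N → Y → ℝ} {n : ℕ}
    (h : ∀ j, 1 ≤ j → j ≤ n → ∀ i, Continuous (z j i)) (i : Fin N) :
    Continuous fun y => src (fun j i => z j i y) n i := by
  unfold src
  refine (continuous_finsetSum _ fun j hj => ?_).neg
  have := Finset.mem_range.mp hj
  exact continuous_const.mul ((continuous_avg (h (j + 1) (by omega) (by omega))).mul
    (h (n - j) (by omega) (by omega) i))

/-! ### The hierarchy of equations for the spatial derivatives -/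

/-- Truncation of a real number at height `R`. -/
noncomputable def clip (R v : ℝ) : ℝ := max (-R) (min v R)

theorem abs_clip_le {R : ℝ} (hR : 0 ≤ R) (v : ℝ) : |clip R v| ≤ R :=
  abs_le.mpr ⟨le_max_left _ _, max_le (by linarith) (min_le_right _ _)⟩

theorem clip_of_abs_le {R v : ℝ} (h : |v| ≤ R) : clip R v = v := by
  rw [abs_le] at h
  rw [clip, min_eq_left h.2, max_eq_right h.1]

theorem abs_clip_sub_le (R v v' : ℝ) : |clip R v - clip R v'| ≤ |v - v'| :=
  (abs_max_sub_max_le_max _ _ _ _).trans (by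
    rw [sub_self, abs_zero]
    refine max_le (abs_nonneg _) ((abs_min_sub_min_le_max _ _ _ _).trans ?_)
    simp)

theorem abs_clip_le_abs {R : ℝ} (hR : 0 ≤ R) (v : ℝ) : |clip R v| ≤ |v| := by
  have := abs_clip_sub_le R v 0
  rwa [clip_of_abs_le (by simpa using hR : |(0 : ℝ)| ≤ R), sub_zero, sub_zero] at this

theorem continuous_clip (R : ℝ) : Continuous (clip R) := by unfold clip; fun_prop

/-- `z 0, …, z n` are bounded continuous solutions, with initial values `ζ 0, …, ζ n`, of the
transport equations satisfied by the spatial derivatives up to order `n` of the fields `z 0 i`. -/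
structure IsTower {N : ℕ} (X : Fin N → ℝ → ℝ → ℝ) (s τ : ℝ) (ζ : ℕ → ℝ → ℝ)
    (z : ℕ → Fin N → ℝ → ℝ → ℝ) (n : ℕ) : Prop where
  cont : ∀ j ≤ n, ∀ i, Continuous fun q : ℝ × ℝ => z j i q.1 q.2
  bdd : ∃ M, 1 ≤ M ∧ ∀ j ≤ n, ∀ i t x, |z j i t x| ≤ M
  eq : ∀ j ≤ n, ∀ t ∈ Icc s τ, ∀ i a,
    z j i t (X i t a) = ζ j a + ∫ r in s..t, src (fun k l => z k l r (X i r a)) j i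

/-- Clipping the unknown at height `R` makes the source bounded and globally Lipschitz, so the
clipped equation is solvable. Its solutions stay below `R`, hence the clip is inactive and the true
equation holds. -/
theorem IsTower.exists_succ {N : ℕ} {X A : Fin N → ℝ → ℝ → ℝ} (hF : IsFlow X A) {s τ Y : ℝ}
    (hsτ : s ≤ τ) {ζ : ℕ → ℝ → ℝ} {z : ℕ → Fin N → ℝ → ℝ → ℝ} {n : ℕ} (hT : IsTower X s τ ζ z n)
    (hζc : Continuous (ζ (n + 1))) (hζ : ∀ a, |ζ (n + 1) a| ≤ Y)
    (hsmall : n = 0 → 4 * Y * (τ - s) ≤ 1) :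
    ∃ z', (∀ j ≤ n, z' j = z j) ∧ IsTower X s τ ζ z' (n + 1) := by
  obtain ⟨M, hM1, hM⟩ := hT.bdd
  have hM0 : 0 ≤ M := zero_le_one.trans hM1
  have hY : 0 ≤ Y := (abs_nonneg _).trans (hζ 0)
  obtain ⟨E, hEtop, hElow⟩ : ∃ E : ℝ → (Fin N → ℝ) → ℝ → ℝ → ℕ → Fin N → ℝ,
      (∀ R ξ r x l, E R ξ r x (n + 1) l = clip R (ξ l)) ∧
      ∀ R ξ r x k l, k ≤ n → E R ξ r x k l = z k l r x :=
    ⟨fun R ξ r x k l => if k = n + 1 then clip R (ξ l) else z k l r x,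
      fun R ξ r x l => if_pos rfl, fun R ξ r x k l hk => if_neg (by omega)⟩
  let F : ℝ → Fin N → ℝ → ℝ → (Fin N → ℝ) → ℝ := fun R i r x ξ => src (E R ξ r x) (n + 1) i
  have hEM : ∀ R, 0 ≤ R → ∀ ξ r x k, 1 ≤ k → k ≤ n + 1 → ∀ l, |E R ξ r x k l| ≤ max M R := by
    intro R hR ξ r x k _ hk l
    rcases Nat.lt_or_ge n k with h | h
    · obtain rfl : k = n + 1 := by omega
      rw [hEtop]
      exact (abs_clip_le hR _).trans (le_max_right _ _)
    · rw [hElow _ _ _ _ _ _ h]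
      exact (hM k h l r x).trans (le_max_left _ _)
  -- The height must dominate the solutions of the equation clipped at that same height. At order
  -- one, `R = 2 * Y` works: the clipped source is at most `4 * Y ^ 2`, which by `hsmall`
  -- contributes at most `Y`. At higher orders the Grönwall bound does not depend on `R`, because
  -- clipping never increases absolute values.
  have hR : ∃ R, 0 ≤ R ∧ ∀ (y : Fin N → ℝ → ℝ → ℝ) (B : ℝ), (∀ i t x, |y i t x| ≤ B) →
      (∀ t ∈ Icc s τ, ∀ i a, y i t (X i t a) =
        ζ (n + 1) a + ∫ r in s..t, F R i r (X i r a) fun j => y j r (X i r a)) →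
      ∀ t ∈ Icc s τ, ∀ i x, |y i t x| ≤ R := by
    rcases Nat.eq_zero_or_pos n with rfl | hn
    · refine ⟨2 * Y, by positivity, fun y B _ heq t ht i x => ?_⟩
      have h1 := heq t ht i (A i t x)
      rw [hF.right] at h1
      have h2 := abs_integral_le (f := fun r => F (2 * Y) i r (X i r (A i t x))
        fun j => y j r (X i r (A i t x))) (C := (2 * Y) * (2 * Y)) ht.1 fun r _ => by
          simp only [F, src_one, abs_neg, zero_add]
          have h3 : ∀ l, |E (2 * Y) (fun j => y j r (X i r (A i t x))) r (X i r (A i t x)) 1 l|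
              ≤ 2 * Y := fun l => by
            have h4 := hEtop (2 * Y) (fun j => y j r (X i r (A i t x))) r (X i r (A i t x)) l
            rw [zero_add] at h4
            rw [h4]
            exact abs_clip_le (by positivity) _
          exact abs_mul_le (abs_avg_le (by positivity) h3) (h3 i)
      rw [h1]
      refine (abs_add_le _ _).trans ?_
      have h3 := hζ (A i t x)
      have h4 : 4 * Y * (t - s) ≤ 1 :=
        (mul_le_mul_of_nonneg_left (by linarith [ht.2]) (by positivity)).trans (hsmall rfl)
      rw [zero_add] at h3
      nlinarith
    · set α : ℝ := 2 ^ (n + 1) * M with hα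
      have hα0 : 0 < α := by positivity
      refine ⟨(Y + M) * Real.exp (α * (τ - s)), by positivity, fun y B hB heq t ht i x => ?_⟩
      have h1 := transport_gronwall hF (h := fun i r x => F _ i r x fun j => y j r x) heq hζ hB
        hM0 hα0 ?_ t ht i x
      · have h2 : (Y + M) * Real.exp (α * (t - s)) ≤ (Y + M) * Real.exp (α * (τ - s)) :=
          mul_le_mul_of_nonneg_left (Real.exp_le_exp.mpr (mul_le_mul_of_nonneg_left
            (by linarith [ht.2]) hα0.le)) (by positivity)
        linarith
      · intro r _ q hq i x
        refine abs_src_le (by omega) hM0 ((abs_nonneg _).trans (hq i x)) (fun k _ hk l => ?_)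
          (fun l => ?_) i
        · rw [hElow _ _ _ _ _ _ (by omega)]
          exact hM k (by omega) l r x
        · rw [hEtop]
          exact (abs_clip_le_abs (by positivity) _).trans (hq l x)
  obtain ⟨R, hR0, hR⟩ := hR
  have hMR : 0 ≤ max M R := hM0.trans (le_max_left _ _)
  obtain ⟨y, hyc, ⟨B, hyB⟩, hyeq⟩ := exists_transport hF (F := F R)
    (C := 2 ^ (n + 1) * (2 * max M R)) (C₀ := 2 ^ (n + 1) * (max M R * max M R)) hsτ (by positivity)
    (fun i => by
      refine continuous_src (z := fun k l (q : (ℝ × ℝ) × (Fin N → ℝ)) => E R q.2 q.1.1 q.1.2 k l)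
        (fun k _ hk l => ?_) i
      rcases Nat.lt_or_ge n k with h | h
      · obtain rfl : k = n + 1 := by omega
        simp only [hEtop]
        exact (continuous_clip R).comp ((continuous_apply l).comp continuous_snd)
      · simp only [hElow _ _ _ _ _ _ h]
        exact (hT.cont k h l).comp continuous_fst)
    (fun i r x ξ ξ' δ hδ => by
      have hδ0 : 0 ≤ δ := (abs_nonneg _).trans (hδ i)
      refine (abs_src_sub_le hMR hδ0 (hEM R hR0 ξ r x) (hEM R hR0 ξ' r x)
        (fun k _ hk l => ?_) i).trans (le_of_eq (by ring))
      rcases Nat.lt_or_ge n k with h | h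
      · obtain rfl : k = n + 1 := by omega
        rw [hEtop, hEtop]
        exact (abs_clip_sub_le R _ _).trans (hδ l)
      · rw [hElow _ _ _ _ _ _ h, hElow _ _ _ _ _ _ h, sub_self, abs_zero]
        exact hδ0)
    (fun i r x ξ => abs_src_le' hMR (hEM R hR0 ξ r x) i) hζc hζ
  have hyR := hR y B hyB hyeq
  let z' : ℕ → Fin N → ℝ → ℝ → ℝ := fun k => if k = n + 1 then y else z k
  have hztop : z' (n + 1) = y := if_pos rfl
  have hzlow : ∀ k ≤ n, z' k = z k := fun k hk => if_neg (by omega)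
  refine ⟨z', hzlow, ⟨fun j hj => ?_, ⟨max M B, hM1.trans (le_max_left _ _), fun j hj => ?_⟩,
    fun j hj => ?_⟩⟩
  · rcases Nat.lt_or_ge n j with h | h
    · obtain rfl : j = n + 1 := by omega
      rw [hztop]; exact hyc
    · rw [hzlow j h]; exact hT.cont j h
  · rcases Nat.lt_or_ge n j with h | h
    · obtain rfl : j = n + 1 := by omega
      rw [hztop]; exact fun i t x => (hyB i t x).trans (le_max_right _ _)
    · rw [hzlow j h]; exact fun i t x => (hM j h i t x).trans (le_max_left _ _)
  · rcases Nat.lt_or_ge n j with h | h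
    · obtain rfl : j = n + 1 := by omega
      rw [hztop]
      intro t ht i a
      rw [hyeq t ht i a]
      congr 1
      refine intervalIntegral.integral_congr fun r hr => ?_
      rw [uIcc_of_le ht.1] at hr
      refine src_congr (fun k _ hk => ?_) i
      funext l
      rcases Nat.lt_or_ge n k with h | h
      · obtain rfl : k = n + 1 := by omega
        rw [hEtop, hztop]
        exact clip_of_abs_le (hyR r ⟨hr.1, hr.2.trans ht.2⟩ l _)
      · rw [hElow _ _ _ _ _ _ h, hzlow k h]
    · rw [hzlow j h]
      intro t ht i a
      rw [hT.eq j h t ht i a]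
      congr 1
      refine intervalIntegral.integral_congr fun r _ => src_congr (fun k _ hk => ?_) i
      funext l
      rw [hzlow k (by omega)]

theorem IsFlow.abs_sub_le {N : ℕ} {X A : Fin N → ℝ → ℝ → ℝ} (hF : IsFlow X A) (i : Fin N)
    (r t x y : ℝ) : |X i r (A i t x) - X i r (A i t y)| ≤ 4 * |x - y| := by
  linarith [hF.lipX i r (A i t x) (A i t y), hF.lipA i t x y]

/-- Induction on the order. Along two particle paths of one index the difference of the sources is
linear in the differences of the fields, and the paths stay within four times the final distance. -/
theorem IsTower.exists_lipschitz {N : ℕ} {X A : Fin N → ℝ → ℝ → ℝ} (hF : IsFlow X A) {s τ : ℝ}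
    {ζ : ℕ → ℝ → ℝ} {z : ℕ → Fin N → ℝ → ℝ → ℝ} {n : ℕ} (hT : IsTower X s τ ζ z n)
    (hζ : ∀ j ≤ n, ∃ K, ∀ a b, |ζ j a - ζ j b| ≤ K * |a - b|) (m : ℕ) (hm : m ≤ n) :
    ∃ L, 0 ≤ L ∧ ∀ j ≤ m, ∀ t ∈ Icc s τ, ∀ i x y, |z j i t x - z j i t y| ≤ L * |x - y| := by
  obtain ⟨M, hM1, hM⟩ := hT.bdd
  have hM0 : 0 ≤ M := zero_le_one.trans hM1
  have step : ∀ m ≤ n, ∀ L', 0 ≤ L' → (∀ j, j < m → ∀ t ∈ Icc s τ, ∀ i x y,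
      |z j i t x - z j i t y| ≤ L' * |x - y|) → ∃ L, L' ≤ L ∧ ∀ t ∈ Icc s τ, ∀ i x y,
        |z m i t x - z m i t y| ≤ L * |x - y| := by
    intro m hm L' hL' hlow
    obtain ⟨K, hK⟩ := hζ m hm
    have hK0 : 0 ≤ K := by simpa using (abs_nonneg _).trans (hK 1 0)
    set Q : ℝ := max (2 * K) L' with hQ
    have hQ0 : 0 ≤ Q := hL'.trans (le_max_right _ _)
    set α : ℝ := 2 ^ m * (8 * M) with hα
    have hα0 : 0 < α := by positivity
    -- Grönwall needs an a priori bound on the difference quotient, which is what is to be shown.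
    -- Adding `η` to the denominator supplies the bound `2 * M / η`; the conclusion is free of it
    -- and `η` tends to zero.
    have key : ∀ η > 0, ∀ t ∈ Icc s τ, ∀ i x y,
        |z m i t x - z m i t y| ≤ Q * Real.exp (α * (t - s)) * (|x - y| + η) := by
      intro η hη
      have hpos : ∀ x y : ℝ, 0 < |x - y| + η := fun x y => by positivity
      have h := sup_gronwall (f := fun t (q : Fin N × ℝ × ℝ) =>
        |z m q.1 t q.2.1 - z m q.1 t q.2.2| / (|q.2.1 - q.2.2| + η)) (s := s) (τ := τ)
        (B := 2 * M / η) hα0.le hQ0 ?_ ?_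
      · intro t ht i x y
        exact (div_le_iff₀ (hpos x y)).mp (h t ht (i, x, y))
      · rintro t _ ⟨i, x, y⟩
        refine div_le_div₀ (by positivity) ?_ hη (by simp)
        have := abs_sub (z m i t x) (z m i t y)
        linarith [hM m hm i t x, hM m hm i t y]
      · rintro S hS hle t ht ⟨i, x, y⟩
        have hS0 : 0 ≤ S := hQ0.trans hS
        simp only
        rw [div_le_iff₀ (hpos x y)]
        have e1 := hT.eq m hm t ht i (A i t x)
        have e2 := hT.eq m hm t ht i (A i t y)
        rw [hF.right] at e1 e2
        have hcont : ∀ a, Continuous fun r => src (fun k l => z k l r (X i r a)) m i := fun a =>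
          continuous_src (z := fun k l r => z k l r (X i r a)) (fun k _ hk l =>
            continuous_along (hT.cont k (hk.trans hm) l) (hF.contX i) a) i
        have hb := abs_integral_le_exp (f := fun r => src (fun k l => z k l r (X i r (A i t x))) m i
            - src (fun k l => z k l r (X i r (A i t y))) m i) (C := α * (S * (|x - y| + η))) ht.1 hα0
          fun r hr => by
            have hr' : r ∈ Icc s τ := ⟨hr.1, hr.2.trans ht.2⟩
            have hexp : 1 ≤ Real.exp (α * (r - s)) := Real.one_le_exp (by nlinarith [hr.1])
            set e := Real.exp (α * (r - s))
            have hd := hF.abs_sub_le i r t x y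
            refine (abs_src_sub_le (δ := 4 * (S * e * (|x - y| + η))) hM0 (by positivity)
              (fun k _ hk l => hM k (hk.trans hm) l r _) (fun k _ hk l => hM k (hk.trans hm) l r _)
              (fun k _ hk l => ?_) i).trans (le_of_eq (by rw [hα]; ring))
            rcases eq_or_lt_of_le hk with rfl | hk
            · have h1 := hle r hr' (l, X i r (A i t x), X i r (A i t y))
              simp only at h1
              rw [div_le_iff₀ (hpos _ _)] at h1
              refine h1.trans ?_
              have : 0 ≤ S * e := by positivity
              nlinarith
            · refine (hlow k hk r hr' l _ _).trans ?_
              have h1 : L' ≤ S * e := ((le_max_right _ _).trans hS).trans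
                (le_mul_of_one_le_right hS0 hexp)
              have h2 := mul_le_mul h1 hd (abs_nonneg _) (by positivity)
              nlinarith [mul_nonneg hS0 (zero_le_one.trans hexp)]
        rw [intervalIntegral.integral_sub ((hcont _).intervalIntegrable _ _)
          ((hcont _).intervalIntegrable _ _), mul_div_cancel_left₀ _ hα0.ne'] at hb
        rw [e1, e2]
        have h1 := (hK (A i t x) (A i t y)).trans
          (mul_le_mul_of_nonneg_left (hF.lipA i t x y) hK0)
        have h2 : K * (2 * |x - y|) ≤ Q * (|x - y| + η) := by
          have := le_max_left (2 * K) L'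
          nlinarith [abs_nonneg (x - y)]
        have h3 := abs_add_le (ζ m (A i t x) - ζ m (A i t y))
          ((∫ r in s..t, src (fun k l => z k l r (X i r (A i t x))) m i)
            - ∫ r in s..t, src (fun k l => z k l r (X i r (A i t y))) m i)
        have h4 : ∀ a b c d : ℝ, a + b - (c + d) = a - c + (b - d) := fun a b c d => by ring
        rw [h4]
        nlinarith
    refine ⟨Q * Real.exp (α * |τ - s|), ?_, fun t ht i x y => ?_⟩
    · exact (le_max_right _ _).trans (le_mul_of_one_le_right hQ0 (Real.one_le_exp (by positivity)))
    · have h1 : Tendsto (fun η : ℝ => Q * Real.exp (α * (t - s)) * (|x - y| + η)) (𝓝[>] 0)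
          (𝓝 (Q * Real.exp (α * (t - s)) * (|x - y| + 0))) :=
        ((tendsto_const_nhds.add tendsto_id).const_mul _).mono_left nhdsWithin_le_nhds
      rw [add_zero] at h1
      have h2 := ge_of_tendsto h1 (eventually_nhdsWithin_of_forall fun η hη => key η hη t ht i x y)
      refine h2.trans (mul_le_mul_of_nonneg_right (mul_le_mul_of_nonneg_left
        (Real.exp_le_exp.mpr (mul_le_mul_of_nonneg_left ?_ hα0.le)) hQ0) (abs_nonneg _))
      exact (by linarith [ht.2] : t - s ≤ τ - s).trans (le_abs_self _)
  induction m with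
  | zero =>
    obtain ⟨L, hL, h⟩ := step 0 hm 0 le_rfl (fun j hj => absurd hj (Nat.not_lt_zero j))
    exact ⟨L, hL, fun j hj => by rw [Nat.le_zero.mp hj]; exact h⟩
  | succ m ih =>
    obtain ⟨L', hL', h'⟩ := ih (by omega)
    obtain ⟨L, hL, h⟩ := step (m + 1) hm L' hL' (fun j hj => h' j (by omega))
    refine ⟨L, hL'.trans hL, fun j hj => ?_⟩
    rcases Nat.lt_or_ge m j with hjm | hjm
    · obtain rfl : j = m + 1 := by omega
      exact h
    · exact fun t ht i x y => (h' j hjm t ht i x y).trans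
        (mul_le_mul_of_nonneg_right hL (abs_nonneg _))

/-! ### Uniform differentiability -/

theorem uniform_of_periodic {f : ℝ → ℝ} (hc : Continuous f) (hp : Function.Periodic f 1) {ε : ℝ}
    (hε : 0 < ε) : ∃ h > 0, ∀ x y, |x - y| ≤ h → |f x - f y| ≤ ε := by
  have hu := (isCompact_Icc (a := (-1 : ℝ)) (b := 2)).uniformContinuousOn_of_continuous
    hc.continuousOn
  rw [Metric.uniformContinuousOn_iff] at hu
  obtain ⟨δ, hδ, h⟩ := hu ε hε
  refine ⟨min (δ / 2) 1, by positivity, fun x y hxy => ?_⟩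
  have h1 : |x - y| ≤ 1 := hxy.trans (min_le_right _ _)
  have h2 : |x - y| < δ := (hxy.trans (min_le_left _ _)).trans_lt (by linarith)
  have hfl := Int.floor_le x
  have hfl' := Int.lt_floor_add_one x
  rw [abs_le] at h1
  have hper : ∀ z, f (z - ⌊x⌋) = f z := fun z => by
    have := hp.sub_int_mul_eq ⌊x⌋ (x := z)
    rwa [mul_one] at this
  have h3 := h (x - ⌊x⌋) ⟨by linarith, by linarith⟩ (y - ⌊x⌋) ⟨by linarith, by linarith⟩
    (by rw [Real.dist_eq]; convert h2 using 2; ring)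
  rw [hper, hper, Real.dist_eq] at h3
  exact h3.le

theorem lip_of_deriv_le {f f' : ℝ → ℝ} {C : ℝ} (hf : ∀ x, HasDerivAt f (f' x) x)
    (hb : ∀ x, |f' x| ≤ C) (x y : ℝ) : |f x - f y| ≤ C * |x - y| :=
  convex_univ.norm_image_sub_le_of_norm_hasDerivWithin_le (s := univ)
    (fun x _ => (hf x).hasDerivWithinAt) (fun x _ => hb x) (mem_univ y) (mem_univ x)

theorem uniform_hasDerivAt {f f' : ℝ → ℝ} (hf : ∀ x, HasDerivAt f (f' x) x)
    (hu : ∀ ε > 0, ∃ h > 0, ∀ x y, |x - y| ≤ h → |f' x - f' y| ≤ ε) {ε : ℝ} (hε : 0 < ε) :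
    ∃ h > 0, ∀ x y, |x - y| ≤ h → |f x - f y - f' y * (x - y)| ≤ ε * |x - y| := by
  obtain ⟨h, h0, hh⟩ := hu ε hε
  refine ⟨h, h0, fun x y hxy => ?_⟩
  have hder : ∀ z ∈ uIcc y x, HasDerivWithinAt (fun z => f z - f' y * z) (f' z - f' y) (uIcc y x) z :=
    fun z _ => by
      have := (hf z).sub ((hasDerivAt_id z).const_mul (f' y))
      rw [mul_one] at this
      exact this.hasDerivWithinAt
  have hb : ∀ z ∈ uIcc y x, ‖f' z - f' y‖ ≤ ε := fun z hz => by
    refine hh z y (le_trans ?_ hxy)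
    exact abs_sub_left_of_mem_uIcc hz
  have := (convex_uIcc y x).norm_image_sub_le_of_norm_hasDerivWithin_le hder hb left_mem_uIcc
    right_mem_uIcc
  rw [Real.norm_eq_abs, Real.norm_eq_abs] at this
  convert this using 2
  ring

/-- `φ'` is a spatial derivative of `φ` up to an error `S`, uniformly on the time interval
`[s, τ]`. -/
def UniformDeriv {N : ℕ} (s τ : ℝ) (S : ℝ → ℝ) (φ φ' : Fin N → ℝ → ℝ → ℝ) : Prop :=
  ∀ ε > 0, ∃ h > 0, ∀ t ∈ Icc s τ, ∀ i x y, |x - y| ≤ h →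
    |φ i t x - φ i t y - φ' i t y * (x - y)| ≤ (S t + ε) * |x - y|

theorem UniformDeriv.hasDerivAt {N : ℕ} {s τ : ℝ} {φ φ' : Fin N → ℝ → ℝ → ℝ}
    (h : UniformDeriv s τ (fun _ => 0) φ φ') {t : ℝ} (ht : t ∈ Icc s τ) (i : Fin N) (x : ℝ) :
    HasDerivAt (φ i t) (φ' i t x) x := by
  rw [hasDerivAt_iff_isLittleO, Asymptotics.isLittleO_iff]
  intro ε hε
  obtain ⟨δ, hδ, hd⟩ := h ε hε
  filter_upwards [Metric.closedBall_mem_nhds x hδ] with y hy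
  have := hd t ht i y x hy
  rw [zero_add] at this
  rwa [smul_eq_mul, mul_comm, Real.norm_eq_abs, Real.norm_eq_abs]

theorem exists_common_threshold {n : ℕ} {P : ℕ → ℝ → Prop}
    (h : ∀ j ≤ n, ∃ δ > 0, ∀ δ' ≤ δ, P j δ') : ∃ δ > 0, ∀ j ≤ n, ∀ δ' ≤ δ, P j δ' := by
  induction n with
  | zero =>
    obtain ⟨δ, hδ, hP⟩ := h 0 le_rfl
    exact ⟨δ, hδ, fun j hj => by rwa [Nat.le_zero.mp hj]⟩
  | succ n ih =>
    obtain ⟨δ₁, hδ₁, hP₁⟩ := ih fun j hj => h j (by omega)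
    obtain ⟨δ₂, hδ₂, hP₂⟩ := h (n + 1) le_rfl
    refine ⟨min δ₁ δ₂, lt_min hδ₁ hδ₂, fun j hj δ' hδ' => ?_⟩
    rcases Nat.lt_or_ge n j with hjn | hjn
    · obtain rfl : j = n + 1 := by omega
      exact hP₂ δ' (hδ'.trans (min_le_right _ _))
    · exact hP₁ j hjn δ' (hδ'.trans (min_le_left _ _))

theorem integral_mul_eq {P Q p q : ℝ → ℝ} {s t P₀ Q₀ : ℝ} (hst : s ≤ t) (hp : Continuous p)
    (hq : Continuous q) (hP : ∀ r ∈ Icc s t, P r = P₀ + ∫ x in s..r, p x)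
    (hQ : ∀ r ∈ Icc s t, Q r = Q₀ + ∫ x in s..r, q x) :
    P t * Q t = P₀ * Q₀ + ∫ r in s..t, (p r * Q r + P r * q r) := by
  have hd : ∀ {f : ℝ → ℝ} (c : ℝ), Continuous f → ∀ r,
      HasDerivAt (fun r => c + ∫ x in s..r, f x) (f r) r := fun c hf r =>
    (intervalIntegral.integral_hasDerivAt_right (hf.intervalIntegrable _ _)
      (hf.stronglyMeasurableAtFilter _ _) hf.continuousAt).const_add c
  have hc : ∀ {f : ℝ → ℝ} (c : ℝ), Continuous f → Continuous fun r => c + ∫ x in s..r, f x :=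
    fun c hf => continuous_iff_continuousAt.mpr fun r => (hd c hf r).continuousAt
  have h1 := intervalIntegral.integral_eq_sub_of_hasDerivAt (a := s) (b := t)
    (fun r _ => (hd P₀ hp r).mul (hd Q₀ hq r))
    (((hp.mul (hc Q₀ hq)).add ((hc P₀ hp).mul hq)).intervalIntegrable _ _)
  have h2 : ∫ r in s..t, (p r * Q r + P r * q r)
      = ∫ r in s..t, (p r * (Q₀ + ∫ x in s..r, q x) + (P₀ + ∫ x in s..r, p x) * q r) := by
    refine intervalIntegral.integral_congr fun r hr => ?_
    rw [uIcc_of_le hst] at hr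
    simp only [hP r hr, hQ r hr]
  simp only [Pi.mul_apply, intervalIntegral.integral_same, add_zero] at h1
  rw [h2, h1, hP t (right_mem_Icc.mpr hst), hQ t (right_mem_Icc.mpr hst)]
  ring

section Derivative

variable {N : ℕ} {X A : Fin N → ℝ → ℝ → ℝ} {s τ : ℝ} {p : Fin N → ℝ → ℝ} {ζ : ℕ → ℝ → ℝ}
  {z : ℕ → Fin N → ℝ → ℝ → ℝ} {n : ℕ}

/-- The remainder of the first order expansion of `z n` along a pair of particle paths. -/
theorem IsTower.remainder_eq (hF : IsFlow X A) (hT : IsTower X s τ ζ z (n + 1))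
    (hX : ∀ t ∈ Icc s τ, ∀ i a,
      X i t a = a + (∫ r in s..t, avg fun l => z 0 l r (X i r a)) + p i t)
    {t : ℝ} (ht : t ∈ Icc s τ) (i : Fin N) (a b : ℝ) :
    z n i t (X i t b) - z n i t (X i t a) - z (n + 1) i t (X i t a) * (X i t b - X i t a)
      = (ζ n b - ζ n a - ζ (n + 1) a * (b - a)) + ∫ r in s..t,
        ((src (fun k l => z k l r (X i r b)) n i - src (fun k l => z k l r (X i r a)) n i
            - srcDeriv (fun k l => z k l r (X i r a)) n i * (X i r b - X i r a))
          - z (n + 1) i r (X i r a) * ((avg fun l => z 0 l r (X i r b))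
            - (avg fun l => z 0 l r (X i r a))
            - (avg fun l => z 1 l r (X i r a)) * (X i r b - X i r a))) := by
  have hz : ∀ k ≤ n + 1, ∀ l c, Continuous fun r => z k l r (X i r c) := fun k hk l c =>
    continuous_along (hT.cont k hk l) (hF.contX i) c
  have hsrc : ∀ k ≤ n + 1, ∀ c, Continuous fun r => src (fun k l => z k l r (X i r c)) k i :=
    fun k hk c => continuous_src (z := fun k l r => z k l r (X i r c))
      (fun j _ hj l => hz j (hj.trans hk) l c) i
  have hu : ∀ c, Continuous fun r => avg fun l => z 0 l r (X i r c) := fun c =>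
    continuous_avg fun l => hz 0 (Nat.zero_le _) l c
  have hD : ∀ c, Continuous fun r => X i r c := fun c =>
    (hF.contX i).comp (continuous_id.prodMk continuous_const)
  have hdist : ∀ r ∈ Icc s t, X i r b - X i r a = (b - a) + ∫ x in s..r,
      ((avg fun l => z 0 l x (X i x b)) - avg fun l => z 0 l x (X i x a)) := by
    intro r hr
    have hr' : r ∈ Icc s τ := ⟨hr.1, hr.2.trans ht.2⟩
    rw [intervalIntegral.integral_sub ((hu b).intervalIntegrable _ _)
      ((hu a).intervalIntegrable _ _), hX r hr' i a, hX r hr' i b]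
    ring
  -- The forcing cancels in the distance of two particles of one index, so this distance is
  -- differentiable in time and the ordinary product rule applies to its product with `z (n + 1)`.
  have hprod := integral_mul_eq ht.1 (hsrc (n + 1) le_rfl a) ((hu b).sub (hu a))
    (fun r hr => hT.eq (n + 1) le_rfl r ⟨hr.1, hr.2.trans ht.2⟩ i a) hdist
  rw [hprod, hT.eq n (by omega) t ht i a, hT.eq n (by omega) t ht i b]
  have hI1 := (hsrc n (by omega) b).intervalIntegrable (μ := volume) s t
  have hI2 := (hsrc n (by omega) a).intervalIntegrable (μ := volume) s t
  have hI3 := (((hsrc (n + 1) le_rfl a).mul ((hD b).sub (hD a))).add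
    ((hz (n + 1) le_rfl i a).mul ((hu b).sub (hu a)))).intervalIntegrable (μ := volume) s t
  have hI := intervalIntegral.integral_sub (hI1.sub hI2) hI3
  rw [intervalIntegral.integral_sub hI1 hI2] at hI
  have hcongr : (∫ r in s..t,
        ((src (fun k l => z k l r (X i r b)) n i - src (fun k l => z k l r (X i r a)) n i
            - srcDeriv (fun k l => z k l r (X i r a)) n i * (X i r b - X i r a))
          - z (n + 1) i r (X i r a) * ((avg fun l => z 0 l r (X i r b))
            - (avg fun l => z 0 l r (X i r a))
            - (avg fun l => z 1 l r (X i r a)) * (X i r b - X i r a))))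
      = ∫ r in s..t, (src (fun k l => z k l r (X i r b)) n i
          - src (fun k l => z k l r (X i r a)) n i
          - (src (fun k l => z k l r (X i r a)) (n + 1) i * (X i r b - X i r a)
            + z (n + 1) i r (X i r a) * ((avg fun l => z 0 l r (X i r b))
              - avg fun l => z 0 l r (X i r a)))) :=
    intervalIntegral.integral_congr fun r _ => by
      simp only [src_succ]
      ring
  simp only [Pi.add_apply, Pi.mul_apply, Pi.sub_apply] at hI ⊢
  rw [hcongr, hI]
  ring

/-- By `remainder_eq` the remainder at time `t` is the initial one plus an integral of remainders of
order at most `n` and a quadratic term. The weight `lam` is so large that the integral returns at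
most half of the error `S`. -/
theorem IsTower.uniformDeriv_half (hF : IsFlow X A)
    (hT : IsTower X s τ ζ z (n + 1))
    (hX : ∀ t ∈ Icc s τ, ∀ i a,
      X i t a = a + (∫ r in s..t, avg fun l => z 0 l r (X i r a)) + p i t)
    {L M : ℝ} (hL0 : 0 ≤ L) (hM1 : 1 ≤ M) (hM : ∀ j ≤ n + 1, ∀ i t x, |z j i t x| ≤ M)
    (hL : ∀ j ≤ n, ∀ t ∈ Icc s τ, ∀ i x y, |z j i t x - z j i t y| ≤ L * |x - y|)
    (hlow : ∀ j < n, UniformDeriv s τ (fun _ => 0) (z j) (z (j + 1)))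
    (hζ : ∀ ε > 0, ∃ h > 0, ∀ b a, |b - a| ≤ h →
      |ζ n b - ζ n a - ζ (n + 1) a * (b - a)| ≤ ε * |b - a|)
    {S lam : ℝ} (hS : 0 ≤ S) (hlam : lam = 8 * (2 ^ n * (2 * M) + M + 1))
    (h : UniformDeriv s τ (fun t => S * Real.exp (lam * (t - s))) (z n) (z (n + 1))) :
    UniformDeriv s τ (fun t => S / 2 * Real.exp (lam * (t - s))) (z n) (z (n + 1)) := by
  have hM0 : 0 ≤ M := zero_le_one.trans hM1
  set K : ℝ := 2 ^ n * (2 * M) + M with hK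
  have hK0 : 0 ≤ K := by positivity
  have hlam0 : 0 < lam := by rw [hlam]; positivity
  intro ε hε
  set Emax : ℝ := Real.exp (lam * (τ - s)) with hEmax
  have hEmax0 : 0 < Emax := Real.exp_pos _
  -- The initial expansion costs `2 * ε₁` and the integral at most `ε₁ * Emax`.
  set ε₁ : ℝ := ε / (Emax + 2) with hε₁
  have hε₁0 : 0 < ε₁ := by positivity
  have hall : ∃ δ > 0, ∀ j ≤ n, ∀ δ' ≤ δ, ∀ t ∈ Icc s τ, ∀ i x y, |x - y| ≤ δ' →
      |z j i t x - z j i t y - z (j + 1) i t y * (x - y)|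
        ≤ (S * Real.exp (lam * (t - s)) + ε₁) * |x - y| := by
    refine exists_common_threshold fun j hj => ?_
    rcases eq_or_lt_of_le hj with rfl | hj
    · obtain ⟨δ, hδ, hd⟩ := h ε₁ hε₁0
      exact ⟨δ, hδ, fun δ' hδ' t ht i x y hxy => hd t ht i x y (hxy.trans hδ')⟩
    · obtain ⟨δ, hδ, hd⟩ := hlow j hj ε₁ hε₁0
      refine ⟨δ, hδ, fun δ' hδ' t ht i x y hxy => (hd t ht i x y (hxy.trans hδ')).trans ?_⟩
      refine mul_le_mul_of_nonneg_right ?_ (abs_nonneg _)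
      have : 0 ≤ S * Real.exp (lam * (t - s)) := by positivity
      linarith
  obtain ⟨δ₁, hδ₁, hd₁⟩ := hall
  obtain ⟨δ₂, hδ₂, hd₂⟩ := hζ ε₁ hε₁0
  -- At distances below `δ₃` the quadratic cross term is at most `ε₁` times the distance. The
  -- divisors below account for particles being at most four times, and labels at most twice, as far
  -- apart as `x` and `y`.
  set δ₃ : ℝ := ε₁ / (2 ^ n * M * L + 1) with hδ₃
  have hδ₃0 : 0 < δ₃ := by positivity
  refine ⟨min (δ₁ / 4) (min (δ₂ / 2) (δ₃ / 4)), by positivity, fun t ht i x y hxy => ?_⟩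
  have hx1 : 4 * |x - y| ≤ δ₁ := by
    have := hxy.trans (min_le_left _ _)
    linarith
  have hx2 : 2 * |x - y| ≤ δ₂ := by
    have := hxy.trans ((min_le_right _ _).trans (min_le_left _ _))
    linarith
  have hx3 : 4 * |x - y| ≤ δ₃ := by
    have := hxy.trans ((min_le_right _ _).trans (min_le_right _ _))
    linarith
  have hid := hT.remainder_eq hF hX ht i (A i t y) (A i t x)
  rw [hF.right, hF.right] at hid
  have hinit : |ζ n (A i t x) - ζ n (A i t y) - ζ (n + 1) (A i t y) * (A i t x - A i t y)|
      ≤ ε₁ * (2 * |x - y|) := by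
    have h1 := hF.lipA i t x y
    exact (hd₂ _ _ (h1.trans hx2)).trans (mul_le_mul_of_nonneg_left h1 hε₁0.le)
  have hint := abs_integral_le_exp (f := fun r =>
        ((src (fun k l => z k l r (X i r (A i t x))) n i
            - src (fun k l => z k l r (X i r (A i t y))) n i
            - srcDeriv (fun k l => z k l r (X i r (A i t y))) n i
              * (X i r (A i t x) - X i r (A i t y)))
          - z (n + 1) i r (X i r (A i t y)) * ((avg fun l => z 0 l r (X i r (A i t x)))
            - (avg fun l => z 0 l r (X i r (A i t y)))
            - (avg fun l => z 1 l r (X i r (A i t y))) * (X i r (A i t x) - X i r (A i t y)))))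
      (C := 4 * (K * S + (K + 1) * ε₁) * |x - y|) ht.1 hlam0 fun r hr => by
    have hr' : r ∈ Icc s τ := ⟨hr.1, hr.2.trans ht.2⟩
    have hdist := hF.abs_sub_le i r t x y
    set x' := X i r (A i t x)
    set y' := X i r (A i t y)
    have hexp : 1 ≤ Real.exp (lam * (r - s)) := Real.one_le_exp (by nlinarith [hr.1])
    set e := Real.exp (lam * (r - s)) with he
    set D := |x' - y'| with hD
    have hD0 : 0 ≤ D := abs_nonneg _
    have hρ0 : 0 ≤ (S * e + ε₁) * D := by positivity
    have h1 := abs_src_sub_sub_le (z := fun k l => z k l r y') (z' := fun k l => z k l r x')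
      (n := n) (ω := L * D) (e := x' - y') hM0 hρ0 (by positivity)
      (fun j _ hj l => hM j hj l r y') (fun j _ hj l => hM j (by omega) l r x')
      (fun j _ hj l => hL j hj r hr' l x' y')
      (fun j _ hj l => hd₁ j hj δ₁ le_rfl r hr' l x' y' (hdist.trans hx1)) i
    have h2 : |(avg fun l => z 0 l r x') - (avg fun l => z 0 l r y')
        - (avg fun l => z 1 l r y') * (x' - y')| ≤ (S * e + ε₁) * D := by
      rw [avg_mul, avg_sub, avg_sub]
      exact abs_avg_le hρ0 fun l => hd₁ 0 (Nat.zero_le _) δ₁ le_rfl r hr' l x' y' (hdist.trans hx1)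
    have h3 := abs_mul_le (hM (n + 1) le_rfl i r y') h2
    refine (abs_sub _ _).trans ?_
    have h4 : 2 ^ n * (M * D * (L * D)) ≤ ε₁ * D := by
      have h5 : (2 ^ n * M * L + 1) * D ≤ ε₁ := by
        have := hdist.trans hx3
        rwa [hδ₃, le_div_iff₀ (by positivity), mul_comm] at this
      have h6 : 2 ^ n * M * L * D ≤ ε₁ := by linarith
      calc 2 ^ n * (M * D * (L * D)) = 2 ^ n * M * L * D * D := by ring
        _ ≤ ε₁ * D := mul_le_mul_of_nonneg_right h6 hD0
    have h7 : (K * S + (K + 1) * ε₁) * D ≤ (K * S + (K + 1) * ε₁) * (4 * |x - y|) :=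
      mul_le_mul_of_nonneg_left hdist (by positivity)
    have h8 : K * (S * e + ε₁) + ε₁ ≤ (K * S + (K + 1) * ε₁) * e := by
      have : (K + 1) * ε₁ * 1 ≤ (K + 1) * ε₁ * e := mul_le_mul_of_nonneg_left hexp (by positivity)
      linarith
    have h9 : (K * (S * e + ε₁) + ε₁) * D ≤ (K * S + (K + 1) * ε₁) * e * D :=
      mul_le_mul_of_nonneg_right h8 hD0
    have h10 := mul_le_mul_of_nonneg_right h7 (zero_le_one.trans hexp)
    rw [hK] at h9 h10 ⊢
    linarith
  rw [hid]
  refine (abs_add_le _ _).trans ((add_le_add hinit hint).trans ?_)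
  have hE1 : 1 ≤ Real.exp (lam * (t - s)) := Real.one_le_exp (by nlinarith [ht.1])
  have hE2 : Real.exp (lam * (t - s)) ≤ Emax :=
    Real.exp_le_exp.mpr (mul_le_mul_of_nonneg_left (by linarith [ht.2]) hlam0.le)
  set e := Real.exp (lam * (t - s))
  have hC : 4 * (K * S + (K + 1) * ε₁) * |x - y| / lam ≤ (S / 2 + ε₁ / 2) * |x - y| := by
    rw [div_le_iff₀ hlam0, hlam]
    have := mul_nonneg hS (abs_nonneg (x - y))
    nlinarith
  have h1 : 4 * (K * S + (K + 1) * ε₁) * |x - y| / lam * (e - 1)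
      ≤ (S / 2 + ε₁ / 2) * |x - y| * e := by
    refine mul_le_mul hC (by linarith) (by linarith) (by positivity)
  have h2 : ε₁ * (Emax + 2) = ε := by rw [hε₁]; field_simp
  have h3 : ε₁ / 2 * e ≤ ε₁ * Emax := by nlinarith
  have h4 : (ε₁ * 2 + ε₁ / 2 * e) * |x - y| ≤ ε * |x - y| :=
    mul_le_mul_of_nonneg_right (by linarith) (abs_nonneg _)
  linarith

/-- The error `L + M` is trivial, since `z n` is Lipschitz and `z (n + 1)` is bounded; halving it
indefinitely leaves zero. -/
theorem IsTower.uniformDeriv (hF : IsFlow X A)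
    (hT : IsTower X s τ ζ z (n + 1))
    (hX : ∀ t ∈ Icc s τ, ∀ i a,
      X i t a = a + (∫ r in s..t, avg fun l => z 0 l r (X i r a)) + p i t)
    (hlip : ∀ j ≤ n, ∃ K, ∀ a b, |ζ j a - ζ j b| ≤ K * |a - b|)
    (hlow : ∀ j < n, UniformDeriv s τ (fun _ => 0) (z j) (z (j + 1)))
    (hζ : ∀ ε > 0, ∃ h > 0, ∀ b a, |b - a| ≤ h →
      |ζ n b - ζ n a - ζ (n + 1) a * (b - a)| ≤ ε * |b - a|) :
    UniformDeriv s τ (fun _ => 0) (z n) (z (n + 1)) := by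
  obtain ⟨M, hM1, hM⟩ := hT.bdd
  have hTn : IsTower X s τ ζ z n :=
    ⟨fun j hj => hT.cont j (by omega), ⟨M, hM1, fun j hj => hM j (by omega)⟩,
      fun j hj => hT.eq j (by omega)⟩
  obtain ⟨L, hL0, hL⟩ := hTn.exists_lipschitz hF hlip n le_rfl
  have hM0 : 0 ≤ M := zero_le_one.trans hM1
  set lam : ℝ := 8 * (2 ^ n * (2 * M) + M + 1) with hlam
  have hlam0 : 0 < lam := by positivity
  have key : ∀ k : ℕ, UniformDeriv s τ
      (fun t => (L + M) * (1 / 2) ^ k * Real.exp (lam * (t - s))) (z n) (z (n + 1)) := by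
    intro k
    induction k with
    | zero =>
      intro ε hε
      refine ⟨1, one_pos, fun t ht i x y _ => ?_⟩
      have h1 := hL n le_rfl t ht i x y
      have h2 := abs_mul_le (hM (n + 1) le_rfl i t y) (le_refl |x - y|)
      refine (abs_sub _ _).trans ((add_le_add h1 h2).trans ?_)
      rw [← add_mul]
      refine mul_le_mul_of_nonneg_right ?_ (abs_nonneg _)
      have hexp : 1 ≤ Real.exp (lam * (t - s)) := Real.one_le_exp (by nlinarith [ht.1])
      have : L + M ≤ (L + M) * Real.exp (lam * (t - s)) :=
        le_mul_of_one_le_right (by positivity) hexp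
      rw [pow_zero, mul_one]
      linarith
    | succ k ih =>
      have := hT.uniformDeriv_half hF hX hL0 hM1 hM hL hlow hζ
        (S := (L + M) * (1 / 2) ^ k) (by positivity) hlam ih
      convert this using 3
      ring
  intro ε hε
  obtain ⟨k, hk⟩ := ((tendsto_mul_half_pow ((L + M) * Real.exp (lam * (τ - s)))).eventually_lt_const
    (half_pos hε)).exists
  obtain ⟨h, h0, hh⟩ := key k (ε / 2) (half_pos hε)
  refine ⟨h, h0, fun t ht i x y hxy => (hh t ht i x y hxy).trans ?_⟩
  refine mul_le_mul_of_nonneg_right ?_ (abs_nonneg _)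
  have h1 : Real.exp (lam * (t - s)) ≤ Real.exp (lam * (τ - s)) :=
    Real.exp_le_exp.mpr (mul_le_mul_of_nonneg_left (by linarith [ht.2]) hlam0.le)
  have h2 : (L + M) * (1 / 2) ^ k * Real.exp (lam * (t - s))
      ≤ (L + M) * (1 / 2) ^ k * Real.exp (lam * (τ - s)) :=
    mul_le_mul_of_nonneg_left h1 (by positivity)
  linarith

end Derivative

/-! ### Spatial regularity of the solution -/

theorem periodic_iteratedDeriv {g : ℝ → ℝ} (hg : Function.Periodic g 1) (j : ℕ) :
    Function.Periodic (iteratedDeriv j g) 1 := by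
  have h : (fun x => g (x + 1)) = g := funext hg
  intro x
  have := congrFun (iteratedDeriv_comp_add_const j g 1) x
  rw [h] at this
  exact this.symm

theorem hasDerivAt_iteratedDeriv {g : ℝ → ℝ} {n j : ℕ} (hg : ContDiff ℝ n g) (hj : j < n) (x : ℝ) :
    HasDerivAt (iteratedDeriv j g) (iteratedDeriv (j + 1) g x) x := by
  rw [iteratedDeriv_succ]
  exact (hg.differentiable_iteratedDeriv j (by exact_mod_cast hj) x).hasDerivAt

/-- The field of order zero is constant along its particles, in accordance with a vanishing source.
At order one the smallness needed for the quadratic source is that of the window, as the derivative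
of `g` is at most `G`. -/
theorem IsData.exists_tower {N : ℕ} {s τ G : ℝ} {p : Fin N → ℝ → ℝ} {g : ℝ → ℝ}
    (H : IsData s τ G p g) (n : ℕ) (hg : ContDiff ℝ n g) :
    ∃ z : ℕ → Fin N → ℝ → ℝ → ℝ, (z 0 = fun i t x => g (back s τ p g i t x)) ∧
      IsTower (pos s τ p g) s τ (fun j => iteratedDeriv j g) z n ∧
      ∀ j < n, UniformDeriv s τ (fun _ => 0) (z j) (z (j + 1)) := by
  have hF := H.isFlow
  induction n with
  | zero =>
    obtain ⟨M, hM0, hM⟩ := exists_bound_of_periodic H.continuous H.per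
    refine ⟨fun _ i t x => g (back s τ p g i t x), rfl, ⟨fun j _ i => ?_, ⟨max M 1, le_max_right _ _,
      fun j _ i t x => (hM _).trans (le_max_left _ _)⟩, fun j hj t ht i a => ?_⟩,
      fun j hj => absurd hj (Nat.not_lt_zero j)⟩
    · exact H.continuous.comp (hF.contA i)
    · obtain rfl := Nat.le_zero.mp hj
      simp [src_zero, hF.left]
  | succ n ih =>
    obtain ⟨z, hz0, hT, hU⟩ := ih (hg.of_le (by exact_mod_cast Nat.le_succ n))
    have hζc : ∀ j ≤ n + 1, Continuous (iteratedDeriv j g) := fun j hj =>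
      hg.continuous_iteratedDeriv j (by exact_mod_cast hj)
    have hbd := fun j (hj : j ≤ n + 1) => exists_bound_of_periodic (hζc j hj)
      (periodic_iteratedDeriv H.per j)
    have hY : ∃ Y, (∀ a, |iteratedDeriv (n + 1) g a| ≤ Y) ∧ (n = 0 → 4 * Y * (τ - s) ≤ 1) := by
      rcases Nat.eq_zero_or_pos n with rfl | hn
      · refine ⟨G, fun a => ?_, fun _ => ?_⟩
        · rw [zero_add, iteratedDeriv_one]
          exact norm_deriv_le_of_lip' (f := g) (x₀ := a) H.nonneg (Eventually.of_forall fun x => H.lip x a)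
        · have := H.small
          have := H.nonneg
          have := H.le
          nlinarith
      · obtain ⟨M, _, hM⟩ := hbd (n + 1) le_rfl
        exact ⟨M, hM, fun h => absurd h hn.ne'⟩
    obtain ⟨Y, hY, hsmall⟩ := hY
    obtain ⟨z', hz', hT'⟩ := hT.exists_succ hF H.le (hζc (n + 1) le_rfl) hY hsmall
    have hz'0 : z' 0 = fun i t x => g (back s τ p g i t x) := by rw [hz' 0 (Nat.zero_le _), hz0]
    have hlow : ∀ j < n, UniformDeriv s τ (fun _ => 0) (z' j) (z' (j + 1)) := fun j hj => by
      rw [hz' j (by omega), hz' (j + 1) (by omega)]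
      exact hU j hj
    have hder := fun j (hj : j ≤ n) => hasDerivAt_iteratedDeriv hg (Nat.lt_succ_of_le hj)
    have htop : UniformDeriv s τ (fun _ => 0) (z' n) (z' (n + 1)) := by
      refine hT'.uniformDeriv (p := p) hF ?_ ?_ hlow ?_
      · intro t ht i a
        rw [hz'0]
        exact H.pos_eq ht i a
      · intro j hj
        obtain ⟨K, _, hK⟩ := hbd (j + 1) (by omega)
        exact ⟨K, lip_of_deriv_le (hder j hj) hK⟩
      · intro ε hε
        exact uniform_hasDerivAt (hder n le_rfl) (fun ε hε => uniform_of_periodic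
          (hζc (n + 1) le_rfl) (periodic_iteratedDeriv H.per (n + 1)) hε) hε
    refine ⟨z', hz'0, hT', fun j hj => ?_⟩
    rcases Nat.lt_or_ge j n with h | h
    · exact hlow j h
    · obtain rfl : j = n := by omega
      exact htop

/-! ### Norms of the solution -/

theorem ckNorm_nonneg (k : ℕ) (f : ℝ → ℝ) : 0 ≤ ckNorm k f :=
  Finset.sum_nonneg fun _ _ => Real.iSup_nonneg fun _ => abs_nonneg _

theorem ckNorm_le {k : ℕ} {f : ℝ → ℝ} {B : ℝ} (hB : 0 ≤ B)
    (h : ∀ j ≤ k, ∀ x, |iteratedDeriv j f x| ≤ B) : ckNorm k f ≤ (k + 1) * B := by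
  have h1 : ∀ j ∈ Finset.range (k + 1), ⨆ x : ℝ, |iteratedDeriv j f x| ≤ B := fun j hj =>
    Real.iSup_le (h j (Nat.lt_succ_iff.mp (Finset.mem_range.mp hj))) hB
  refine (Finset.sum_le_sum h1).trans (le_of_eq ?_)
  simp

theorem IsCk.abs_iteratedDeriv_le {k : ℕ} {f : ℝ → ℝ} (hf : IsCk k f) {j : ℕ} (hj : j ≤ k)
    (x : ℝ) : |iteratedDeriv j f x| ≤ ckNorm k f := by
  obtain ⟨M, _, hM⟩ := exists_bound_of_periodic
    (hf.2.continuous_iteratedDeriv j (by exact_mod_cast hj)) (periodic_iteratedDeriv hf.1 j)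
  have h1 : |iteratedDeriv j f x| ≤ ⨆ x : ℝ, |iteratedDeriv j f x| :=
    le_ciSup ⟨M, by rintro _ ⟨y, rfl⟩; exact hM y⟩ x
  refine h1.trans ?_
  exact Finset.single_le_sum (f := fun j => ⨆ x : ℝ, |iteratedDeriv j f x|)
    (fun _ _ => Real.iSup_nonneg fun _ => abs_nonneg _)
    (Finset.mem_range.mpr (Nat.lt_succ_of_le hj))

theorem IsCk.lip {k : ℕ} {f : ℝ → ℝ} (hf : IsCk k f) (hk : 1 ≤ k) (x y : ℝ) :
    |f x - f y| ≤ ckNorm k f * |x - y| := by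
  have h := fun x => hasDerivAt_iteratedDeriv hf.2 (show 0 < k from hk) x
  rw [iteratedDeriv_zero] at h
  exact lip_of_deriv_le h (fun x => hf.abs_iteratedDeriv_le hk x) x y

theorem tendsto_iSup_sub {F : ℝ → ℝ → ℝ} (hF : Continuous fun q : ℝ × ℝ => F q.1 q.2) {s τ : ℝ}
    (hper : ∀ t ∈ Icc s τ, Function.Periodic (F t) 1) {t : ℝ} (ht : t ∈ Icc s τ) :
    Tendsto (fun r => ⨆ x, |F r x - F t x|) (𝓝[Icc s τ] t) (𝓝 0) := by
  have hu := ((isCompact_Icc (a := s) (b := τ)).prod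
    (isCompact_Icc (a := (0 : ℝ)) (b := 1))).uniformContinuousOn_of_continuous hF.continuousOn
  rw [Metric.uniformContinuousOn_iff] at hu
  rw [Metric.tendsto_nhdsWithin_nhds]
  intro ε hε
  obtain ⟨δ, hδ, h⟩ := hu (ε / 2) (half_pos hε)
  refine ⟨δ, hδ, fun {r} hr hd => ?_⟩
  rw [Real.dist_0_eq_abs, abs_of_nonneg (Real.iSup_nonneg fun _ => abs_nonneg _)]
  refine lt_of_le_of_lt (Real.iSup_le (fun x => ?_) (half_pos hε).le) (half_lt_self hε)
  have hp : Function.Periodic (fun x => F r x - F t x) 1 := fun x => by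
    simp only [hper r hr x, hper t ht x]
  obtain ⟨y, hy, hxy⟩ := hp.exists_mem_Ico₀ one_pos x
  rw [hxy]
  have := h (r, y) ⟨hr, hy.1, hy.2.le⟩ (t, y) ⟨ht, hy.1, hy.2.le⟩ (by
    rw [Prod.dist_eq]
    simpa using hd)
  exact this.le

/-! ### Estimates on one window between resets. -/

section Window

variable {N : ℕ} {s τ G : ℝ} {p : Fin N → ℝ → ℝ} {g : ℝ → ℝ} {n : ℕ}

theorem hasDerivAt_avg {f f' : Fin N → ℝ → ℝ} {x : ℝ} (h : ∀ i, HasDerivAt (f i) (f' i x) x) :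
    HasDerivAt (fun y => avg fun i => f i y) (avg fun i => f' i x) x := by
  unfold avg
  exact (HasDerivAt.fun_sum fun i _ => h i).const_mul _

theorem IsData.iteratedDeriv_sol {z : ℕ → Fin N → ℝ → ℝ → ℝ}
    (hz0 : z 0 = fun i t x => g (back s τ p g i t x))
    (hU : ∀ j < n, UniformDeriv s τ (fun _ => 0) (z j) (z (j + 1))) {t : ℝ} (ht : t ∈ Icc s τ)
    {j : ℕ} (hj : j ≤ n) :
    iteratedDeriv j (sol s τ p g t) = fun x => avg fun i => z j i t x := by
  induction j with
  | zero =>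
    rw [iteratedDeriv_zero]
    funext x
    rw [sol_eq, hz0]
  | succ j ih =>
    rw [iteratedDeriv_succ, ih (by omega)]
    funext x
    exact (hasDerivAt_avg (f := fun i => z j i t) (f' := fun i => z (j + 1) i t)
      fun i => (hU j hj).hasDerivAt ht i x).deriv

theorem IsData.isCk_sol (H : IsData s τ G p g) (hg : ContDiff ℝ n g) {t : ℝ} (ht : t ∈ Icc s τ) :
    IsCk n (sol s τ p g t) := by
  obtain ⟨z, hz0, hT, hU⟩ := H.exists_tower n hg
  have hD := fun j (hj : j ≤ n) => IsData.iteratedDeriv_sol hz0 hU ht hj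
  refine ⟨H.periodic_sol t, contDiff_nat_iff_iteratedDeriv.mpr ⟨fun j hj => ?_, fun j hj => ?_⟩⟩
  · rw [hD j hj]
    exact continuous_avg fun i => (hT.cont j hj i).comp (continuous_const.prodMk continuous_id)
  · rw [hD j hj.le]
    exact fun x => (hasDerivAt_avg (f := fun i => z j i t) (f' := fun i => z (j + 1) i t)
      fun i => (hU j hj).hasDerivAt ht i x).differentiableAt

theorem IsData.tendsto_ckNorm_sol (H : IsData s τ G p g) (hg : ContDiff ℝ n g) {t : ℝ}
    (ht : t ∈ Icc s τ) :
    Tendsto (fun r => ckNorm n (sol s τ p g r - sol s τ p g t)) (𝓝[Icc s τ] t) (𝓝 0) := by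
  obtain ⟨z, hz0, hT, hU⟩ := H.exists_tower n hg
  have hper : ∀ j ≤ n, ∀ t ∈ Icc s τ, Function.Periodic (fun x => avg fun i => z j i t x) 1 := by
    intro j hj t ht
    rw [← IsData.iteratedDeriv_sol hz0 hU ht hj]
    exact periodic_iteratedDeriv (H.periodic_sol t) j
  have hlim : Tendsto (fun r => ∑ j ∈ Finset.range (n + 1),
      ⨆ x : ℝ, |(avg fun i => z j i r x) - avg fun i => z j i t x|) (𝓝[Icc s τ] t)
      (𝓝 (∑ j ∈ Finset.range (n + 1), 0)) := by
    refine tendsto_finsetSum _ fun j hj => ?_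
    have hj' := Nat.lt_succ_iff.mp (Finset.mem_range.mp hj)
    exact tendsto_iSup_sub (F := fun t x => avg fun i => z j i t x)
      (continuous_avg fun i => hT.cont j hj' i) (hper j hj') ht
  rw [Finset.sum_const_zero] at hlim
  refine hlim.congr' ?_
  filter_upwards [self_mem_nhdsWithin] with r hr
  refine Finset.sum_congr rfl fun j hj => ?_
  have hj' := Nat.lt_succ_iff.mp (Finset.mem_range.mp hj)
  congr 1
  funext x
  rw [iteratedDeriv_sub
    ((H.isCk_sol hg hr).2.contDiffAt.of_le (by exact_mod_cast hj'))
    ((H.isCk_sol hg ht).2.contDiffAt.of_le (by exact_mod_cast hj')),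
    IsData.iteratedDeriv_sol hz0 hU hr hj', IsData.iteratedDeriv_sol hz0 hU ht hj']

/-- Bounds for the spatial derivatives of the solution: `derivBound U j` bounds the derivatives of
order less than `j + 2`. -/
noncomputable def derivBound (U : ℝ) : ℕ → ℝ
  | 0 => 4 * U + 1
  | k + 1 => (U + derivBound U k) * Real.exp (2 ^ (k + 2) * derivBound U k)

theorem derivBound_pos {U : ℝ} (hU : 0 ≤ U) (k : ℕ) : 0 < derivBound U k := by
  induction k with
  | zero => simp only [derivBound]; positivity
  | succ k ih => simp only [derivBound]; positivity

theorem monotone_derivBound {U : ℝ} (hU : 0 ≤ U) : Monotone (derivBound U) := by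
  refine monotone_nat_of_le_succ fun k => ?_
  have hpos := derivBound_pos hU k
  have h1 : 1 ≤ Real.exp (2 ^ (k + 2) * derivBound U k) := Real.one_le_exp (by positivity)
  have h2 : U + derivBound U k ≤ derivBound U (k + 1) :=
    le_mul_of_one_le_right (by positivity) h1
  linarith

/-- The bound on derivatives of order `k + 2` that is propagated by the particle system. -/
def DerivControl (U : ℝ) (n : ℕ) (σ : ℝ) (h : ℝ → ℝ) : Prop :=
  ∀ k, k + 2 ≤ n → ∀ x, |iteratedDeriv (k + 2) h x| + derivBound U k
    ≤ (U + derivBound U k) * Real.exp (2 ^ (k + 2) * derivBound U k * σ)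

/-- All fields start from the same `g`, so its bounds hold for each of them initially; they are
propagated order by order and pass to the mean. -/
theorem IsData.derivControl_sol (H : IsData s τ G p g) (hg : ContDiff ℝ n g) {U σ : ℝ}
    (hU0 : 0 ≤ U) (hσ : 0 ≤ σ) (hG : G ≤ 2 * U) (hσ1 : σ + (τ - s) ≤ 1)
    (hc : DerivControl U n σ g) {t : ℝ} (ht : t ∈ Icc s τ) :
    DerivControl U n (σ + (t - s)) (sol s τ p g t) := by
  obtain ⟨z, hz0, hT, hU⟩ := H.exists_tower n hg
  have hF := H.isFlow
  obtain ⟨B, _, hB⟩ := hT.bdd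
  have h1 : 1 ≤ n → ∀ t ∈ Icc s τ, ∀ i x, |z 1 i t x| ≤ derivBound U 0 := by
    intro hn t ht i x
    have hd := (hU 0 hn).hasDerivAt ht i x
    -- The labels have Lipschitz constant 2, so order one is bounded by `2 * G ≤ 4 * U`.
    have hl := norm_deriv_le_of_lip' (f := z 0 i t) (x₀ := x) (C := 2 * G)
      (mul_nonneg zero_le_two H.nonneg) (Eventually.of_forall fun y => by
        simp only [hz0]
        refine (H.lip _ _).trans ?_
        have := mul_le_mul_of_nonneg_left (hF.lipA i t y x) H.nonneg
        rw [Real.norm_eq_abs]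
        linarith)
    rw [hd.deriv] at hl
    refine le_trans hl ?_
    simp only [derivBound]
    linarith
  have key : ∀ k, k + 2 ≤ n → ∀ t ∈ Icc s τ, ∀ i x, |z (k + 2) i t x| + derivBound U k
      ≤ (U + derivBound U k) * Real.exp (2 ^ (k + 2) * derivBound U k * (σ + (t - s))) := by
    intro k
    induction k using Nat.strong_induction_on with
    | _ k ih =>
      intro hk
      have hM := derivBound_pos hU0 k
      have hlow : ∀ j, 1 ≤ j → j < k + 2 → ∀ t ∈ Icc s τ, ∀ i x, |z j i t x| ≤ derivBound U k := by
        intro j hj hjk t ht i x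
        rcases eq_or_lt_of_le hj with rfl | hj
        · exact (h1 (by omega) t ht i x).trans (monotone_derivBound hU0 (Nat.zero_le k))
        · obtain ⟨l, rfl⟩ : ∃ l, j = l + 2 := ⟨j - 2, by omega⟩
          have h2 := ih l (by omega) (by omega) t ht i x
          have hMl := derivBound_pos hU0 l
          have h3 : Real.exp (2 ^ (l + 2) * derivBound U l * (σ + (t - s)))
              ≤ Real.exp (2 ^ (l + 2) * derivBound U l) :=
            Real.exp_le_exp.mpr (mul_le_of_le_one_right (by positivity) (by linarith [ht.2]))
          have h4 := mul_le_mul_of_nonneg_left h3 (show 0 ≤ U + derivBound U l by positivity)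
          have h5 : derivBound U (l + 1) ≤ derivBound U k := monotone_derivBound hU0 (by omega)
          rw [derivBound] at h5
          linarith
      intro t ht i x
      have hα : 0 < 2 ^ (k + 2) * derivBound U k := by positivity
      -- `Y` is chosen so that `Y + M` is the exponential bound at time `σ`; the Grönwall factor
      -- then advances the exponent to `σ + (t - s)`.
      have h2 := transport_gronwall hF (y := z (k + 2))
        (h := fun i r x => src (fun k l => z k l r x) (k + 2) i) (M := derivBound U k)
        (Y := (U + derivBound U k) * Real.exp (2 ^ (k + 2) * derivBound U k * σ) - derivBound U k)
        (hT.eq (k + 2) hk) (fun a => by linarith [hc k hk a]) (hB (k + 2) hk) hM.le hα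
        (fun r hr q hq i x => abs_src_le (by omega) hM.le ((abs_nonneg _).trans (hq i x))
          (fun j hj hjk l => hlow j hj hjk r hr l x) (fun l => hq l x) i) t ht i x
      rw [sub_add_cancel, mul_assoc, ← Real.exp_add, ← mul_add] at h2
      exact h2
  intro k hk x
  rw [IsData.iteratedDeriv_sol hz0 hU ht hk]
  have hN : ∀ i, |z (k + 2) i t x| ≤ (U + derivBound U k) *
      Real.exp (2 ^ (k + 2) * derivBound U k * (σ + (t - s))) - derivBound U k :=
    fun i => by linarith [key k hk t ht i x]
  have hM := derivBound_pos hU0 k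
  have hpos : 0 ≤ (U + derivBound U k) *
      Real.exp (2 ^ (k + 2) * derivBound U k * (σ + (t - s))) - derivBound U k := by
    have h3 : 1 ≤ Real.exp (2 ^ (k + 2) * derivBound U k * (σ + (t - s))) :=
      Real.one_le_exp (mul_nonneg (by positivity) (by linarith [ht.1]))
    nlinarith
  linarith [abs_avg_le hpos hN]

/-- The properties of the velocity that are propagated by the reset system, at the time `σ` after
the initial time; `K` is a Lipschitz constant of the initial velocity. -/
structure Controlled (K U : ℝ) (n : ℕ) (σ : ℝ) (h : ℝ → ℝ) : Prop where
  isCk : IsCk n h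
  bound : ∀ x, |h x| ≤ U
  lip : ∀ x y, |h x - h y| ≤ K / (1 - 3 * K * σ) * |x - y|
  deriv : DerivControl U n σ h

/-- The condition on `T` gives `3 * K * σ ≤ 1 / 2`, so the current Lipschitz constant is at most `2
* K`, and what remains of the time is still short in the sense of `IsData`. The constant 100 is
generous. -/
theorem Controlled.isData {K U σ T : ℝ} (hc : Controlled K U n σ g) (hK : 0 ≤ K) (hσ : 0 ≤ σ)
    (hT : 100 * (K + 1) * T ≤ 1) (hs : s ≤ τ) (hσT : σ + (τ - s) ≤ T)
    (hp : ∀ i, Continuous (p i)) (hp0 : ∀ i, p i s = 0) :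
    IsData s τ (K / (1 - 3 * K * σ)) p g := by
  have h1 : 100 * K * (σ + (τ - s)) ≤ 1 := by nlinarith
  have h2 : 3 * K * σ ≤ 1 / 2 := by nlinarith
  refine ⟨hs, hp, hp0, hc.lip, div_nonneg hK (by linarith), hc.isCk.1, ?_⟩
  have h3 : K / (1 - 3 * K * σ) ≤ 2 * K := by
    rw [div_le_iff₀ (by linarith)]
    nlinarith
  have h4 : 0 ≤ τ - s := by linarith
  nlinarith [mul_le_mul_of_nonneg_right h3 h4]

theorem Controlled.sol {K U σ T : ℝ} (hc : Controlled K U n σ g) (hK : 0 ≤ K) (hKU : K ≤ U)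
    (hσ : 0 ≤ σ) (hT : 100 * (K + 1) * T ≤ 1) (hs : s ≤ τ) (hσT : σ + (τ - s) ≤ T)
    (hp : ∀ i, Continuous (p i)) (hp0 : ∀ i, p i s = 0) {t : ℝ} (ht : t ∈ Icc s τ) :
    Controlled K U n (σ + (t - s)) (sol s τ p g t) := by
  have H := hc.isData hK hσ hT hs hσT hp hp0
  have hU : 0 ≤ U := hK.trans hKU
  have h1 : 100 * K * (σ + (τ - s)) ≤ 1 := by nlinarith
  have h2 : 3 * K * σ ≤ 1 / 2 := by nlinarith
  have h3 : K / (1 - 3 * K * σ) ≤ 2 * K := by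
    rw [div_le_iff₀ (by linarith)]
    nlinarith
  refine ⟨H.isCk_sol hc.isCk.2 ht, fun x => abs_avg_le hU fun j => hc.bound _, fun x y => ?_,
    H.derivControl_sol hc.isCk.2 hU hσ (by linarith) (by nlinarith) hc.deriv ht⟩
  have h4 := H.lip_sol ht x y
  convert h4 using 2
  have h5 : 3 * K * (σ + (t - s)) ≤ 1 / 2 := by nlinarith [ht.2]
  have h6 : (1 - 3 * K * σ) ≠ 0 := by linarith
  -- The semigroup law: the constant after time `σ`, evolved for `t - s`, is the constant after time
  -- `σ + (t - s)`.
  have h7 : 1 - 3 * (K / (1 - 3 * K * σ)) * (t - s)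
      = (1 - 3 * K * (σ + (t - s))) / (1 - 3 * K * σ) := by
    field_simp
    ring
  rw [h7, div_div_div_cancel_right₀ h6]

theorem Controlled.ckNorm_le {K U σ T : ℝ} (hc : Controlled K U n σ g) (hK : 0 ≤ K) (hKU : K ≤ U)
    (hσ : 0 ≤ σ) (hT : 100 * (K + 1) * T ≤ 1) (hσT : σ ≤ T) :
    ckNorm n g ≤ (n + 1) * derivBound U n := by
  have hU : 0 ≤ U := hK.trans hKU
  have h0 : 4 * U + 1 ≤ derivBound U n := monotone_derivBound hU (Nat.zero_le n)
  refine BurgersReset.ckNorm_le (derivBound_pos hU n).le fun j hj x => ?_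
  match j, hj with
  | 0, _ =>
    rw [iteratedDeriv_zero]
    linarith [hc.bound x]
  | 1, _ =>
    have h2 : 3 * K * σ ≤ 1 / 2 := by nlinarith
    have h3 : K / (1 - 3 * K * σ) ≤ 2 * K := by
      rw [div_le_iff₀ (by linarith)]
      nlinarith
    rw [iteratedDeriv_one]
    have := norm_deriv_le_of_lip' (f := g) (x₀ := x) (div_nonneg hK (by linarith))
      (Eventually.of_forall fun y => hc.lip y x)
    rw [Real.norm_eq_abs] at this
    linarith
  | k + 2, hk =>
    have h1 := hc.deriv k hk x
    have hM := derivBound_pos hU k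
    have h2 : Real.exp (2 ^ (k + 2) * derivBound U k * σ)
        ≤ Real.exp (2 ^ (k + 2) * derivBound U k) :=
      Real.exp_le_exp.mpr (mul_le_of_le_one_right (by positivity) (by nlinarith))
    have h3 := mul_le_mul_of_nonneg_left h2 (show 0 ≤ U + derivBound U k by positivity)
    have h4 : derivBound U (k + 1) ≤ derivBound U n := monotone_derivBound hU (by omega)
    rw [derivBound] at h4
    linarith

theorem Controlled.initial {K U : ℝ} (hg : IsCk n g) (hU : ckNorm n g ≤ U)
    (hlip : ∀ x y, |g x - g y| ≤ K * |x - y|) : Controlled K U n 0 g := by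
  refine ⟨hg, fun x => ?_, fun x y => by simpa using hlip x y, fun k hk x => ?_⟩
  · have := hg.abs_iteratedDeriv_le (Nat.zero_le n) x
    rw [iteratedDeriv_zero] at this
    exact this.trans hU
  · rw [mul_zero, Real.exp_zero, mul_one]
    linarith [hg.abs_iteratedDeriv_le hk x]

end Window

/-! ### Measurability of the solution -/

section Measurability

variable {Ω : Type*} [MeasurableSpace Ω] {N : ℕ} {s τ G : ℝ} {p : Ω → Fin N → ℝ → ℝ}
  {g : Ω → ℝ → ℝ}

theorem measurable_comp_of_continuous {f : Ω → ℝ → ℝ} (hc : ∀ ω, Continuous (f ω))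
    (hf : ∀ x, Measurable fun ω => f ω x) {Y : Ω → ℝ} (hY : Measurable Y) :
    Measurable fun ω => f ω (Y ω) := by
  have h := measurable_uncurry_of_continuous_of_measurable (u := fun x ω => f ω x) hc hf
  exact h.comp (hY.prodMk measurable_id)

theorem measurable_intervalIntegral {f : Ω → ℝ → ℝ} (hc : ∀ ω, Continuous (f ω))
    (hf : ∀ x, Measurable fun ω => f ω x) (a b : ℝ) :
    Measurable fun ω => ∫ r in a..b, f ω r := by
  have h := measurable_uncurry_of_continuous_of_measurable (u := fun x ω => f ω x) hc hf
  simp only [intervalIntegral]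
  exact (h.stronglyMeasurable.integral_prod_left' (μ := volume.restrict (Ioc a b))).measurable.sub
    (h.stronglyMeasurable.integral_prod_left' (μ := volume.restrict (Ioc b a))).measurable

/-- Positions increase with the label, so the label of `x` is at most `c` exactly when `x` is at
most the position of the particle `c`. -/
theorem measurable_lab (H : ∀ ω, IsData s τ G (p ω) (g ω)) {d : Ω → Fin N → ℝ → ℝ → ℝ}
    (hd : ∀ ω, IsDisplacement (d ω)) {r : ℝ} (hdm : ∀ i a, Measurable fun ω => d ω i r a)
    (hp : ∀ i, Measurable fun ω => p ω i r) (i : Fin N) (x : ℝ) :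
    Measurable fun ω => lab (p ω) (d ω) i r x := by
  refine measurable_of_Iic fun c => ?_
  have : (fun ω => lab (p ω) (d ω) i r x) ⁻¹' Iic c = {ω | x ≤ posn (p ω) (d ω) i r c} := by
    ext ω
    have hmono : StrictMono (posn (p ω) (d ω) i r) := fun a b hab => by
      have := (hd ω).posn_expand (p ω) i r hab.le
      linarith
    have hright := ((hd ω).isFlow (H ω).contp).right i r x
    simp only [mem_preimage, mem_Iic, mem_ofPred_eq]
    rw [← hmono.le_iff_le, hright]
  rw [this]
  exact measurableSet_le measurable_const ((measurable_const.add (hdm i c)).add (hp i))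

theorem measurable_vel (H : ∀ ω, IsData s τ G (p ω) (g ω)) {d : Ω → Fin N → ℝ → ℝ → ℝ}
    (hd : ∀ ω, IsDisplacement (d ω)) {r : ℝ} (hdm : ∀ i a, Measurable fun ω => d ω i r a)
    (hp : ∀ i, Measurable fun ω => p ω i r) (hg : ∀ x, Measurable fun ω => g ω x) (x : ℝ) :
    Measurable fun ω => vel (p ω) (g ω) (d ω) r x := by
  unfold vel avg
  refine measurable_const.mul (Finset.measurable_fun_sum _ fun i _ => ?_)
  exact measurable_comp_of_continuous (fun ω => (H ω).continuous) hg (measurable_lab H hd hdm hp i x)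

theorem measurable_dispIter (H : ∀ ω, IsData s τ G (p ω) (g ω)) {t : ℝ} (ht : t ∈ Icc s τ)
    (hp : ∀ r ∈ Icc s t, ∀ i, Measurable fun ω => p ω i r) (hg : ∀ x, Measurable fun ω => g ω x)
    (k : ℕ) : ∀ r ∈ Icc s t, ∀ i a, Measurable fun ω => dispIter s τ (p ω) (g ω) k i r a := by
  induction k with
  | zero => exact fun r _ i a => measurable_const
  | succ k ih =>
    intro r hr i a
    have hD : ∀ ω, IsDisplacement (dispIter s τ (p ω) (g ω) k) := fun ω =>
      (H ω).isDisplacement_dispIter k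
    -- Clamping the time to `[s, t]` makes the integrand continuous and measurable for every `x`
    -- without changing the integral, and uses the forcing up to time `t` only.
    have hcont : ∀ ω, Continuous fun x => vel (p ω) (g ω) (dispIter s τ (p ω) (g ω) k)
        (clampTime s t x) (posn (p ω) (dispIter s τ (p ω) (g ω) k) i (clampTime s t x) a) :=
      fun ω => (continuous_along ((H ω).continuous_vel (hD ω))
        (((hD ω).isFlow (H ω).contp).contX i) a).comp (continuous_clampTime s t)
    have hmeas : ∀ x, Measurable fun ω => vel (p ω) (g ω) (dispIter s τ (p ω) (g ω) k)
        (clampTime s t x) (posn (p ω) (dispIter s τ (p ω) (g ω) k) i (clampTime s t x) a) := by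
      intro x
      have hx := clampTime_mem ht.1 x
      refine measurable_comp_of_continuous (f := fun ω => vel (p ω) (g ω)
        (dispIter s τ (p ω) (g ω) k) (clampTime s t x))
        (fun ω => ((H ω).continuous_vel (hD ω)).comp (continuous_const.prodMk continuous_id))
        (measurable_vel H hD (fun i a => ih _ hx i a) (hp _ hx) hg) ?_
      exact (measurable_const.add (ih _ hx i a)).add (hp _ hx i)
    have h := measurable_intervalIntegral hcont hmeas s r
    convert h using 2 with ω
    simp only [dispIter, nextDisp]
    rw [clampTime_of_mem ⟨hr.1, hr.2.trans ht.2⟩]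
    refine intervalIntegral.integral_congr fun x hx => ?_
    rw [uIcc_of_le hr.1] at hx
    simp only [clampTime_of_mem (show x ∈ Icc s t from ⟨hx.1, hx.2.trans hr.2⟩)]

theorem measurable_disp (H : ∀ ω, IsData s τ G (p ω) (g ω)) {t : ℝ} (ht : t ∈ Icc s τ)
    (hp : ∀ r ∈ Icc s t, ∀ i, Measurable fun ω => p ω i r) (hg : ∀ x, Measurable fun ω => g ω x)
    (i : Fin N) (a : ℝ) : Measurable fun ω => disp s τ (p ω) (g ω) i t a := by
  refine measurable_of_tendsto_metrizable (fun k =>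
    measurable_dispIter H ht hp hg k t (right_mem_Icc.mpr ht.1) i a) (tendsto_pi_nhds.mpr fun ω => ?_)
  obtain ⟨M, _, hM⟩ := (H ω).exists_rate
  exact (hM i t a).1

theorem measurable_pos (H : ∀ ω, IsData s τ G (p ω) (g ω)) {t : ℝ} (ht : t ∈ Icc s τ)
    (hp : ∀ r ∈ Icc s t, ∀ i, Measurable fun ω => p ω i r) (hg : ∀ x, Measurable fun ω => g ω x)
    (i : Fin N) (a : ℝ) : Measurable fun ω => pos s τ (p ω) (g ω) i t a :=
  (measurable_const.add (measurable_disp H ht hp hg i a)).add (hp t (right_mem_Icc.mpr ht.1) i)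

theorem measurable_sol (H : ∀ ω, IsData s τ G (p ω) (g ω)) {t : ℝ} (ht : t ∈ Icc s τ)
    (hp : ∀ r ∈ Icc s t, ∀ i, Measurable fun ω => p ω i r) (hg : ∀ x, Measurable fun ω => g ω x)
    (x : ℝ) : Measurable fun ω => sol s τ (p ω) (g ω) t x :=
  measurable_vel H (fun ω => (H ω).isDisplacement_disp) (fun i a => measurable_disp H ht hp hg i a)
    (hp t (right_mem_Icc.mpr ht.1)) hg x

end Measurability

/-! ### Continuous adapted modifications of Wiener processes -/

/-- The largest multiple of `2⁻ᵏ` that is at most `t`. -/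
noncomputable def dyadicBelow (t : ℝ≥0) (k : ℕ) : ℝ≥0 := (⌊t * 2 ^ k⌋₊ : ℝ≥0) / 2 ^ k

theorem dyadicBelow_le (t : ℝ≥0) (k : ℕ) : dyadicBelow t k ≤ t := by
  rw [dyadicBelow, div_le_iff₀ (by positivity)]
  exact Nat.floor_le bot_le

theorem tendsto_dyadicBelow (t : ℝ≥0) : Tendsto (dyadicBelow t) atTop (𝓝 t) := by
  rw [tendsto_iff_dist_tendsto_zero]
  refine squeeze_zero (fun _ => dist_nonneg) (fun k => ?_) (tendsto_mul_half_pow 1)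
  have h1 := dyadicBelow_le t k
  have h2 : t ≤ dyadicBelow t k + (1 / 2) ^ k := by
    have h3 := (Nat.lt_floor_add_one (t * 2 ^ k)).le
    rw [dyadicBelow, one_div, inv_pow, ← one_div, ← add_div, le_div_iff₀ (by positivity)]
    exact h3
  rw [NNReal.dist_eq, one_mul, abs_sub_comm, abs_of_nonneg (sub_nonneg.mpr (by exact_mod_cast h1))]
  have h4 : (t : ℝ) ≤ dyadicBelow t k + (1 / 2) ^ k := by exact_mod_cast h2
  linarith

/-- The nonnegative dyadic numbers. -/
def dyadics : Set ℝ≥0 := range fun q : ℕ × ℕ => (q.1 : ℝ≥0) / 2 ^ q.2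

theorem countable_dyadics : dyadics.Countable := countable_range _

theorem dyadicBelow_mem (t : ℝ≥0) (k : ℕ) : dyadicBelow t k ∈ dyadics :=
  ⟨(⌊t * 2 ^ k⌋₊, k), rfl⟩

theorem dense_dyadics : Dense dyadics := fun t =>
  mem_closure_of_tendsto (tendsto_dyadicBelow t) (Eventually.of_forall (dyadicBelow_mem t))

/-- Functions whose restriction to the dyadic numbers is uniformly continuous on bounded sets. -/
def DyadicUniform (w : ℝ≥0 → ℝ) : Prop :=
  ∀ m l : ℕ, ∃ j : ℕ, ∀ q ∈ dyadics, ∀ q' ∈ dyadics, q ≤ m → q' ≤ m →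
    dist q q' ≤ 1 / (j + 1) → |w q - w q'| ≤ 1 / (l + 1)

theorem dyadicUniform_of_continuous {w : ℝ≥0 → ℝ} (hw : Continuous w) : DyadicUniform w := by
  intro m l
  have hu := (isCompact_Icc (a := (0 : ℝ≥0)) (b := m)).uniformContinuousOn_of_continuous
    hw.continuousOn
  rw [Metric.uniformContinuousOn_iff] at hu
  obtain ⟨δ, hδ, h⟩ := hu (1 / (l + 1)) (by positivity)
  obtain ⟨j, hj⟩ := exists_nat_one_div_lt hδ
  exact ⟨j, fun q _ q' _ hq hq' hqq =>
    (h q ⟨bot_le, hq⟩ q' ⟨bot_le, hq'⟩ (hqq.trans_lt hj)).le⟩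

theorem DyadicUniform.exists_tendsto {w : ℝ≥0 → ℝ} (hw : DyadicUniform w) (t : ℝ≥0) :
    ∃ y, Tendsto w (𝓝[dyadics] t) (𝓝 y) := by
  have : (𝓝[dyadics] t).NeBot := mem_closure_iff_nhdsWithin_neBot.mp (dense_dyadics t)
  refine cauchy_map_iff_exists_tendsto.mp (Metric.cauchy_iff.mpr ⟨inferInstance, fun ε hε => ?_⟩)
  obtain ⟨m, hm⟩ := exists_nat_gt t
  obtain ⟨l, hl⟩ := exists_nat_one_div_lt hε
  obtain ⟨j, hj⟩ := hw m l
  have hj0 : (0 : ℝ) < 1 / (j + 1) / 2 := by positivity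
  have hball : dyadics ∩ (Iio (m : ℝ≥0) ∩ Metric.ball t (1 / (j + 1) / 2)) ∈ 𝓝[dyadics] t :=
    inter_mem self_mem_nhdsWithin
      (mem_nhdsWithin_of_mem_nhds (inter_mem (Iio_mem_nhds hm) (Metric.ball_mem_nhds t hj0)))
  refine ⟨_, image_mem_map hball, ?_⟩
  rintro _ ⟨q, ⟨hq, hqm, hqt⟩, rfl⟩ _ ⟨q', ⟨hq', hqm', hqt'⟩, rfl⟩
  rw [Real.dist_eq]
  refine (hj q hq q' hq' (mem_Iio.mp hqm).le (mem_Iio.mp hqm').le ?_).trans_lt hl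
  rw [Metric.mem_ball] at hqt hqt'
  have := dist_triangle_right q q' t
  linarith

theorem DyadicUniform.continuous_extendFrom {w : ℝ≥0 → ℝ} (hw : DyadicUniform w) :
    Continuous (extendFrom dyadics w) :=
  _root_.continuous_extendFrom dense_dyadics hw.exists_tendsto

theorem DyadicUniform.tendsto_dyadicBelow {w : ℝ≥0 → ℝ} (hw : DyadicUniform w) (t : ℝ≥0) :
    Tendsto (fun k => w (dyadicBelow t k)) atTop (𝓝 (extendFrom dyadics w t)) :=
  (tendsto_extendFrom (hw.exists_tendsto t)).comp (tendsto_nhdsWithin_iff.mpr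
    ⟨BurgersReset.tendsto_dyadicBelow t, Eventually.of_forall (dyadicBelow_mem t)⟩)

section Modification

variable {Ω : Type*} {mΩ : MeasurableSpace Ω} {F : Filtration ℝ≥0 mΩ} {P : Measure Ω}

theorem measurableSet_dyadicUniform {m : MeasurableSpace Ω} {W : ℝ≥0 → Ω → ℝ}
    (hW : ∀ t, Measurable[m] (W t)) : MeasurableSet[m] {ω | DyadicUniform (W · ω)} := by
  simp only [DyadicUniform, ofPred_forall, ofPred_exists]
  refine MeasurableSet.iInter fun m => MeasurableSet.iInter fun l => MeasurableSet.iUnion fun j =>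
    MeasurableSet.biInter countable_dyadics fun q _ =>
    MeasurableSet.biInter countable_dyadics fun q' _ =>
    MeasurableSet.iInter fun _ => MeasurableSet.iInter fun _ => MeasurableSet.iInter fun _ =>
    measurableSet_le ((hW q).sub (hW q')).norm measurable_const

/-- Under the usual conditions, an adapted process with almost surely continuous paths is
indistinguishable from an adapted process with continuous paths. -/
theorem exists_continuous_adapted (hF : UsualConditions F P) {W : ℝ≥0 → Ω → ℝ}
    (hW : ∀ t, Measurable[F t] (W t)) (hc : ∀ᵐ ω ∂P, Continuous (W · ω)) :
    ∃ V : ℝ≥0 → Ω → ℝ, (∀ ω, Continuous (V · ω)) ∧ (∀ t, Measurable[F t] (V t)) ∧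
      ∀ᵐ ω ∂P, ∀ t, V t ω = W t ω := by
  classical
  set D : Set Ω := {ω | DyadicUniform (W · ω)} with hD
  have hDm : MeasurableSet[⨆ t, F t] D :=
    measurableSet_dyadicUniform fun t => (hW t).mono (le_iSup F.seq t) le_rfl
  -- The complement of `D` lies in the sigma algebra generated by the filtration and is null, so the
  -- usual conditions place it in `F 0`.
  have hD0 : MeasurableSet[F 0] D := by
    refine MeasurableSet.of_compl (hF.nullSets _ hDm.compl ?_)
    refine measure_mono_null (fun ω hω => ?_) (ae_iff.mp hc)
    exact fun h => hω (dyadicUniform_of_continuous h)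
  refine ⟨fun t ω => if ω ∈ D then extendFrom dyadics (W · ω) t else 0, fun ω => ?_, fun t => ?_, ?_⟩
  · by_cases h : ω ∈ D
    · simpa only [if_pos h] using DyadicUniform.continuous_extendFrom h
    · simpa only [if_neg h] using continuous_const
  -- The extension at `t` is a limit along dyadic times below `t`, hence adapted.
  · refine @measurable_of_tendsto_metrizable _ _ (F t) _ _ _ _
      (fun k ω => if ω ∈ D then W (dyadicBelow t k) ω else 0) _ (fun k => ?_)
      (tendsto_pi_nhds.mpr fun ω => ?_)
    · exact Measurable.ite (F.mono bot_le _ hD0)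
        ((hW _).mono (F.mono (dyadicBelow_le t k)) le_rfl) measurable_const
    · by_cases h : ω ∈ D
      · simpa only [if_pos h] using DyadicUniform.tendsto_dyadicBelow h t
      · simpa only [if_neg h] using tendsto_const_nhds
  · filter_upwards [hc] with ω hω t
    have h : ω ∈ D := dyadicUniform_of_continuous hω
    rw [if_pos h]
    exact tendsto_nhds_unique (DyadicUniform.tendsto_dyadicBelow h t)
      ((hω.tendsto t).comp (tendsto_dyadicBelow t))

theorem measurableSet_lip_rat {m : MeasurableSpace Ω} {f : Ω → ℝ → ℝ}
    (hf : ∀ x, Measurable[m] fun ω => f ω x) (U : ℝ) :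
    MeasurableSet[m] {ω | ∀ q r : ℚ, |f ω q - f ω r| ≤ U * |(q : ℝ) - r|} := by
  simp only [ofPred_forall]
  exact MeasurableSet.iInter fun q => MeasurableSet.iInter fun r =>
    measurableSet_le ((hf q).sub (hf r)).norm measurable_const

/-- A `C^k(𝕋)`-valued random variable whose norm is almost surely at most `U` agrees almost surely
with one whose paths are all Lipschitz with constant `U`. -/
theorem IsCkRandomVariable.exists_lip {s : ℝ≥0} {k : ℕ} {f : Ω → ℝ → ℝ} (hk : 1 ≤ k)
    (hf : IsCkRandomVariable F s k f) {U : ℝ≥0} (hU : ∀ᵐ ω ∂P, ckNorm k (f ω) ≤ U) :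
    ∃ g : Ω → ℝ → ℝ, IsCkRandomVariable F s k g ∧ (∀ ω x y, |g ω x - g ω y| ≤ U * |x - y|) ∧
      ∀ᵐ ω ∂P, g ω = f ω := by
  classical
  -- Rational points make this a countable family of conditions, hence an event of `F s`; continuity
  -- of the paths extends the bound to all points.
  set D : Set Ω := {ω | ∀ q r : ℚ, |f ω q - f ω r| ≤ U * |(q : ℝ) - r|} with hD
  have hDm : MeasurableSet[F s] D :=
    measurableSet_lip_rat (fun x => (measurable_pi_apply x).comp hf.measurable) U
  have hlip : ∀ ω ∈ D, ∀ x y, |f ω x - f ω y| ≤ U * |x - y| := by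
    intro ω hω
    have hc := (hf.mem ω).2.continuous
    have hcl : IsClosed {z : ℝ × ℝ | |f ω z.1 - f ω z.2| ≤ U * |z.1 - z.2|} := by
      refine isClosed_le ?_ ?_ <;> fun_prop
    have hd := (Rat.denseRange_cast (𝕜 := ℝ)).prodMap (Rat.denseRange_cast (𝕜 := ℝ))
    intro x y
    refine closure_minimal ?_ hcl (hd (x, y))
    rintro _ ⟨⟨q, r⟩, rfl⟩
    exact hω q r
  refine ⟨fun ω => if ω ∈ D then f ω else 0, ⟨?_, fun ω => ?_⟩, fun ω x y => ?_, ?_⟩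
  · exact Measurable.ite hDm hf.measurable measurable_const
  · by_cases h : ω ∈ D
    · simpa only [if_pos h] using hf.mem ω
    · simp only [if_neg h]
      exact ⟨fun _ => rfl, contDiff_const⟩
  · by_cases h : ω ∈ D
    · simpa only [if_pos h] using hlip ω h x y
    · simp only [if_neg h, Pi.zero_apply, sub_self, abs_zero]
      positivity
  · filter_upwards [hU] with ω hω
    have h : ω ∈ D := fun q r => ((hf.mem ω).lip hk q r).trans
      (mul_le_mul_of_nonneg_right hω (abs_nonneg _))
    exact if_pos h

end Modification
/-! ### The particle system along one path of the driving processes -/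

section Path

variable {N : ℕ}

/-- The increments after time `s` of a family of paths. -/
def incr (w : Fin N → ℝ≥0 → ℝ) (s : ℝ≥0) (i : Fin N) (r : ℝ) : ℝ := w i r.toNNReal - w i s

/-- The velocity of the particle system stopped at `τ ∨ s`, with data `g` at time `s`. -/
noncomputable def winSol (s τ : ℝ≥0) (w : Fin N → ℝ≥0 → ℝ) (g : ℝ → ℝ) (t : ℝ≥0) : ℝ → ℝ :=
  sol s (max τ s : ℝ≥0) (incr w s) g (min (max τ s) t : ℝ≥0)

/-- The positions in the particle system stopped at `τ ∨ s`, with data `g` at time `s`. -/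
noncomputable def winPos (s τ : ℝ≥0) (w : Fin N → ℝ≥0 → ℝ) (g : ℝ → ℝ) (i : Fin N) (t : ℝ≥0) :
    ℝ → ℝ :=
  pos s (max τ s : ℝ≥0) (incr w s) g i (min (max τ s) t : ℝ≥0)

/-- The labels in the particle system stopped at `τ ∨ s`, with data `g` at time `s`. -/
noncomputable def winBack (s τ : ℝ≥0) (w : Fin N → ℝ≥0 → ℝ) (g : ℝ → ℝ) (i : Fin N) (t : ℝ≥0) :
    ℝ → ℝ :=
  back s (max τ s : ℝ≥0) (incr w s) g i (min (max τ s) t : ℝ≥0)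

/-- The equations of the particle system along one path of the driving processes. -/
def IsPathFixedPoint (s τ : ℝ≥0) (w : Fin N → ℝ≥0 → ℝ) (g : ℝ → ℝ) (v : ℝ≥0 → ℝ → ℝ)
    (X A : Fin N → ℝ≥0 → ℝ → ℝ) : Prop :=
  ∀ t, s ≤ t →
    (∀ i a,
      IntervalIntegrable (fun r : ℝ => v r.toNNReal (X i r.toNNReal a)) volume
        (s : ℝ) (min (max τ s) t : ℝ≥0) ∧
      X i t a = a + (∫ r in (s : ℝ)..(min (max τ s) t : ℝ≥0), v r.toNNReal (X i r.toNNReal a))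
        + (w i (min (max τ s) t) - w i s)) ∧
    (∀ i, Function.LeftInverse (A i t) (X i t) ∧ Function.RightInverse (A i t) (X i t)) ∧
    ∀ x, v t x = (1 / (N : ℝ)) * ∑ i, g (A i t x)

variable {s τ : ℝ≥0} {w : Fin N → ℝ≥0 → ℝ} {g : ℝ → ℝ} {G : ℝ}

theorem continuous_incr (hw : ∀ i, Continuous (w i)) (s : ℝ≥0) (i : Fin N) :
    Continuous (incr w s i) :=
  ((hw i).comp continuous_real_toNNReal).sub continuous_const

theorem incr_self (w : Fin N → ℝ≥0 → ℝ) (s : ℝ≥0) (i : Fin N) : incr w s i s = 0 := by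
  rw [incr, Real.toNNReal_coe, sub_self]

theorem stopped_mem {t : ℝ≥0} (ht : s ≤ t) :
    ((min (max τ s) t : ℝ≥0) : ℝ) ∈ Icc (s : ℝ) (max τ s : ℝ≥0) :=
  ⟨NNReal.coe_le_coe.mpr (le_min (le_max_right _ _) ht), NNReal.coe_le_coe.mpr (min_le_left _ _)⟩

theorem stopped_toNNReal {t : ℝ≥0} {r : ℝ} (hr : r ∈ Icc (s : ℝ) (min (max τ s) t : ℝ≥0)) :
    ((min (max τ s) r.toNNReal : ℝ≥0) : ℝ) = r := by
  have h0 : 0 ≤ r := s.2.trans hr.1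
  rw [min_eq_right, Real.coe_toNNReal r h0]
  rw [Real.toNNReal_le_iff_le_coe]
  exact hr.2.trans (NNReal.coe_le_coe.mpr (min_le_left _ _))

theorem isPathFixedPoint_win (H : IsData s (max τ s : ℝ≥0) G (incr w s) g) :
    IsPathFixedPoint s τ w g (winSol s τ w g) (winPos s τ w g) (winBack s τ w g) := by
  intro t ht
  have hm := stopped_mem (τ := τ) ht
  refine ⟨fun i a => ?_, fun i => ⟨H.isFlow.left i _, H.isFlow.right i _⟩, fun x => rfl⟩
  have hcongr : ∀ r ∈ uIcc (s : ℝ) (min (max τ s) t : ℝ≥0),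
      sol s (max τ s : ℝ≥0) (incr w s) g r (pos s (max τ s : ℝ≥0) (incr w s) g i r a) =
        winSol s τ w g r.toNNReal (winPos s τ w g i r.toNNReal a) := by
    intro r hr
    rw [uIcc_of_le hm.1] at hr
    rw [winSol, winPos, stopped_toNNReal hr]
  have hcont := continuous_along H.continuous_sol (H.isFlow.contX i) a
  refine ⟨(hcont.intervalIntegrable _ _).congr fun r hr => ?_, ?_⟩
  · exact hcongr r (uIoc_subset_uIcc hr)
  · rw [← intervalIntegral.integral_congr hcongr]
    have h := H.pos_eq hm i a
    rw [incr, Real.toNNReal_coe] at h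
    exact h

/-- Up to the time `τ ∨ s` this is `sol_unique`. Afterwards the equation freezes the positions,
hence also their inverses and the velocity. -/
theorem IsPathFixedPoint.eq_winSol (H : IsData s (max τ s : ℝ≥0) G (incr w s) g)
    {v : ℝ≥0 → ℝ → ℝ} {X A : Fin N → ℝ≥0 → ℝ → ℝ} (h : IsPathFixedPoint s τ w g v X A)
    {t : ℝ≥0} (ht : s ≤ t) : v t = winSol s τ w g t := by
  have hback : ∀ r ∈ Icc (s : ℝ) (max τ s : ℝ≥0), s ≤ r.toNNReal ∧
      min (max τ s) r.toNNReal = r.toNNReal ∧ (r.toNNReal : ℝ) = r := by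
    intro r hr
    refine ⟨NNReal.le_toNNReal_of_coe_le hr.1, min_eq_right ?_,
      Real.coe_toNNReal r (s.2.trans hr.1)⟩
    exact Real.toNNReal_le_iff_le_coe.mpr hr.2
  have key := H.sol_unique (v := fun r => v r.toNNReal) (Y := fun i r => X i r.toNNReal)
    (B := fun i r => A i r.toNNReal)
    (fun r hr i a => by
      obtain ⟨h1, h2, h3⟩ := hback r hr
      have := (h _ h1).1 i a
      rw [h2, h3] at this
      exact this)
    (fun r hr i => ((h _ (hback r hr).1).2.1 i).2)
    (fun r hr x => (h _ (hback r hr).1).2.2 x)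
  set t' := min (max τ s) t with ht'
  have hs' : s ≤ t' := le_min (le_max_right _ _) ht
  have hX : ∀ i, X i t = X i t' := fun i => by
    funext a
    rw [((h t ht).1 i a).2, ((h t' hs').1 i a).2, ← ht', min_eq_right (min_le_left _ _)]
  have hA : ∀ i x, A i t x = A i t' x := fun i x => by
    have h1 := ((h t' hs').2.1 i).1 (A i t x)
    rw [← hX, ((h t ht).2.1 i).2 x] at h1
    exact h1.symm
  have hv : v t = v t' := by
    funext x
    rw [(h t ht).2.2, (h t' hs').2.2]
    simp only [hA]
  funext x
  have h1 := (key t' (stopped_mem ht)).1 x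
  simp only [Real.toNNReal_coe] at h1
  rw [hv, h1, winSol]

theorem winSol_self [NeZero N] (H : IsData s (max τ s : ℝ≥0) G (incr w s) g) :
    winSol s τ w g s = g := by
  funext x
  rw [winSol, min_eq_right (le_max_right _ _), H.sol_zero]

theorem isCk_winSol {n : ℕ} (H : IsData s (max τ s : ℝ≥0) G (incr w s) g) (hg : ContDiff ℝ n g)
    {t : ℝ≥0} (ht : s ≤ t) : IsCk n (winSol s τ w g t) :=
  H.isCk_sol hg (stopped_mem ht)

theorem tendsto_ckNorm_winSol {n : ℕ} (H : IsData s (max τ s : ℝ≥0) G (incr w s) g)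
    (hg : ContDiff ℝ n g) {t : ℝ≥0} (ht : s ≤ t) :
    Tendsto (fun r => ckNorm n (winSol s τ w g r - winSol s τ w g t)) (𝓝[Ici s] t) (𝓝 0) := by
  refine (H.tendsto_ckNorm_sol hg (stopped_mem ht)).comp
    (f := fun r : ℝ≥0 => ((min (max τ s) r : ℝ≥0) : ℝ)) (tendsto_nhdsWithin_iff.mpr ⟨?_, ?_⟩)
  · exact (Continuous.tendsto (by fun_prop) t).mono_left nhdsWithin_le_nhds
  · exact eventually_mem_nhdsWithin.mono fun r hr => stopped_mem hr

section Measurability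

variable {Ω : Type*} {m : MeasurableSpace Ω} {V : Fin N → ℝ≥0 → Ω → ℝ} {f : Ω → ℝ → ℝ}

theorem measurable_incr {t r : ℝ≥0} (hst : s ≤ t) (hV : ∀ i, ∀ r ≤ t, Measurable (V i r))
    (hr : r ≤ t) : ∀ q ∈ Icc (s : ℝ) r, ∀ i, Measurable fun ω => incr (fun i r => V i r ω) s i q :=
  fun _ hq i => (hV i _ ((Real.toNNReal_le_iff_le_coe.mpr hq.2).trans hr)).sub (hV i s hst)

theorem measurable_winSol (H : ∀ ω, IsData s (max τ s : ℝ≥0) G (incr (fun i r => V i r ω) s) (f ω))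
    {t : ℝ≥0} (ht : s ≤ t) (hV : ∀ i, ∀ r ≤ t, Measurable (V i r)) (hf : Measurable f) :
    Measurable fun ω => winSol s τ (fun i r => V i r ω) (f ω) t :=
  measurable_pi_lambda _ fun x => measurable_sol H (stopped_mem ht)
    (measurable_incr ht hV (min_le_right _ _)) (fun x => (measurable_pi_apply x).comp hf) x

theorem measurable_winPos (H : ∀ ω, IsData s (max τ s : ℝ≥0) G (incr (fun i r => V i r ω) s) (f ω))
    {t : ℝ≥0} (ht : s ≤ t) (hV : ∀ i, ∀ r ≤ t, Measurable (V i r)) (hf : Measurable f)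
    (i : Fin N) : Measurable fun ω => winPos s τ (fun i r => V i r ω) (f ω) i t :=
  measurable_pi_lambda _ fun x => measurable_pos H (stopped_mem ht)
    (measurable_incr ht hV (min_le_right _ _)) (fun x => (measurable_pi_apply x).comp hf) i x

end Measurability

section Controlled

variable {n : ℕ} {K U : ℝ} {t₀ : ℝ≥0}

/-- The clock of `Controlled` is the time elapsed since `t₀` before stopping at `τ`; a window that
starts after `τ` does not advance it. -/
theorem stopped_sub {t : ℝ≥0} (ht : s ≤ t) :
    ((min s τ : ℝ≥0) : ℝ) - t₀ + ((min (max τ s) t : ℝ≥0) - s) = (min t τ : ℝ≥0) - t₀ := by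
  rcases le_total s τ with h | h
  · rw [min_eq_left h, max_eq_left h, min_comm]; ring
  · rw [min_eq_right h, max_eq_right h, min_eq_left ht, min_eq_right (h.trans ht)]; ring

theorem le_stopped (h₀ : t₀ ≤ s) (hτ : t₀ ≤ τ) : 0 ≤ ((min s τ : ℝ≥0) : ℝ) - t₀ :=
  sub_nonneg.mpr (NNReal.coe_le_coe.mpr (le_min h₀ hτ))

theorem Controlled.isData_win (hc : Controlled K U n ((min s τ : ℝ≥0) - t₀) g) (hK : 0 ≤ K)
    (hT : 100 * (K + 1) * ((τ : ℝ) - t₀) ≤ 1) (h₀ : t₀ ≤ s) (hτ : t₀ ≤ τ)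
    (hw : ∀ i, Continuous (w i)) :
    IsData s (max τ s : ℝ≥0) (K / (1 - 3 * K * ((min s τ : ℝ≥0) - t₀))) (incr w s) g := by
  refine hc.isData hK (le_stopped h₀ hτ) hT (NNReal.coe_le_coe.mpr (le_max_right _ _)) ?_
    (continuous_incr hw s) (incr_self w s)
  have := stopped_sub (τ := τ) (t₀ := t₀) (le_max_right τ s)
  rw [min_self, min_eq_right (le_max_left τ s)] at this
  exact this.le

theorem Controlled.win (hc : Controlled K U n ((min s τ : ℝ≥0) - t₀) g) (hK : 0 ≤ K) (hKU : K ≤ U)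
    (hT : 100 * (K + 1) * ((τ : ℝ) - t₀) ≤ 1) (h₀ : t₀ ≤ s) (hτ : t₀ ≤ τ)
    (hw : ∀ i, Continuous (w i)) {t : ℝ≥0} (ht : s ≤ t) :
    Controlled K U n ((min t τ : ℝ≥0) - t₀) (winSol s τ w g t) := by
  rw [← stopped_sub ht]
  refine hc.sol hK hKU (le_stopped h₀ hτ) hT (NNReal.coe_le_coe.mpr (le_max_right _ _)) ?_
    (continuous_incr hw s) (incr_self w s) (stopped_mem ht)
  have := stopped_sub (τ := τ) (t₀ := t₀) (le_max_right τ s)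
  rw [min_self, min_eq_right (le_max_left τ s)] at this
  exact this.le

end Controlled

end Path

/-! ### The reset system along one path of the driving processes -/

section Reset

/-- The `k`-th resetting time. -/
noncomputable def node (t₀ δ : ℝ≥0) (k : ℕ) : ℝ≥0 := t₀ + k * δ

variable {N : ℕ} {t₀ τ δ : ℝ≥0} {w : Fin N → ℝ≥0 → ℝ} {g : ℝ → ℝ}

theorem node_zero (t₀ δ : ℝ≥0) : node t₀ δ 0 = t₀ := by simp [node]

theorem node_succ (t₀ δ : ℝ≥0) (k : ℕ) : node t₀ δ (k + 1) = t₀ + (k + 1) * δ := by simp [node]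

theorem le_node (t₀ δ : ℝ≥0) (k : ℕ) : t₀ ≤ node t₀ δ k := le_self_add

theorem node_lt_succ (hδ : 0 < δ) (t₀ : ℝ≥0) (k : ℕ) : node t₀ δ k < node t₀ δ (k + 1) := by
  rw [node_succ, add_mul, ← add_assoc, one_mul]
  exact lt_add_of_pos_right _ hδ

theorem exists_node_ge (hδ : 0 < δ) (t₀ t : ℝ≥0) : ∃ k, t ≤ node t₀ δ k := by
  obtain ⟨k, hk⟩ := exists_nat_ge (t / δ)
  exact ⟨k, ((div_le_iff₀ hδ).mp hk).trans le_add_self⟩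

theorem exists_mem_node (hδ : 0 < δ) {t : ℝ≥0} (ht : t₀ < t) :
    ∃ k, t ∈ Ioc (node t₀ δ k) (node t₀ δ (k + 1)) := by
  classical
  have h := exists_node_ge hδ t₀ t
  have h0 : Nat.find h ≠ 0 := fun h0 => by
    have := Nat.find_spec h
    rw [h0, node_zero] at this
    exact absurd ht this.not_gt
  obtain ⟨k, hk⟩ := Nat.exists_eq_succ_of_ne_zero h0
  refine ⟨k, not_le.mp (Nat.find_min h (by omega)), ?_⟩
  rw [← Nat.succ_eq_add_one, ← hk]
  exact Nat.find_spec h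

/-- The data at the `k`-th resetting time. -/
noncomputable def resetData (t₀ δ τ : ℝ≥0) (w : Fin N → ℝ≥0 → ℝ) (g : ℝ → ℝ) : ℕ → ℝ → ℝ
  | 0 => g
  | k + 1 => winSol (node t₀ δ k) τ w (resetData t₀ δ τ w g k) (node t₀ δ (k + 1))

/-- The index of the window that contains a given time. -/
noncomputable def window (t₀ δ t : ℝ≥0) : ℕ := ⌈(t - t₀) / δ⌉₊ - 1

theorem window_eq (hδ : 0 < δ) {k : ℕ} {t : ℝ≥0}
    (ht : t ∈ Ioc (node t₀ δ k) (node t₀ δ (k + 1))) : window t₀ δ t = k := by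
  have h0 : t₀ ≤ t := (le_node t₀ δ k).trans ht.1.le
  have h : ⌈(t - t₀) / δ⌉₊ = k + 1 := by
    rw [Nat.ceil_eq_iff (Nat.succ_ne_zero k), Nat.succ_sub_one, lt_div_iff₀ hδ,
      div_le_iff₀ hδ, lt_tsub_iff_left, tsub_le_iff_left, Nat.succ_eq_add_one]
    exact ⟨ht.1, ht.2⟩
  rw [window, h, Nat.add_sub_cancel]

open Classical in
/-- The solution of the reset system. -/
noncomputable def resetSol (t₀ δ τ : ℝ≥0) (w : Fin N → ℝ≥0 → ℝ) (g : ℝ → ℝ) (t : ℝ≥0) : ℝ → ℝ :=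
  if t ≤ t₀ then g else
    winSol (node t₀ δ (window t₀ δ t)) τ w (resetData t₀ δ τ w g (window t₀ δ t)) t

theorem resetSol_of_mem (hδ : 0 < δ) {k : ℕ} {t : ℝ≥0}
    (ht : t ∈ Ioc (node t₀ δ k) (node t₀ δ (k + 1))) :
    resetSol t₀ δ τ w g t = winSol (node t₀ δ k) τ w (resetData t₀ δ τ w g k) t := by
  rw [resetSol, if_neg (((le_node t₀ δ k).trans_lt ht.1).not_ge), window_eq hδ ht]

theorem resetSol_node (hδ : 0 < δ) (k : ℕ) :
    resetSol t₀ δ τ w g (node t₀ δ k) = resetData t₀ δ τ w g k := by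
  cases k with
  | zero => rw [node_zero, resetSol, if_pos le_rfl, resetData]
  | succ k =>
    rw [resetSol_of_mem hδ ⟨node_lt_succ hδ t₀ k, le_rfl⟩, resetData]

/-- `u` solves the reset system along one path, as far as the data on the windows are controlled. -/
structure IsPathReset (K U : ℝ) (n : ℕ) (t₀ δ τ : ℝ≥0) (w : Fin N → ℝ≥0 → ℝ)
    (u : ℝ≥0 → ℝ → ℝ) : Prop where
  contw : ∀ i, Continuous (w i)
  pos : 0 < δ
  le : t₀ ≤ τ
  nonneg : 0 ≤ K
  le_bound : K ≤ U
  small : 100 * (K + 1) * ((τ : ℝ) - t₀) ≤ 1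
  initial : Controlled K U n 0 (u t₀)
  step : ∀ k, Controlled K U n ((min (node t₀ δ k) τ : ℝ≥0) - t₀) (u (node t₀ δ k)) →
    ∀ t ∈ Ioc (node t₀ δ k) (node t₀ δ (k + 1)), u t = winSol (node t₀ δ k) τ w (u (node t₀ δ k)) t

variable {K U : ℝ} {n : ℕ} {u : ℝ≥0 → ℝ → ℝ}

theorem IsPathReset.controlled_of (h : IsPathReset K U n t₀ δ τ w u) {k : ℕ}
    (hk : Controlled K U n ((min (node t₀ δ k) τ : ℝ≥0) - t₀) (u (node t₀ δ k))) {t : ℝ≥0}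
    (ht : t ∈ Ioc (node t₀ δ k) (node t₀ δ (k + 1))) :
    Controlled K U n ((min t τ : ℝ≥0) - t₀) (u t) := by
  rw [h.step k hk t ht]
  exact hk.win h.nonneg h.le_bound h.small (le_node _ _ _) h.le h.contw ht.1.le

/-- The field `step` identifies `u` on a window only when its data are controlled, since uniqueness
requires a short window; the control and the identification therefore advance together. -/
theorem IsPathReset.controlled_node (h : IsPathReset K U n t₀ δ τ w u) (k : ℕ) :
    Controlled K U n ((min (node t₀ δ k) τ : ℝ≥0) - t₀) (u (node t₀ δ k)) := by
  induction k with
  | zero => rw [node_zero, min_eq_left h.le, sub_self]; exact h.initial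
  | succ k ih => exact h.controlled_of ih ⟨node_lt_succ h.pos t₀ k, le_rfl⟩

theorem IsPathReset.controlled (h : IsPathReset K U n t₀ δ τ w u) {t : ℝ≥0} (ht : t₀ ≤ t) :
    Controlled K U n ((min t τ : ℝ≥0) - t₀) (u t) := by
  rcases ht.eq_or_lt with rfl | ht
  · have := h.controlled_node 0
    rwa [node_zero] at this
  · obtain ⟨k, hk⟩ := exists_mem_node h.pos ht
    exact h.controlled_of (h.controlled_node k) hk

theorem IsPathReset.isData (h : IsPathReset K U n t₀ δ τ w u) (k : ℕ) :
    IsData (node t₀ δ k) (max τ (node t₀ δ k) : ℝ≥0)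
      (K / (1 - 3 * K * ((min (node t₀ δ k) τ : ℝ≥0) - t₀))) (incr w (node t₀ δ k))
      (u (node t₀ δ k)) :=
  (h.controlled_node k).isData_win h.nonneg h.small (le_node _ _ _) h.le h.contw

theorem tendsto_within_union {n : ℕ} {u : ℝ≥0 → ℝ → ℝ} {A B : Set ℝ≥0} (hA : IsClosed A)
    (hB : IsClosed B)
    (huA : ∀ t ∈ A, Tendsto (fun r => ckNorm n (u r - u t)) (𝓝[A] t) (𝓝 0))
    (huB : ∀ t ∈ B, Tendsto (fun r => ckNorm n (u r - u t)) (𝓝[B] t) (𝓝 0)) :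
    ∀ t ∈ A ∪ B, Tendsto (fun r => ckNorm n (u r - u t)) (𝓝[A ∪ B] t) (𝓝 0) := by
  have key : ∀ {C : Set ℝ≥0}, IsClosed C →
      (∀ t ∈ C, Tendsto (fun r => ckNorm n (u r - u t)) (𝓝[C] t) (𝓝 0)) →
      ∀ t, Tendsto (fun r => ckNorm n (u r - u t)) (𝓝[C] t) (𝓝 0) := by
    intro C hC h t
    by_cases ht : t ∈ C
    · exact h t ht
    · rw [notMem_closure_iff_nhdsWithin_eq_bot.mp (by rwa [hC.closure_eq])]
      exact tendsto_bot
  intro t _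
  rw [nhdsWithin_union]
  exact (key hA huA t).sup (key hB huB t)

theorem IsPathReset.tendsto_ckNorm [NeZero N] (h : IsPathReset K U n t₀ δ τ w u) {t : ℝ≥0}
    (ht : t ∈ Icc t₀ τ) :
    Tendsto (fun r => ckNorm n (u r - u t)) (𝓝[Icc t₀ τ] t) (𝓝 0) := by
  -- The left endpoint may be included because the window solution starts from its data. The closed
  -- windows can then be glued.
  have hwin : ∀ k, ∀ t ∈ Icc (node t₀ δ k) (node t₀ δ (k + 1)),
      u t = winSol (node t₀ δ k) τ w (u (node t₀ δ k)) t := by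
    intro k t ht
    rcases ht.1.eq_or_lt with rfl | h1
    · exact (winSol_self (h.isData k)).symm
    · exact h.step k (h.controlled_node k) t ⟨h1, ht.2⟩
  have hstep : ∀ k, ∀ t ∈ Icc (node t₀ δ k) (node t₀ δ (k + 1)),
      Tendsto (fun r => ckNorm n (u r - u t)) (𝓝[Icc (node t₀ δ k) (node t₀ δ (k + 1))] t)
        (𝓝 0) := by
    intro k t ht
    refine ((tendsto_ckNorm_winSol (h.isData k) (h.controlled_node k).isCk.2 ht.1).mono_left
      (nhdsWithin_mono t Icc_subset_Ici_self)).congr' ?_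
    filter_upwards [self_mem_nhdsWithin] with r hr
    rw [hwin k t ht, hwin k r hr]
  have hall : ∀ k, ∀ t ∈ Icc t₀ (node t₀ δ k),
      Tendsto (fun r => ckNorm n (u r - u t)) (𝓝[Icc t₀ (node t₀ δ k)] t) (𝓝 0) := by
    intro k
    induction k with
    | zero =>
      intro t ht
      rw [node_zero, Icc_self, mem_singleton_iff] at ht
      rw [node_zero, Icc_self, ht, nhdsWithin_singleton, tendsto_pure_left]
      intro s hs
      have h0 : ckNorm n (u t₀ - u t₀) = 0 := by
        rw [sub_self]
        refine le_antisymm ?_ (ckNorm_nonneg _ _)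
        refine (ckNorm_le le_rfl fun j _ x => ?_).trans (mul_zero _).le
        simp
      rw [h0]
      exact mem_of_mem_nhds hs
    | succ k ih =>
      rw [← Icc_union_Icc_eq_Icc (le_node t₀ δ k) (node_lt_succ h.pos t₀ k).le]
      exact tendsto_within_union isClosed_Icc isClosed_Icc ih (hstep k)
  obtain ⟨k, hk⟩ := exists_node_ge h.pos t₀ τ
  exact (hall k t ⟨ht.1, ht.2.trans hk⟩).mono_left (nhdsWithin_mono t (Icc_subset_Icc_right hk))

theorem isPathReset_resetSol (hw : ∀ i, Continuous (w i)) (hδ : 0 < δ) (hτ : t₀ ≤ τ) (hK : 0 ≤ K)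
    (hKU : K ≤ U) (hT : 100 * (K + 1) * ((τ : ℝ) - t₀) ≤ 1) (hg : Controlled K U n 0 g) :
    IsPathReset K U n t₀ δ τ w (resetSol t₀ δ τ w g) where
  contw := hw
  pos := hδ
  le := hτ
  nonneg := hK
  le_bound := hKU
  small := hT
  initial := by rwa [resetSol, if_pos le_rfl]
  step k _ t ht := by rw [resetSol_of_mem hδ ht, resetSol_node hδ]

end Reset
/-! ### Solutions adapted to a filtration -/

section Solution

variable {Ω : Type*} {mΩ : MeasurableSpace Ω} {F : Filtration ℝ≥0 mΩ} {P : Measure Ω} {N : ℕ}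
  {V W : Fin N → ℝ≥0 → Ω → ℝ} {f : Ω → ℝ → ℝ} {t₀ s τ δ : ℝ≥0}

theorem adapted_winSol {G : ℝ}
    (H : ∀ ω, IsData s (max τ s : ℝ≥0) G (incr (fun i r => V i r ω) s) (f ω))
    (hV : ∀ i t, Measurable[F t] (V i t)) (hf : Measurable[F s] f) {t : ℝ≥0} (ht : s ≤ t) :
    Measurable[F t] fun ω => winSol s τ (fun i r => V i r ω) (f ω) t :=
  measurable_winSol (m := F t) H ht (fun i r hr => (hV i r).mono (F.mono hr) le_rfl)
    (hf.mono (F.mono ht) le_rfl)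

/-- The construction uses the continuous version `V` for every `ω`; the equations for `W` follow
where the two agree, and uniqueness up to indistinguishability follows from uniqueness along paths.
-/
theorem isSolution_winSol {G : ℝ}
    (H : ∀ ω, IsData s (max τ s : ℝ≥0) G (incr (fun i r => V i r ω) s) (f ω))
    (hV : ∀ i t, Measurable[F t] (V i t)) (hVW : ∀ᵐ ω ∂P, ∀ i t, V i t ω = W i t ω)
    (hf : Measurable[F s] f) (hf' : ∀ ω, ContDiff ℝ 1 (f ω)) :
    IsSolution F P W s τ f fun t ω => winSol s τ (fun i r => V i r ω) (f ω) t := by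
  refine ⟨⟨⟨?_, ?_, fun t ht => ?_⟩, fun i t ω => winPos s τ (fun i r => V i r ω) (f ω) i t,
    fun i t ω => winBack s τ (fun i r => V i r ω) (f ω) i t, fun i t ht => ?_, ?_⟩, ?_⟩
  · exact ae_of_all _ fun ω t ht => isCk_winSol (H ω) (by exact_mod_cast hf' ω) ht.1
  · exact ae_of_all _ fun ω t ht => (tendsto_ckNorm_winSol (n := 1) (H ω)
      (by exact_mod_cast hf' ω) ht.1).mono_left (nhdsWithin_mono t Icc_subset_Ici_self)
  · exact (adapted_winSol H hV hf (le_min (le_max_right _ _) ht)).mono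
      (F.mono (min_le_right _ _)) le_rfl
  · exact measurable_winPos (m := F t) H ht (fun i r hr => (hV i r).mono (F.mono hr) le_rfl)
      (hf.mono (F.mono ht) le_rfl) i
  · filter_upwards [hVW] with ω hω
    have h := isPathFixedPoint_win (H ω)
    intro t ht
    simpa only [hω] using h t ht
  · rintro v ⟨_, X, A, _, h⟩
    filter_upwards [hVW, h] with ω hω hv t ht
    refine IsPathFixedPoint.eq_winSol (v := fun t => v t ω) (X := fun i t => X i t ω)
      (A := fun i t => A i t ω) (H ω) (fun t ht => ?_) ht
    simpa only [hω] using hv t ht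

/-- The reset system has a solution when the driving processes have continuous paths. -/
theorem exists_isResetSolution [NeZero N] (hVc : ∀ ω i, Continuous fun t => V i t ω)
    (hV : ∀ i t, Measurable[F t] (V i t)) (hVW : ∀ᵐ ω ∂P, ∀ i t, V i t ω = W i t ω)
    {g : Ω → ℝ → ℝ} (hg : IsCkRandomVariable F t₀ 1 g) (hgf : ∀ᵐ ω ∂P, g ω = f ω) {K : ℝ≥0}
    (hlip : ∀ ω x y, |g ω x - g ω y| ≤ K * |x - y|) (hδ : 0 < δ) (hτ : t₀ ≤ τ)
    (hT : 100 * ((K : ℝ) + 1) * (τ - t₀) ≤ 1) :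
    ∃ u : ℝ≥0 → Ω → ℝ → ℝ, IsCkProcess F P t₀ τ 1 u ∧ IsResetSolution F P W δ t₀ τ f u := by
  set D : ℕ → Ω → ℝ → ℝ := fun k ω => resetData t₀ δ τ (fun i r => V i r ω) (g ω) k with hD
  set u : ℝ≥0 → Ω → ℝ → ℝ := fun t ω => resetSol t₀ δ τ (fun i r => V i r ω) (g ω) t with hu
  -- The Lipschitz constant `K` is deterministic, as it fixes the time. The other bound may depend
  -- on the path, since existence only needs it to be finite.
  have hreset : ∀ ω, IsPathReset K (max K (ckNorm 1 (g ω))) 1 t₀ δ τ (fun i r => V i r ω)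
      fun t => u t ω := fun ω =>
    isPathReset_resetSol (hVc ω) hδ hτ K.2 (le_max_left _ _) hT
      (Controlled.initial (hg.mem ω) (le_max_right _ _) (hlip ω))
  have hnode : ∀ k, u (node t₀ δ k) = D k := fun k => funext fun ω => resetSol_node hδ k
  have hdata := fun k ω => (hreset ω).isData k
  have hck := fun k ω => ((hreset ω).controlled_node k).isCk
  simp only [hnode] at hdata hck
  have hwin : ∀ k, ∀ t ∈ Ioc (node t₀ δ k) (node t₀ δ (k + 1)),
      u t = fun ω => winSol (node t₀ δ k) τ (fun i r => V i r ω) (D k ω) t :=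
    fun k t ht => funext fun ω => resetSol_of_mem hδ ht
  have hDm : ∀ k, Measurable[F (node t₀ δ k)] (D k) := by
    intro k
    induction k with
    | zero => rw [node_zero]; exact hg.measurable
    | succ k ih =>
      rw [← hnode, hwin k _ ⟨node_lt_succ hδ t₀ k, le_rfl⟩]
      exact adapted_winSol (hdata k) hV ih (node_lt_succ hδ t₀ k).le
  have hum : ∀ t, t₀ ≤ t → Measurable[F t] (u t) := by
    intro t ht
    rcases ht.eq_or_lt with rfl | ht
    · have := hDm 0
      rw [← hnode] at this
      rwa [node_zero] at this
    · obtain ⟨k, hk⟩ := exists_mem_node hδ ht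
      rw [hwin k t hk]
      exact adapted_winSol (hdata k) hV (hDm k) hk.1.le
  refine ⟨u, ⟨ae_of_all _ fun ω t ht => ?_, ae_of_all _ fun ω t ht => ?_, fun t ht => ?_⟩, ?_,
    fun k => ?_⟩
  · exact ((hreset ω).controlled ht.1).isCk
  · rw [max_eq_left hτ] at ht ⊢
    exact (hreset ω).tendsto_ckNorm ht
  · exact (hum _ (le_min (le_max_right _ _) ht)).mono (F.mono (min_le_right _ _)) le_rfl
  · filter_upwards [hgf] with ω hω
    rw [← hω]
    exact if_pos le_rfl
  · refine ⟨fun t ω => winSol (node t₀ δ k) τ (fun i r => V i r ω) (D k ω) t, ?_, ?_⟩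
    · have h := isSolution_winSol (hdata k) hV hVW (hDm k)
        (fun ω => by exact_mod_cast (hck k ω).2)
      rw [← hnode] at h ⊢
      exact h
    · rw [← node_succ]
      exact ae_of_all _ fun ω t ht => congrFun (hwin k t ht) ω

/-- Almost every path of a solution of the reset system solves the reset system along the path. -/
theorem IsResetSolution.ae_isPathReset {u : ℝ≥0 → Ω → ℝ → ℝ}
    (h : IsResetSolution F P W δ t₀ τ f u) (hW : ∀ᵐ ω ∂P, ∀ i, Continuous fun t => W i t ω)
    {n : ℕ} {K U : ℝ≥0} (hf : ∀ᵐ ω ∂P, Controlled K U n 0 (f ω)) (hδ : 0 < δ) (hτ : t₀ ≤ τ)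
    (hKU : K ≤ U) (hT : 100 * ((K : ℝ) + 1) * (τ - t₀) ≤ 1) :
    ∀ᵐ ω ∂P, IsPathReset K U n t₀ δ τ (fun i r => W i r ω) fun t => u t ω := by
  have hstep : ∀ᵐ ω ∂P, ∀ k,
      Controlled K U n ((min (node t₀ δ k) τ : ℝ≥0) - t₀) (u (node t₀ δ k) ω) →
      (∀ i, Continuous fun t => W i t ω) → ∀ t ∈ Ioc (node t₀ δ k) (node t₀ δ (k + 1)),
        u t ω = winSol (node t₀ δ k) τ (fun i r => W i r ω) (u (node t₀ δ k) ω) t := by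
    refine ae_all_iff.mpr fun k => ?_
    obtain ⟨v, ⟨⟨_, X, A, _, hv⟩, _⟩, huv⟩ := h.2 k
    filter_upwards [hv, huv] with ω hω huω hc hw t ht
    rw [node_succ] at ht
    rw [huω t ht]
    exact IsPathFixedPoint.eq_winSol (v := fun t => v t ω) (X := fun i t => X i t ω)
      (A := fun i t => A i t ω) (hc.isData_win K.2 hT (le_node _ _ _) hτ hw) hω ht.1.le
  filter_upwards [h.1, hW, hf, hstep] with ω h0 hw hc hs
  exact ⟨hw, hδ, hτ, K.2, NNReal.coe_le_coe.mpr hKU, hT, by rwa [h0], fun k hk => hs k hk hw⟩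

end Solution
end BurgersReset

/-! ### The choice of the time and of the bounds. -/

theorem mainTheorem6 :
    ∃ (T : ℝ≥0 → ℝ≥0) (U : ℝ≥0 → ℕ → ℝ≥0), (∀ c, 0 < T c) ∧
      ∀ (Ω : Type*) (mΩ : MeasurableSpace Ω) (P : Measure Ω) (_ : IsProbabilityMeasure P)
        (F : Filtration ℝ≥0 mΩ) (_ : BurgersReset.UsualConditions F P)
        (N : ℕ) (_ : 2 ≤ N)
        (W : Fin N → ℝ≥0 → Ω → ℝ) (_ : BurgersReset.IsWienerFamily F P W)
        (t₀ : ℝ≥0) (f : Ω → ℝ → ℝ) (_ : BurgersReset.IsCkRandomVariable F t₀ 1 f)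
        (U₁ : ℝ≥0) (_ : ∀ᵐ ω ∂P, BurgersReset.ckNorm 1 (f ω) ≤ U₁)
        (δ : ℝ≥0) (_ : 0 < δ),
        (∃ u : ℝ≥0 → Ω → ℝ → ℝ, BurgersReset.IsCkProcess F P t₀ (t₀ + T U₁) 1 u ∧
          BurgersReset.IsResetSolution F P W δ t₀ (t₀ + T U₁) f u) ∧
        ∀ u : ℝ≥0 → Ω → ℝ → ℝ, BurgersReset.IsCkProcess F P t₀ (t₀ + T U₁) 1 u →
          BurgersReset.IsResetSolution F P W δ t₀ (t₀ + T U₁) f u →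
          ∀ n : ℕ, 1 ≤ n → BurgersReset.IsCkRandomVariable F t₀ n f →
          ∀ Uₙ : ℝ≥0, (∀ᵐ ω ∂P, BurgersReset.ckNorm n (f ω) ≤ Uₙ) →
            BurgersReset.IsCkProcess F P t₀ (t₀ + T U₁) n u ∧
            (δ < t₀ + T U₁ →
              ∀ᵐ ω ∂P, ∀ t ∈ Icc t₀ (t₀ + T U₁),
                BurgersReset.ckNorm n (u t ω) ≤ U Uₙ n) := by
  -- This time gives equality in the smallness condition of `IsPathReset` for `K = c`.
  refine ⟨fun c => 1 / (100 * (c + 1)),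
    fun c n => ((n + 1) * BurgersReset.derivBound c n).toNNReal, fun c => by positivity, ?_⟩
  intro Ω mΩ P _ F hF N hN W hW t₀ f hf U₁ hU₁ δ hδ
  have : NeZero N := ⟨by omega⟩
  have hτ : t₀ ≤ t₀ + 1 / (100 * (U₁ + 1)) := le_self_add
  have hT : ∀ K : ℝ≥0, K ≤ U₁ →
      100 * ((K : ℝ) + 1) * ((t₀ + 1 / (100 * (U₁ + 1)) : ℝ≥0) - t₀) ≤ 1 := by
    intro K hK
    have hK' : (K : ℝ) ≤ U₁ := by exact_mod_cast hK
    have hU0 : (0 : ℝ) ≤ U₁ := U₁.2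
    push_cast
    rw [add_sub_cancel_left, mul_one_div, div_le_one (by positivity)]
    linarith
  constructor
  · have hVex := fun i => BurgersReset.exists_continuous_adapted hF (hW.adapted i)
      (hW.brownian i).cont
    choose V hVc hVm hVW using hVex
    obtain ⟨g, hg, hlip, hgf⟩ := hf.exists_lip le_rfl hU₁
    exact BurgersReset.exists_isResetSolution (fun ω i => hVc i ω) hVm (ae_all_iff.mpr hVW) hg hgf
      hlip hδ hτ (hT U₁ le_rfl)
  · intro u hu hsol n hn hfn Uₙ hUₙ
    -- The time is chosen from `U₁` while the bound may involve `Uₙ` only, and the two are not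
    -- ordered. Both bound the Lipschitz constant of the data, so their minimum meets both
    -- requirements.
    have hc : ∀ᵐ ω ∂P, BurgersReset.Controlled (min U₁ Uₙ : ℝ≥0) Uₙ n 0 (f ω) := by
      filter_upwards [hU₁, hUₙ] with ω h1 h2
      refine BurgersReset.Controlled.initial (hfn.mem ω) h2 fun x y => ?_
      rw [NNReal.coe_min, min_mul_of_nonneg _ _ (abs_nonneg _)]
      exact le_min
        (((hf.mem ω).lip le_rfl x y).trans (mul_le_mul_of_nonneg_right h1 (abs_nonneg _)))
        (((hfn.mem ω).lip hn x y).trans (mul_le_mul_of_nonneg_right h2 (abs_nonneg _)))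
    have hpath := hsol.ae_isPathReset (ae_all_iff.mpr fun i => (hW.brownian i).cont) hc hδ hτ
      (min_le_right _ _) (hT _ (min_le_left _ _))
    -- Adaptedness does not involve the order of differentiability and is inherited; the remaining
    -- properties hold along almost every path.
    refine ⟨⟨?_, ?_, hu.adapted⟩, fun _ => ?_⟩
    · filter_upwards [hpath] with ω h t ht
      exact (h.controlled ht.1).isCk
    · filter_upwards [hpath] with ω h t ht
      rw [max_eq_left hτ] at ht ⊢
      exact h.tendsto_ckNorm ht
    · filter_upwards [hpath] with ω h t ht
      refine ((h.controlled ht.1).ckNorm_le h.nonneg h.le_bound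
        (BurgersReset.le_stopped ht.1 hτ) h.small ?_).trans (Real.le_coe_toNNReal _)
      exact sub_le_sub_right (NNReal.coe_le_coe.mpr (min_le_right _ _)) _
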